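/- Let $T$ be a finite tree embedded in an oriented disk $D^2$ so that exactly the leaves lie on the boundary circle and every interior (non-leaf) vertex has degree at least $3$. The regions into which $T$ cuts $D^2$ are its faces; a corner is a pair $(v,F)$ of an interior vertex $v$ and a face $F$ containing $v$, and $(v,F')$ is immediately clockwise from $(v,F)$ if $F'$ is the next face after $F$ clockwise around $v$. An arc (resp. a segment) is a path in $T$ between two distinct leaves (resp. two distinct interior vertices) any two consecutive edges of which are incident to a common face. An arc contains the corner $(v,F)$ if it passes through $v$ along two edges incident to $F$. An arc $p$ divides the set of faces into two regions, and $\mathrm{Reg}(p,F)$ is the one containing $F$. Two arcs cross if they share a segment and no region of either one is contained in a region of the other. A boundary arc is an arc whose vertices all lie on one face. The reduced noncrossing complex has as simplices the sets of pairwise noncrossing non-boundary arcs; its maximal simplices are called facets. An arc $p$ of a facet $\mathcal F$ is marked at a corner $(v,F)$ that it contains if $\mathrm{Reg}(q,F)\subseteq\mathrm{Reg}(p,F)$ for every $q\in\mathcal F$ containing $(v,F)$. The oriented flip graph $\overrightarrow{FG}(T)$ has the facets as vertices, and an edge $\mathcal F_1\to\mathcal F_2$ whenever $\mathcal F_2=(\mathcal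 F_1\setminus\{p\})\cup\{q\}$ with $p\in\mathcal F_1$, $q\notin\mathcal F_1$, and there are distinct vertices $u,v$ such that $p$ is marked in $\mathcal F_1$ at $(u,F),(v,G)$, $q$ is marked in $\mathcal F_2$ at $(u,F'),(v,G')$, and $(u,F'),(v,G')$ are immediately clockwise from $(u,F),(v,G)$ respectively. Write $\mathcal F\le\mathcal F'$ if there is a directed path, possibly of length $0$, from $\mathcal F$ to $\mathcal F'$. Let $P_T$ be the polygon whose vertices $v_F$ are indexed by the faces $F$ of $T$, in the same cyclic order as the faces around the disk. A polygonal subdivision of $P_T$ is given by its set of diagonals, a diagonal being an unordered pair of vertices. The dual subdivision $\mathcal P_T$ consists of the diagonals $\{v_F,v_G\}$ for which $F$ and $G$ are the two faces incident to an edge of $T$ between two interior vertices. An arc with end leaves $a,b$ corresponds to the diagonal $\{v_F,v_G\}$, where $a$ is the counterclockwise most leaf of $F$ and $b$ is the counterclockwise most leaf of $G$; for a facet $\mathcal F$, let $\mathcal P(\mathcal F)$ be the set of diagonals corresponding to its arcs. The rotation $\varrho$ moves both endpoints of every diagonal to the vertices of $P_T$ immediately clockwise from them. **Theorem.** The relation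 $\le$ is a partial order on the facets, and the map $\mathcal F\mapsto\mathcal P(\mathcal F)$ is injective. There is a smallest facet $\hat 0$ and a largest facet $\hat 1$ with respect to $\le$, and $$\mathcal P(\hat 0)=\mathcal P_T,\qquad \mathcal P(\hat 1)=\varrho(\mathcal P_T).$$ -/

import Mathlib

/-- A finite tree embedded in an oriented disk, with exactly the leaves on the boundary circle and
every interior vertex of degree at least three, up to orientation-preserving homeomorphism of the
disk. The embedding is recorded by its rotation system: `cw d` is the next oriented edge, in
clockwise order, around the initial vertex of the oriented edge `d`. For a tree every rotation
system comes from such an embedding, and the embedding is determined by it. -/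
structure PlaneTree (V : Type*) where
  /-- the underlying tree -/
  graph : SimpleGraph V
  isTree : graph.IsTree
  /-- the next oriented edge clockwise around the same initial vertex -/
  cw : Equiv.Perm graph.Dart
  cw_fst : ∀ d : graph.Dart, (cw d).fst = d.fst
  cw_sameCycle : ∀ d d' : graph.Dart, d.fst = d'.fst → cw.SameCycle d d'
  degree_cond : ∀ v : V,
    (graph.neighborSet v).ncard = 1 ∨ 3 ≤ (graph.neighborSet v).ncard

namespace PlaneTree

variable {V : Type*} (T : PlaneTree V)

/-- A leaf is a vertex of degree one; the other vertices are the interior vertices. -/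
def IsLeaf (v : V) : Prop := (T.graph.neighborSet v).ncard = 1

/-! ### Faces and corners -/

/-- Walk along `d` with a face on the left hand. If `d` ends at an interior vertex, the boundary of
that face continues with the edge that comes clockwise after the reverse of `d` there. If `d` ends
at a leaf, the boundary of the face has reached the circle. -/
def SideStep (d d' : T.graph.Dart) : Prop :=
  ¬ T.IsLeaf d.snd ∧ d' = T.cw d.symm

/-- The faces: the regions into which the tree cuts the disk. An oriented edge stands for its left
side, and two sides belong to the same face when they are linked by `SideStep`. -/
def Face : Type _ := Quot T.SideStep

/-- The face to the left of an oriented edge. -/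
def leftFace (d : T.graph.Dart) : T.Face := Quot.mk _ d

/-- The face to the right of an oriented edge. -/
def rightFace (d : T.graph.Dart) : T.Face := T.leftFace d.symm

/-- The face `F` is incident to the (unoriented) edge underlying `d`. -/
def Borders (F : T.Face) (d : T.graph.Dart) : Prop :=
  F = T.leftFace d ∨ F = T.rightFace d

/-- The vertex `v` lies on the face `F`. -/
def OnFace (v : V) (F : T.Face) : Prop :=
  ∃ d : T.graph.Dart, d.fst = v ∧ T.Borders F d

/-- The corner `(v, G)` is immediately clockwise from the corner `(v, F)`. The corner at `v` in the
face left of `d` lies between `d` and the edge that comes counterclockwise after `d`. -/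
def ImmediatelyClockwise (v : V) (F G : T.Face) : Prop :=
  ¬ T.IsLeaf v ∧
    ∃ d : T.graph.Dart, d.fst = v ∧ F = T.leftFace d ∧ G = T.leftFace (T.cw d)

/-! ### Arcs and segments -/

/-- `p` is the vertex set of an acyclic path of the tree with endpoints `a` and `b`. Acyclic paths
are identified with their vertex sets. -/
def IsAcyclicPath (p : Set V) (a b : V) : Prop :=
  ∃ w : T.graph.Walk a b, w.IsPath ∧ p = {v | v ∈ w.support}

/-- The edge underlying `d` is an edge of the path with vertex set `p`. -/
def EdgeOf (d : T.graph.Dart) (p : Set V) : Prop := d.fst ∈ p ∧ d.snd ∈ p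

/-- Any two consecutive edges of the path `p` are incident to a common face. -/
def TurnsAtCorners (p : Set V) : Prop :=
  ∀ d d' : T.graph.Dart, d.fst = d'.fst → d ≠ d' → T.EdgeOf d p → T.EdgeOf d' p →
    ∃ F : T.Face, T.Borders F d ∧ T.Borders F d'

/-- An arc: an acyclic path between two distinct leaves that turns at corners. -/
def IsArc (p : Set V) : Prop :=
  (∃ a b : V, a ≠ b ∧ T.IsLeaf a ∧ T.IsLeaf b ∧ T.IsAcyclicPath p a b) ∧ T.TurnsAtCorners p

/-- A segment: an acyclic path with at least two vertices, whose endpoints are not leaves, that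
turns at corners. -/
def IsSegment (s : Set V) : Prop :=
  (∃ a b : V, a ≠ b ∧ ¬ T.IsLeaf a ∧ ¬ T.IsLeaf b ∧ T.IsAcyclicPath s a b) ∧
    T.TurnsAtCorners s

/-- The arc `p` contains the corner `(v, F)`. -/
def ContainsCorner (p : Set V) (v : V) (F : T.Face) : Prop :=
  ¬ T.IsLeaf v ∧ ∃ d d' : T.graph.Dart, d.fst = v ∧ d'.fst = v ∧ d ≠ d' ∧
    T.EdgeOf d p ∧ T.EdgeOf d' p ∧ T.Borders F d ∧ T.Borders F d'

/-- Two faces share an edge of the tree that is not an edge of `p`. -/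
def AdjacentOff (p : Set V) (F G : T.Face) : Prop :=
  ∃ d : T.graph.Dart, ¬ T.EdgeOf d p ∧ F = T.leftFace d ∧ G = T.rightFace d

/-- `Reg p F`: the set of faces on the same side of `p` as `F`, that is, in the same connected
component of the complement of `p` in the disk. -/
def Reg (p : Set V) (F : T.Face) : Set T.Face :=
  {G | Relation.ReflTransGen (T.AdjacentOff p) F G}

/-- `R` is one of the regions defined by `p`. -/
def IsRegion (p : Set V) (R : Set T.Face) : Prop := ∃ F : T.Face, R = T.Reg p F

/-! ### The noncrossing complex -/

/-- The arcs `p` and `q` cross along the segment `s`. -/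
def CrossAlong (p q s : Set V) : Prop :=
  T.IsSegment s ∧ s ⊆ p ∧ s ⊆ q ∧
    ∀ Rp Rq : Set T.Face, T.IsRegion p Rp → T.IsRegion q Rq → ¬ Rp ⊆ Rq ∧ ¬ Rq ⊆ Rp

/-- The arcs `p` and `q` are noncrossing. -/
def Noncrossing (p q : Set V) : Prop := ∀ s : Set V, ¬ T.CrossAlong p q s

/-- A boundary arc: an arc whose vertices all lie on a common face. -/
def IsBoundaryArc (p : Set V) : Prop :=
  T.IsArc p ∧ ∃ F : T.Face, ∀ v ∈ p, T.OnFace v F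

/-- `S` is a simplex of the noncrossing complex. -/
def IsNoncrossingSet (S : Set (Set V)) : Prop :=
  (∀ p ∈ S, T.IsArc p) ∧ ∀ p ∈ S, ∀ q ∈ S, T.Noncrossing p q

/-- `S` is a simplex of the reduced noncrossing complex. -/
def IsReducedNoncrossingSet (S : Set (Set V)) : Prop :=
  T.IsNoncrossingSet S ∧ ∀ p ∈ S, ¬ T.IsBoundaryArc p

/-- The facets (maximal simplices) of the reduced noncrossing complex. -/
def Facet : Type _ := {S : Set (Set V) // Maximal T.IsReducedNoncrossingSet S}

/-- `p ∈ S` is marked at the corner `(v, F)`: it is the largest arc of `S` containing that corner,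
where arcs are compared by the inclusion of their regions containing `F`. The boundary arc that
contains `(v, F)` is the smallest arc at that corner, so it makes no difference for the other arcs
whether boundary arcs are included in `S`. -/
def Marked (S : Set (Set V)) (p : Set V) (v : V) (F : T.Face) : Prop :=
  p ∈ S ∧ T.ContainsCorner p v F ∧
    ∀ q ∈ S, T.ContainsCorner q v F → T.Reg q F ⊆ T.Reg p F

/-! ### The oriented flip graph -/

/-- The edge `S₁ ⟶ S₂` of the oriented flip graph: `S₂` arises from `S₁` by replacing an arc `p`
with another arc `q`, where `p` is marked in `S₁` at the corners `(u, F)` and `(v, G)`, `q` is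
marked in `S₂` at `(u, F')` and `(v, G')`, and `(u, F')`, `(v, G')` are immediately clockwise from
`(u, F)`, `(v, G)`, respectively. -/
def FlipEdge (S₁ S₂ : T.Facet) : Prop :=
  ∃ p q : Set V, p ∈ S₁.1 ∧ q ∉ S₁.1 ∧ S₂.1 = (S₁.1 \ {p}) ∪ {q} ∧
    ∃ (u v : V) (F G F' G' : T.Face), u ≠ v ∧
      T.Marked S₁.1 p u F ∧ T.Marked S₁.1 p v G ∧
      T.Marked S₂.1 q u F' ∧ T.Marked S₂.1 q v G' ∧
      T.ImmediatelyClockwise u F F' ∧ T.ImmediatelyClockwise v G G'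

/-- Facets are compared by reachability along the edges of the oriented flip graph. -/
instance : Preorder T.Facet where
  le := Relation.ReflTransGen T.FlipEdge
  le_refl _ := Relation.ReflTransGen.refl
  le_trans _ _ _ := Relation.ReflTransGen.trans

/-! ### The dual polygon

The vertices of the polygon are the faces of the tree, in the same cyclic order around the disk.
A diagonal is the unordered pair of its end vertices, and a polygonal subdivision is recorded by
its set of diagonals. -/

/-- `a` is the counterclockwise most leaf on the face `F`: seen from `a`, towards the interior of
the disk, `F` is on the left of the edge at `a`. -/
def IsCcwMostLeaf (a : V) (F : T.Face) : Prop :=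
  T.IsLeaf a ∧ ∃ d : T.graph.Dart, d.fst = a ∧ F = T.leftFace d

/-- `a` is the clockwise most leaf on the face `F`. -/
def IsCwMostLeaf (a : V) (F : T.Face) : Prop :=
  T.IsLeaf a ∧ ∃ d : T.graph.Dart, d.fst = a ∧ F = T.rightFace d

/-- The polygon vertex of `G` is immediately clockwise from that of `F`. -/
def NextVertex (F G : T.Face) : Prop :=
  ∃ a : V, T.IsCwMostLeaf a F ∧ T.IsCcwMostLeaf a G

/-- `D` is the diagonal of the dual polygon that corresponds to the arc `p`: each end leaf of `p`
is replaced with the polygon vertex of the face whose counterclockwise most leaf it is. -/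
def IsDiagonalOf (p : Set V) (D : Sym2 T.Face) : Prop :=
  ∃ (a b : V) (F G : T.Face), a ≠ b ∧ a ∈ p ∧ b ∈ p ∧
    T.IsCcwMostLeaf a F ∧ T.IsCcwMostLeaf b G ∧ D = s(F, G)

/-- The polygonal subdivision corresponding to a facet. -/
def subdivision (S : T.Facet) : Set (Sym2 T.Face) :=
  {D | ∃ p ∈ S.1, T.IsDiagonalOf p D}

/-- The polygonal subdivision dual to the tree: two polygon vertices are joined by a diagonal
when the two faces share an edge between interior vertices. (An edge at a leaf gives a side of the
polygon.) -/
def dualSubdivision : Set (Sym2 T.Face) :=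
  {D | ∃ d : T.graph.Dart, ¬ T.IsLeaf d.fst ∧ ¬ T.IsLeaf d.snd ∧
    D = s(T.leftFace d, T.rightFace d)}

/-- The rotation: each end of each diagonal is moved to the polygon vertex immediately
clockwise from it. -/
def rotation (P : Set (Sym2 T.Face)) : Set (Sym2 T.Face) :=
  {D | ∃ F G F' G' : T.Face, s(F, G) ∈ P ∧ T.NextVertex F F' ∧ T.NextVertex G G' ∧ D = s(F', G')}

end PlaneTree

namespace PlaneTree

variable {V : Type*} (T : PlaneTree V)

/-! ### Branches of the tree -/

/-! An arc through an oriented edge `d` is a pair of words in left and right turns (`false < true`),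
one read along `d` and one along `d.symm`. In lexicographic order, inclusion of the regions to the
left of `d` is the relation `Le` (`reg_subset_iff`), and noncrossing arcs are those that are
comparable at every common edge (`noncrossing_iff`). After that the argument is about words. When
two arcs cross, one of them turns left of the other in both directions; this is `Under`, and it
orients every crossing.

In a facet, two arcs that are consecutive at an edge agree before it or after it: otherwise the arc
following the first one before the edge and the second one after it could be added
(`Facet.agree_of_adjacent`). Hence the arcs marked at the two corners beside an oriented edge, at
its final vertex, have the same past (`Facet.agree_of_marks`), and each arc of the facet has exactly
one mark on its left in each direction (`Facet.exists_mark`, `Facet.mark_unique`).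

Suppose that an arc `p` turns left at both ends of the segment between its marks. Turning right
there instead, and then following the arcs marked at the neighbouring corners, gives an arc `q` that
replaces `p` in a new facet; the oriented flip leads from the new facet to the old one
(`Facet.exists_flipEdge`). If no arc of a facet has this shape, no arc turns right before it turns
left, and the facet is `bottom` (`Facet.eq_bottom`). So every other facet has an incoming flip.

A flip replaces an arc with one that is under it. The property that no arc of `S` is under an arc of
`R` passes from the target of a flip to its source (`FlipEdge.neverUnder`). On a directed cycle,
this contradicts the first flip, whence antisymmetry. As there are finitely many facets, a minimal
facet below a given one exists, and it must be `bottom`.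

An arc of `bottom` is determined by the edge between its left turns and its right turns, and its
diagonal joins the two faces at that edge. The largest facet is the bottom facet of the mirror
image: reflection reverses flips and exchanges clockwise and counterclockwise most leaves, which
accounts for the rotation. -/

/-- The vertices beyond the oriented edge `d`. -/
def beyond (d : T.graph.Dart) : Set V := {v | T.graph.dist v d.snd < T.graph.dist v d.fst}

variable {T}

theorem dart_ext {d e : T.graph.Dart} (h₁ : d.fst = e.fst) (h₂ : d.snd = e.snd) : d = e :=
  SimpleGraph.Dart.ext _ _ (Prod.ext h₁ h₂)

@[simp] theorem symm_fst (d : T.graph.Dart) : d.symm.fst = d.snd := rfl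

@[simp] theorem symm_snd (d : T.graph.Dart) : d.symm.snd = d.fst := rfl

theorem snd_mem_beyond (d : T.graph.Dart) : d.snd ∈ T.beyond d := by
  have : T.graph.dist d.snd d.fst = 1 := SimpleGraph.dist_eq_one_iff_adj.2 d.adj.symm
  simp [beyond, this]

theorem fst_not_mem_beyond (d : T.graph.Dart) : d.fst ∉ T.beyond d := by
  simp [beyond]

theorem mem_beyond_symm {d : T.graph.Dart} {v : V} : v ∈ T.beyond d.symm ↔ v ∉ T.beyond d := by
  have h := T.isTree.dist_ne_of_adj v d.adj
  simp only [beyond, Set.mem_ofPred_eq, symm_fst, symm_snd]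
  omega

/-- The unique path from `w` to the common initial vertex has only one penultimate vertex. -/
theorem eq_of_mem_beyond {d e : T.graph.Dart} (h : d.fst = e.fst) {w : V}
    (hd : w ∈ T.beyond d) (he : w ∈ T.beyond e) : d = e := by
  have key : ∀ x : T.graph.Dart, w ∈ T.beyond x →
      ∃ p : T.graph.Walk w x.fst, p.IsPath ∧ p.penultimate = x.snd := by
    intro x hx
    obtain ⟨p, hp, hl⟩ := T.isTree.connected.exists_path_of_dist w x.snd
    refine ⟨p.concat x.adj.symm, hp.concat ?_ _, by simp⟩
    intro hmem
    classical
    have h1 := SimpleGraph.dist_le (p.takeUntil _ hmem)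
    have h2 := p.length_takeUntil_le_length hmem
    simp only [beyond, Set.mem_ofPred_eq] at hx
    omega
  obtain ⟨p, hp, hp'⟩ := key d hd
  obtain ⟨q, hq, hq'⟩ := key e he
  refine dart_ext h ?_
  rw [← hp', ← hq']
  cases d with | mk d hd0 => cases e with | mk e he0 =>
  obtain ⟨d1, d2⟩ := d
  obtain ⟨e1, e2⟩ := e
  simp only at h
  subst h
  rw [(T.isTree.existsUnique_path w d1).unique hp hq]

theorem exists_dart_mem_beyond {v w : V} (h : w ≠ v) :
    ∃ d : T.graph.Dart, d.fst = v ∧ w ∈ T.beyond d := by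
  obtain ⟨p, hp⟩ := T.isTree.connected.exists_walk_length_eq_dist v w
  cases p with
  | nil => exact (h rfl).elim
  | cons hadj p =>
    refine ⟨⟨(_, _), hadj⟩, rfl, ?_⟩
    have := SimpleGraph.dist_le p
    simp only [SimpleGraph.Walk.length_cons] at hp
    simp only [beyond, Set.mem_ofPred_eq]
    rw [SimpleGraph.dist_comm, SimpleGraph.dist_comm (u := w)]
    omega

theorem beyond_subset {d e : T.graph.Dart} (h : e.fst = d.snd) (hne : e ≠ d.symm) :
    T.beyond e ⊆ T.beyond d := by
  intro w hw
  by_contra hc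
  exact hne (eq_of_mem_beyond (by simpa using h) hw (mem_beyond_symm.2 hc))

theorem eq_of_boundary {d e : T.graph.Dart} (h₁ : e.snd ∈ T.beyond d) (h₂ : e.fst ∉ T.beyond d) :
    e = d := by
  have hc := T.isTree.connected
  by_cases hs : e.snd = d.snd
  · by_contra hne
    have := eq_of_mem_beyond (T := T) (d := d.symm) (e := e.symm) (by simp [hs]) (mem_beyond_symm.2 h₂)
        (mem_beyond_symm.2 (fst_not_mem_beyond e))
    exact hne (by simpa using congrArg SimpleGraph.Dart.symm this.symm)
  · obtain ⟨n, hn1, hn2⟩ := exists_dart_mem_beyond (T := T) hs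
    have hnd : n ≠ d.symm := by
      rintro rfl
      exact mem_beyond_symm.1 hn2 h₁
    have hy : e.fst ∈ T.beyond d.symm := mem_beyond_symm.2 h₂
    -- `n` leads from `d.snd` towards `e.snd`. Comparing distances shows that `e.fst` lies beyond
    -- `n` too, which forces `n = d.symm`.
    refine (hnd ?_).elim
    refine eq_of_mem_beyond (by simpa using hn1) (w := e.fst) ?_ hy
    have t1 := hc.dist_triangle (u := e.fst) (v := e.snd) (w := n.snd)
    have t0 : T.graph.dist e.fst e.snd = 1 := SimpleGraph.dist_eq_one_iff_adj.2 e.adj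
    have t2 := hc.dist_triangle (u := e.snd) (v := e.fst) (w := d.fst)
    have t0' : T.graph.dist e.snd e.fst = 1 := SimpleGraph.dist_eq_one_iff_adj.2 e.adj.symm
    have t3 := T.isTree.dist_ne_of_adj e.fst n.adj
    have t4 := T.isTree.dist_ne_of_adj e.snd d.adj
    have t5 := T.isTree.dist_ne_of_adj e.fst d.adj
    simp only [beyond, Set.mem_ofPred_eq, symm_snd, symm_fst, hn1] at *
    omega

/-! ### Turning left and right -/

theorem leaf_dart_unique {d e : T.graph.Dart} (hl : T.IsLeaf d.fst) (h : d.fst = e.fst) : d = e := by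
  obtain ⟨a, ha⟩ := Set.ncard_eq_one.1 hl
  have h1 : d.snd ∈ T.graph.neighborSet d.fst := d.adj
  have h2 : e.snd ∈ T.graph.neighborSet d.fst := by rw [h]; exact e.adj
  rw [ha] at h1 h2
  exact dart_ext h (h1.trans h2.symm)

theorem cw_of_leaf {d : T.graph.Dart} (hl : T.IsLeaf d.fst) : T.cw d = d :=
  (leaf_dart_unique hl (T.cw_fst d).symm).symm

/-- The rotation is transitive on the darts at a vertex, so a period of at most two would leave at
most two neighbours. -/
theorem cw_cw_ne {d : T.graph.Dart} (hl : ¬ T.IsLeaf d.fst) : T.cw (T.cw d) ≠ d := by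
  intro h
  have h3 : 3 ≤ (T.graph.neighborSet d.fst).ncard := (T.degree_cond d.fst).resolve_left hl
  have hall : ∀ i : ℤ, (T.cw ^ i) d = d ∨ (T.cw ^ i) d = T.cw d := by
    intro i
    induction i using Int.induction_on with
    | zero => simp
    | succ i ih =>
      rw [add_comm, zpow_add, zpow_one, Equiv.Perm.mul_apply]
      rcases ih with ih | ih <;> rw [ih]
      · exact .inr rfl
      · exact .inl h
    | pred i ih =>
      rw [sub_eq_neg_add, zpow_add, zpow_neg_one, Equiv.Perm.mul_apply]
      rcases ih with ih | ih <;> rw [ih]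
      · right; rw [Equiv.Perm.inv_eq_iff_eq]; exact h.symm
      · left; simp
  have hsub : T.graph.neighborSet d.fst ⊆ {d.snd, (T.cw d).snd} := by
    intro w hw
    obtain ⟨i, hi⟩ := T.cw_sameCycle d ⟨(d.fst, w), hw⟩ rfl
    rcases hall i with h' | h' <;> rw [hi] at h'
    · left; exact congrArg (fun e : T.graph.Dart => e.snd) h'
    · right; exact congrArg (fun e : T.graph.Dart => e.snd) h'
  have := Set.ncard_le_ncard hsub
  have := Set.ncard_insert_le d.snd {(T.cw d).snd}
  simp at this
  omega

theorem cw_ne {d : T.graph.Dart} (hl : ¬ T.IsLeaf d.fst) : T.cw d ≠ d := by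
  intro h
  exact cw_cw_ne hl (by rw [h, h])

theorem cw_symm_fst (d : T.graph.Dart) : (T.cw.symm d).fst = d.fst := by
  have := T.cw_fst (T.cw.symm d)
  rwa [Equiv.apply_symm_apply, eq_comm] at this

variable (T) in
/-- The oriented edge that follows `d` after a left (`false`) or right (`true`) turn. -/
def turn (b : Bool) (d : T.graph.Dart) : T.graph.Dart :=
  bif b then T.cw.symm d.symm else T.cw d.symm

theorem turn_false (d : T.graph.Dart) : T.turn false d = T.cw d.symm := rfl

theorem turn_true (d : T.graph.Dart) : T.turn true d = T.cw.symm d.symm := rfl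

@[simp] theorem turn_fst (b : Bool) (d : T.graph.Dart) : (T.turn b d).fst = d.snd := by
  cases b
  · exact T.cw_fst d.symm
  · exact cw_symm_fst d.symm

@[simp] theorem turn_symm_turn (b : Bool) (d : T.graph.Dart) :
    T.turn (!b) (T.turn b d).symm = d.symm := by
  cases b <;> simp [turn]

theorem turn_ne_symm {b : Bool} {d : T.graph.Dart} (hl : ¬ T.IsLeaf d.snd) :
    T.turn b d ≠ d.symm := by
  cases b
  · exact cw_ne (d := d.symm) hl
  · intro h
    rw [turn_true, Equiv.symm_apply_eq] at h
    exact cw_ne (d := d.symm) hl h.symm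

theorem turn_ne_turn {b : Bool} {d : T.graph.Dart} (hl : ¬ T.IsLeaf d.snd) :
    T.turn (!b) d ≠ T.turn b d := by
  have : T.turn true d ≠ T.turn false d := by
    intro h
    rw [turn_true, Equiv.symm_apply_eq] at h
    exact cw_cw_ne (d := d.symm) hl h.symm
  cases b
  · exact this
  · exact this.symm

theorem beyond_turn_subset {b : Bool} {d : T.graph.Dart} (hl : ¬ T.IsLeaf d.snd) :
    T.beyond (T.turn b d) ⊆ T.beyond d :=
  beyond_subset (turn_fst b d) (turn_ne_symm hl)

variable (T) in
/-- `e` is reached from `d` along a path that turns left or right at each vertex. -/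
def Ahead : T.graph.Dart → T.graph.Dart → Prop :=
  Relation.ReflTransGen fun x y => ¬ T.IsLeaf x.snd ∧ ∃ b, y = T.turn b x

theorem Ahead.refl (d : T.graph.Dart) : T.Ahead d d := Relation.ReflTransGen.refl

theorem Ahead.trans {d e f : T.graph.Dart} (h : T.Ahead d e) (h' : T.Ahead e f) : T.Ahead d f :=
  Relation.ReflTransGen.trans h h'

theorem ahead_turn {b : Bool} {d : T.graph.Dart} (hl : ¬ T.IsLeaf d.snd) :
    T.Ahead d (T.turn b d) := Relation.ReflTransGen.single ⟨hl, b, rfl⟩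

theorem Ahead.symm {d e : T.graph.Dart} (h : T.Ahead d e) : T.Ahead e.symm d.symm := by
  induction h with
  | refl => exact .refl _
  | @tail x y _ hxy ih =>
    obtain ⟨hl, b, rfl⟩ := hxy
    refine Ahead.trans ?_ ih
    rw [← turn_symm_turn b x]
    exact ahead_turn (by simpa using hl)

theorem Ahead.beyond_subset {d e : T.graph.Dart} (h : T.Ahead d e) : T.beyond e ⊆ T.beyond d := by
  induction h with
  | refl => exact subset_rfl
  | tail _ hxy ih =>
    obtain ⟨hl, b, rfl⟩ := hxy
    exact (beyond_turn_subset hl).trans ih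

theorem Ahead.snd_mem {d e : T.graph.Dart} (h : T.Ahead d e) : e.snd ∈ T.beyond d :=
  h.beyond_subset (snd_mem_beyond e)

theorem Ahead.eq_or_fst_mem {d e : T.graph.Dart} (h : T.Ahead d e) :
    d = e ∨ e.fst ∈ T.beyond d := by
  rcases Relation.ReflTransGen.cases_tail h with h | ⟨x, hx, hl, b, rfl⟩
  · exact .inl h.symm
  · right
    rw [turn_fst]
    exact Ahead.snd_mem hx

/-! ### Faces at a vertex -/

theorem leftFace_turn {d : T.graph.Dart} (hl : ¬ T.IsLeaf d.snd) :
    T.leftFace (T.turn false d) = T.leftFace d := (Quot.sound ⟨hl, rfl⟩).symm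

theorem rightFace_turn {d : T.graph.Dart} (hl : ¬ T.IsLeaf d.snd) :
    T.rightFace (T.turn true d) = T.rightFace d := by
  have := leftFace_turn (d := (T.turn true d).symm) (by simpa using hl)
  rw [show false = !true from rfl, turn_symm_turn] at this
  exact this.symm

theorem rightFace_eq_leftFace_cw {d : T.graph.Dart} (hl : ¬ T.IsLeaf d.fst) :
    T.rightFace d = T.leftFace (T.cw d) :=
  (leftFace_turn (d := d.symm) hl).symm

/-- `SideStep` is deterministic forwards and backwards, so the sides of one face form a single
chain. -/
theorem sideStep_chain {d e : T.graph.Dart} (h : T.leftFace d = T.leftFace e) :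
    Relation.ReflTransGen T.SideStep d e ∨ Relation.ReflTransGen T.SideStep e d := by
  replace h := Quot.eqvGen_exact h
  induction h with
  | rel x y h => exact .inl (.single h)
  | refl x => exact .inl .refl
  | symm x y _ ih => exact ih.symm
  | trans x y z _ _ ih₁ ih₂ =>
    rcases ih₁ with h₁ | h₁ <;> rcases ih₂ with h₂ | h₂
    · exact .inl (h₁.trans h₂)
    · have : Relator.RightUnique (Function.swap T.SideStep) := by
        rintro a b c ⟨_, hb⟩ ⟨_, hc⟩
        have := T.cw.injective (hb.symm.trans hc)
        simpa using congrArg SimpleGraph.Dart.symm this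
      have := Relation.ReflTransGen.total_of_right_unique this (Relation.reflTransGen_swap.2 h₁)
        (Relation.reflTransGen_swap.2 h₂)
      exact this.symm.imp Relation.reflTransGen_swap.1 Relation.reflTransGen_swap.1
    · have : Relator.RightUnique T.SideStep := by
        rintro a b c ⟨_, hb⟩ ⟨_, hc⟩
        exact hb.trans hc.symm
      exact Relation.ReflTransGen.total_of_right_unique this h₁ h₂
    · exact .inr (h₂.trans h₁)

theorem ahead_of_chain {d e : T.graph.Dart} (h : Relation.ReflTransGen T.SideStep d e) :
    T.Ahead d e :=
  Relation.ReflTransGen.mono (fun _ _ h => ⟨h.1, false, h.2⟩) _ _ h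

theorem ahead_of_leftFace_eq {d e : T.graph.Dart} (h : T.leftFace d = T.leftFace e) :
    T.Ahead d e ∨ T.Ahead e d :=
  (sideStep_chain h).imp ahead_of_chain ahead_of_chain

/-- The chain of sides of a face never returns to a vertex that it has left, since it stays beyond
the edge just used. -/
theorem eq_of_leftFace_eq {d e : T.graph.Dart} (hv : d.fst = e.fst)
    (h : T.leftFace d = T.leftFace e) : d = e := by
  rcases ahead_of_leftFace_eq h with h | h <;> rcases h.eq_or_fst_mem with h' | h'
  · exact h'
  · exact (fst_not_mem_beyond d (hv ▸ h')).elim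
  · exact h'.symm
  · exact (fst_not_mem_beyond e (hv ▸ h')).elim

theorem eq_of_leftFace_eq_of_leaf {d e : T.graph.Dart} (hd : T.IsLeaf d.fst) (he : T.IsLeaf e.fst)
    (h : T.leftFace d = T.leftFace e) : d = e := by
  have key : ∀ {x y : T.graph.Dart}, T.IsLeaf y.fst → T.Ahead x y → x = y := by
    intro x y hy hxy
    rcases Relation.ReflTransGen.cases_tail hxy with h | ⟨z, _, hl, b, rfl⟩
    · exact h.symm
    · exact (hl (by simpa using hy)).elim
  rcases ahead_of_leftFace_eq h with h | h
  · exact key he h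
  · exact (key hd h).symm

theorem leftFace_ne_rightFace {d : T.graph.Dart} (hl : ¬ T.IsLeaf d.snd) :
    T.leftFace d ≠ T.rightFace d := by
  rw [← leftFace_turn hl]
  intro h
  exact turn_ne_symm hl (eq_of_leftFace_eq (by simp) h)

/-- Distinct edges at a vertex that border a common face are next to each other. -/
theorem corner_of_borders {d e : T.graph.Dart} (hl : ¬ T.IsLeaf d.fst) (hv : d.fst = e.fst)
    (hne : d ≠ e) {F : T.Face} (hd : T.Borders F d) (he : T.Borders F e) :
    (e = T.cw d ∧ F = T.leftFace e) ∨ (d = T.cw e ∧ F = T.leftFace d) := by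
  have hl' : ¬ T.IsLeaf e.fst := hv ▸ hl
  have h1 := T.cw_fst d
  have h2 := T.cw_fst e
  rcases hd with hd | hd <;> rcases he with he | he
  · exact (hne (eq_of_leftFace_eq hv (hd.symm.trans he))).elim
  · rw [rightFace_eq_leftFace_cw hl'] at he
    exact .inr ⟨eq_of_leftFace_eq (by rw [h2, hv]) (hd.symm.trans he), hd⟩
  · rw [rightFace_eq_leftFace_cw hl] at hd
    exact .inl ⟨eq_of_leftFace_eq (by rw [h1, hv]) (he.symm.trans hd), he⟩
  · rw [rightFace_eq_leftFace_cw hl] at hd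
    rw [rightFace_eq_leftFace_cw hl'] at he
    exact (hne (T.cw.injective (eq_of_leftFace_eq (by rw [h1, h2, hv]) (hd.symm.trans he)))).elim

/-! ### Turn sequences -/

variable (T) in
/-- `Run d l`: starting with `d` and turning according to `l`, one ends at a leaf. -/
inductive Run : T.graph.Dart → List Bool → Prop
  | leaf {d : T.graph.Dart} : T.IsLeaf d.snd → Run d []
  | turn {d : T.graph.Dart} {b : Bool} {l : List Bool} :
      ¬ T.IsLeaf d.snd → Run (T.turn b d) l → Run d (b :: l)

variable (T) in
/-- The vertices met after the initial vertex of `d` when turning according to `l`. -/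
def trail : List Bool → T.graph.Dart → Set V
  | [], d => {d.snd}
  | b :: l, d => insert d.snd (trail l (T.turn b d))

theorem snd_mem_trail (l : List Bool) (d : T.graph.Dart) : d.snd ∈ T.trail l d := by
  cases l <;> simp [trail]

theorem Run.trail_subset {d : T.graph.Dart} {l : List Bool} (h : T.Run d l) :
    T.trail l d ⊆ T.beyond d := by
  induction h with
  | leaf _ => simpa [trail] using snd_mem_beyond _
  | turn hl _ ih =>
    exact Set.insert_subset (snd_mem_beyond _) (ih.trans (beyond_turn_subset hl))

theorem Run.eq_nil {d : T.graph.Dart} {l : List Bool} (h : T.Run d l) (hl : T.IsLeaf d.snd) :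
    l = [] := by
  cases h with
  | leaf _ => rfl
  | turn h _ => exact (h hl).elim

theorem Run.eq_cons {d : T.graph.Dart} {l : List Bool} (h : T.Run d l) (hl : ¬ T.IsLeaf d.snd) :
    ∃ b l', l = b :: l' ∧ T.Run (T.turn b d) l' := by
  cases h with
  | leaf h => exact (hl h).elim
  | turn _ h => exact ⟨_, _, rfl, h⟩

theorem beyond_turn_ssubset {b : Bool} {d : T.graph.Dart} (hl : ¬ T.IsLeaf d.snd) :
    T.beyond (T.turn b d) ⊂ T.beyond d := by
  refine (beyond_turn_subset hl).ssubset_of_ne fun h => ?_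
  have := fst_not_mem_beyond (T.turn b d)
  rw [h, turn_fst] at this
  exact this (snd_mem_beyond d)

theorem exists_run [Finite V] (b : Bool) (d : T.graph.Dart) : ∃ n, T.Run d (List.replicate n b) := by
  induction h : (T.beyond d).ncard using Nat.strong_induction_on generalizing d with
  | _ n ih =>
    by_cases hl : T.IsLeaf d.snd
    · exact ⟨0, .leaf hl⟩
    · obtain ⟨m, hm⟩ := ih _ (h ▸ Set.ncard_lt_ncard (beyond_turn_ssubset (b := b) hl)) _ rfl
      exact ⟨m + 1, .turn hl hm⟩

/-- The branches after a left and after a right turn are disjoint, so the vertex set reveals each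
turn. -/
theorem Run.eq_of_trail_eq {d : T.graph.Dart} {l k : List Bool} (hl : T.Run d l) (hk : T.Run d k)
    (h : T.trail l d = T.trail k d) : l = k := by
  induction hl generalizing k with
  | leaf hd => exact (hk.eq_nil hd).symm
  | @turn d b l hd hr ih =>
    obtain ⟨c, k, rfl, hk'⟩ := hk.eq_cons hd
    have key : ∀ {b c : Bool} {l k : List Bool}, T.Run (T.turn c d) k →
        T.trail (b :: l) d = T.trail (c :: k) d → b = c ∧
        T.trail l (T.turn b d) ⊆ insert d.snd (T.trail k (T.turn c d)) := by
      intro b c l k hk' h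
      have h1 : T.trail l (T.turn b d) ⊆ insert d.snd (T.trail k (T.turn c d)) := by
        simp only [trail] at h
        rw [← h]
        exact Set.subset_insert _ _
      refine ⟨?_, h1⟩
      have h2 := h1 (snd_mem_trail l _)
      rcases h2 with h2 | h2
      · have := (T.turn b d).adj.ne
        exact (this (by rw [h2]; exact turn_fst b d)).elim
      · have := eq_of_mem_beyond (by simp) (snd_mem_beyond (T.turn b d)) (hk'.trail_subset h2)
        by_contra hbc
        obtain rfl : b = !c := by cases b <;> cases c <;> simp_all
        exact turn_ne_turn hd this
    obtain ⟨rfl, h1⟩ := key hk' h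
    obtain ⟨-, h2⟩ := key hr h.symm
    have hn : ∀ {m : List Bool}, T.Run (T.turn b d) m → d.snd ∉ T.trail m (T.turn b d) := by
      intro m hm hmem
      have := hm.trail_subset hmem
      rw [← turn_fst b d] at this
      exact fst_not_mem_beyond _ this
    rw [ih hk' (Set.Subset.antisymm ?_ ?_)]
    · intro x hx
      exact (h1 hx).resolve_left (by rintro rfl; exact hn hr hx)
    · intro x hx
      exact (h2 hx).resolve_left (by rintro rfl; exact hn hk' hx)

/-! ### Arcs as pairs of turn sequences -/

variable (T) in
/-- `p` is obtained by prolonging `d` in both directions by turning according to `l` and `k`. -/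
def IsStrand (p : Set V) (d : T.graph.Dart) (l k : List Bool) : Prop :=
  T.Run d l ∧ T.Run d.symm k ∧ p = T.trail l d ∪ T.trail k d.symm

theorem EdgeOf.symm {p : Set V} {d : T.graph.Dart} (h : T.EdgeOf d p) : T.EdgeOf d.symm p :=
  ⟨h.2, h.1⟩

theorem edgeOf_symm {p : Set V} {d : T.graph.Dart} : T.EdgeOf d.symm p ↔ T.EdgeOf d p :=
  and_comm

namespace IsStrand

variable {p : Set V} {d e : T.graph.Dart} {l k : List Bool}

theorem symm (h : T.IsStrand p d l k) : T.IsStrand p d.symm k l :=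
  ⟨h.2.1, h.1, h.2.2.trans (Set.union_comm _ _)⟩

theorem edgeOf (h : T.IsStrand p d l k) : T.EdgeOf d p := by
  rw [EdgeOf, h.2.2]
  exact ⟨.inr (snd_mem_trail k d.symm), .inl (snd_mem_trail l d)⟩

theorem inter_beyond (h : T.IsStrand p d l k) : p ∩ T.beyond d = T.trail l d := by
  rw [h.2.2, Set.union_inter_distrib_right, Set.inter_eq_left.2 h.1.trail_subset]
  refine Set.union_eq_left.2 fun x hx => ?_
  exact (mem_beyond_symm.1 (h.2.1.trail_subset hx.1) hx.2).elim

theorem step {b : Bool} (h : T.IsStrand p d (b :: l) k) :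
    T.IsStrand p (T.turn b d) l ((!b) :: k) := by
  obtain ⟨h1, h2, h3⟩ := h
  cases h1 with
  | turn hd h1 =>
    refine ⟨h1, .turn (by simpa using hd) (by simpa using h2), ?_⟩
    rw [h3]
    simp only [trail, symm_snd, turn_fst, turn_symm_turn]
    rw [Set.insert_union, Set.union_insert]

theorem ahead (h : T.IsStrand p d l k) (he : T.EdgeOf e p) (hb : e.snd ∈ T.beyond d) :
    ∃ l' k', (T.Ahead d e ∧ T.IsStrand p e l' k') ∨
      (T.Ahead d e.symm ∧ T.IsStrand p e.symm l' k') := by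
  induction l generalizing d k e with
  | nil =>
    have h1 : e.snd ∈ T.trail [] d := h.inter_beyond ▸ ⟨he.2, hb⟩
    have h2 : e.snd = d.snd := h1
    have hl : T.IsLeaf d.snd := by cases h.1; assumption
    have : d.symm = e.symm := leaf_dart_unique hl h2.symm
    have : d = e := by simpa using congrArg SimpleGraph.Dart.symm this
    subst this
    exact ⟨_, _, .inl ⟨.refl _, h⟩⟩
  | cons b l ih =>
    have hl : ¬ T.IsLeaf d.snd := by cases h.1; assumption
    have key : ∀ {f : T.graph.Dart}, T.EdgeOf f p → f.snd ∈ T.beyond d → f.snd ≠ d.snd →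
        ∃ l' k', (T.Ahead d f ∧ T.IsStrand p f l' k') ∨
        (T.Ahead d f.symm ∧ T.IsStrand p f.symm l' k') := by
      intro f hf hfb hne
      have h1 : f.snd ∈ T.trail (b :: l) d := h.inter_beyond ▸ ⟨hf.2, hfb⟩
      have h2 := h.step.1.trail_subset (h1.resolve_left hne)
      obtain ⟨l', k', h3⟩ := ih h.step hf h2
      exact ⟨l', k', h3.imp (fun x => ⟨(ahead_turn hl).trans x.1, x.2⟩)
        (fun x => ⟨(ahead_turn hl).trans x.1, x.2⟩)⟩
    by_cases h1 : e.snd = d.snd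
    · by_cases h2 : e.fst ∈ T.beyond d
      · obtain ⟨l', k', h3⟩ := key he.symm h2 (by rw [← h1]; exact e.adj.ne)
        exact ⟨l', k', h3.symm⟩
      · obtain rfl := eq_of_boundary hb h2
        exact ⟨_, _, .inl ⟨.refl _, h⟩⟩
    · exact key he hb h1

theorem exists_strand (h : T.IsStrand p d l k) (he : T.EdgeOf e p) :
    (∃ l' k', T.IsStrand p e l' k') ∧ (T.Ahead d e ∨ T.Ahead d e.symm ∨ T.Ahead d.symm e ∨
      T.Ahead d.symm e.symm) := by
  by_cases hb : e.snd ∈ T.beyond d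
  · obtain ⟨l', k', ⟨h1, h2⟩ | ⟨h1, h2⟩⟩ := h.ahead he hb
    · exact ⟨⟨_, _, h2⟩, .inl h1⟩
    · exact ⟨⟨_, _, h2.symm⟩, .inr (.inl h1)⟩
  · obtain ⟨l', k', ⟨h1, h2⟩ | ⟨h1, h2⟩⟩ := h.symm.ahead he (mem_beyond_symm.2 hb)
    · exact ⟨⟨_, _, h2⟩, .inr (.inr (.inl h1))⟩
    · exact ⟨⟨_, _, h2.symm⟩, .inr (.inr (.inr h1))⟩

theorem eq_symm_or_eq_turn (h : T.IsStrand p d l k) (he : T.EdgeOf e p) (hv : e.fst = d.snd) :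
    e = d.symm ∨ ∃ b l', l = b :: l' ∧ e = T.turn b d := by
  by_cases hb : e.snd ∈ T.beyond d
  · right
    have h1 : e.snd ∈ T.trail l d := h.inter_beyond ▸ ⟨he.2, hb⟩
    cases l with
    | nil => exact (e.adj.ne (hv.trans (show e.snd = d.snd from h1).symm)).elim
    | cons b l =>
      refine ⟨b, l, rfl, ?_⟩
      rcases h1 with h1 | h1
      · exact (e.adj.ne (hv.trans h1.symm)).elim
      · exact eq_of_mem_beyond (by rw [hv, turn_fst]) (snd_mem_beyond e)
          (h.step.1.trail_subset h1)
  · exact .inl (eq_of_mem_beyond hv (snd_mem_beyond e) (mem_beyond_symm.2 hb))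

end IsStrand

/-! ### Arcs are the same as strands -/

theorem Run.exists_walk {d : T.graph.Dart} {l : List Bool} (h : T.Run d l) :
    ∃ (b : V) (w : T.graph.Walk d.snd b), T.IsLeaf b ∧ w.IsPath ∧
      ∀ v, v ∈ w.support ↔ v ∈ T.trail l d := by
  induction h with
  | @leaf d hl => exact ⟨d.snd, .nil, hl, .nil, by simp [trail]⟩
  | @turn d c l hl h ih =>
    obtain ⟨b, w, hb, hw, hs⟩ := ih
    have hadj : T.graph.Adj d.snd (T.turn c d).snd := by
      have := (T.turn c d).adj
      rwa [turn_fst] at this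
    refine ⟨b, .cons hadj w, hb, ?_, ?_⟩
    · rw [SimpleGraph.Walk.cons_isPath_iff]
      refine ⟨hw, fun hm => ?_⟩
      have := h.trail_subset ((hs _).1 hm)
      rw [← turn_fst c d] at this
      exact fst_not_mem_beyond _ this
    · intro v
      simp [trail, hs]

theorem IsStrand.isArc {p : Set V} {d : T.graph.Dart} {l k : List Bool}
    (h : T.IsStrand p d l k) : T.IsArc p := by
  refine ⟨?_, ?_⟩
  · obtain ⟨b, w, hb, hw, hs⟩ := h.1.exists_walk
    obtain ⟨a, u, ha, hu, ht⟩ := h.2.1.exists_walk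
    have hb' : b ∈ T.beyond d := h.1.trail_subset ((hs b).1 w.end_mem_support)
    have ha' : a ∉ T.beyond d :=
      mem_beyond_symm.1 (h.2.1.trail_subset ((ht a).1 u.end_mem_support))
    refine ⟨a, b, fun hab => ha' (hab ▸ hb'), ha, hb,
      u.reverse.append (.cons (show T.graph.Adj d.symm.snd d.snd from d.adj) w), ?_, ?_⟩
    · rw [SimpleGraph.Walk.isPath_def, SimpleGraph.Walk.support_append,
        SimpleGraph.Walk.support_cons, List.tail_cons, List.nodup_append]
      refine ⟨hu.reverse.support_nodup, hw.support_nodup, ?_⟩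
      rintro x hx y hy rfl
      rw [SimpleGraph.Walk.support_reverse, List.mem_reverse, ht] at hx
      exact mem_beyond_symm.1 (h.2.1.trail_subset hx) (h.1.trail_subset ((hs x).1 hy))
    · ext v
      rw [h.2.2]
      have ht' : ∀ v, v ∈ u.reverse.support ↔ v ∈ T.trail k d.symm := fun v => by
        rw [SimpleGraph.Walk.support_reverse, List.mem_reverse, ht]
      rw [Set.mem_ofPred_eq, SimpleGraph.Walk.mem_support_append_iff,
        SimpleGraph.Walk.support_cons, List.mem_cons, hs, ht', Set.mem_union]
      constructor
      · rintro (h' | h')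
        · exact .inr (.inr h')
        · exact .inl h'
      · rintro (h' | rfl | h')
        · exact .inr h'
        · exact .inr (snd_mem_trail k d.symm)
        · exact .inl h'
  · intro x y hxy hne hx hy
    obtain ⟨⟨m, m', hm⟩, -⟩ := h.exists_strand hx
    rcases hm.symm.eq_symm_or_eq_turn hy hxy.symm with h1 | ⟨b, l', rfl, h1⟩
    · exact (hne (by simpa using h1.symm)).elim
    · have hl : ¬ T.IsLeaf x.symm.snd := by cases hm.2.1; assumption
      cases b
      · exact ⟨T.leftFace y, .inr (by rw [h1, leftFace_turn hl]; rfl), .inl rfl⟩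
      · refine ⟨T.rightFace y, .inl (by rw [h1, rightFace_turn hl]; rfl), .inr rfl⟩

/-- Consecutive edges of the path border a common face, hence are neighbours in the rotation at
their vertex: each step is a left or a right turn. -/
theorem exists_run_of_path {p : Set V} (hp : T.TurnsAtCorners p) {u b : V}
    (w : T.graph.Walk u b) (hw : w.IsPath) (hb : T.IsLeaf b) (hwp : ∀ v ∈ w.support, v ∈ p)
    (d : T.graph.Dart) (hd : d.snd = u) (hds : d.fst ∉ w.support) (hdp : d.fst ∈ p) :
    ∃ l, T.Run d l ∧ ∀ v, v ∈ w.support ↔ v ∈ T.trail l d := by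
  induction w generalizing d with
  | nil => exact ⟨[], .leaf (hd ▸ hb), by simp [trail, hd]⟩
  | @cons u v b hadj w ih =>
    subst hd
    rw [SimpleGraph.Walk.cons_isPath_iff] at hw
    let e : T.graph.Dart := ⟨(d.snd, v), hadj⟩
    simp only [SimpleGraph.Walk.support_cons, List.mem_cons, not_or, forall_eq_or_imp] at hds hwp
    have hne : d.symm ≠ e := by
      intro h
      have : d.fst = v := congrArg (fun e : T.graph.Dart => e.snd) h
      exact hds.2 (this ▸ w.start_mem_support)
    have hl : ¬ T.IsLeaf d.snd := fun hl => hne (leaf_dart_unique hl rfl)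
    obtain ⟨F, hF, hF'⟩ := hp d.symm e rfl hne ⟨hwp.1, hdp⟩ ⟨hwp.1, hwp.2 v w.start_mem_support⟩
    have : ∃ c, e = T.turn c d := by
      rcases corner_of_borders (d := d.symm) (e := e) hl rfl hne hF hF' with ⟨h, -⟩ | ⟨h, -⟩
      · exact ⟨false, h⟩
      · exact ⟨true, by rw [turn_true, h, Equiv.symm_apply_apply]⟩
    obtain ⟨c, hc⟩ := this
    obtain ⟨l, hl1, hl2⟩ := ih hw.1 hb hwp.2 e rfl hw.2 hwp.1
    refine ⟨c :: l, .turn hl (hc ▸ hl1), fun v => ?_⟩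
    simp [trail, hl2, hc]

theorem IsArc.exists_strand {p : Set V} (hp : T.IsArc p) : ∃ d l k, T.IsStrand p d l k := by
  obtain ⟨⟨a, b, hab, ha, hb, w, hw, rfl⟩, hc⟩ := hp
  cases w with
  | nil => exact (hab rfl).elim
  | @cons _ v _ hadj w =>
    rw [SimpleGraph.Walk.cons_isPath_iff] at hw
    obtain ⟨l, hl, hs⟩ := exists_run_of_path hc w hw.1 hb
      (fun v hv => by simp [hv]) ⟨(a, v), hadj⟩ rfl hw.2 (by simp)
    refine ⟨⟨(a, v), hadj⟩, l, [], hl, .leaf ha, ?_⟩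
    ext x
    simp only [SimpleGraph.Walk.support_cons, List.mem_cons, hs, trail, symm_snd, Set.mem_ofPred_eq,
      Set.mem_union, Set.mem_singleton_iff]
    exact or_comm

theorem IsArc.strand {p : Set V} (hp : T.IsArc p) {d : T.graph.Dart} (hd : T.EdgeOf d p) :
    ∃ l k, T.IsStrand p d l k := by
  obtain ⟨e, l, k, h⟩ := hp.exists_strand
  exact (h.exists_strand hd).1

theorem IsArc.exists_edge {p : Set V} (hp : T.IsArc p) : ∃ d, T.EdgeOf d p := by
  obtain ⟨e, l, k, h⟩ := hp.exists_strand
  exact ⟨e, h.edgeOf⟩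

/-! ### Turn sequences of arcs -/

open Classical in
variable (T) in
/-- The turns made by the arc `p` after the oriented edge `d`. -/
noncomputable def code (p : Set V) (d : T.graph.Dart) : List Bool :=
  -- For an arc through `d` the list exists and is unique; the default `[]` is not used there.
  if h : ∃ l, T.Run d l ∧ T.trail l d = p ∩ T.beyond d then h.choose else []

theorem IsStrand.code_eq {p : Set V} {d : T.graph.Dart} {l k : List Bool}
    (h : T.IsStrand p d l k) : T.code p d = l := by
  have hex : ∃ l, T.Run d l ∧ T.trail l d = p ∩ T.beyond d := ⟨l, h.1, h.inter_beyond.symm⟩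
  rw [code, dif_pos hex]
  exact hex.choose_spec.1.eq_of_trail_eq h.1 (hex.choose_spec.2.trans h.inter_beyond)

variable (T) in
/-- The arc `p` passes through the oriented edge `d`. -/
def Thru (p : Set V) (d : T.graph.Dart) : Prop := T.IsArc p ∧ T.EdgeOf d p

theorem IsStrand.thru {p : Set V} {d : T.graph.Dart} {l k : List Bool}
    (h : T.IsStrand p d l k) : T.Thru p d := ⟨h.isArc, h.edgeOf⟩

theorem exists_thru {d : T.graph.Dart} {l k : List Bool} (hl : T.Run d l) (hk : T.Run d.symm k) :
    ∃ p, T.Thru p d ∧ T.code p d = l ∧ T.code p d.symm = k := by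
  have h : T.IsStrand (T.trail l d ∪ T.trail k d.symm) d l k := ⟨hl, hk, rfl⟩
  exact ⟨_, h.thru, h.code_eq, h.symm.code_eq⟩

namespace Thru

variable {p q : Set V} {d e : T.graph.Dart}

theorem symm (h : T.Thru p d) : T.Thru p d.symm := ⟨h.1, h.2.symm⟩

theorem of_symm (h : T.Thru p d.symm) : T.Thru p d := ⟨h.1, edgeOf_symm.1 h.2⟩

theorem strand (h : T.Thru p d) : T.IsStrand p d (T.code p d) (T.code p d.symm) := by
  obtain ⟨l, k, hs⟩ := h.1.strand h.2
  rw [hs.code_eq, hs.symm.code_eq]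
  exact hs

theorem run (h : T.Thru p d) : T.Run d (T.code p d) := h.strand.1

theorem of_code {b : Bool} {l : List Bool} (h : T.Thru p d) (hc : T.code p d = b :: l) :
    ¬ T.IsLeaf d.snd ∧ T.Thru p (T.turn b d) ∧ T.code p (T.turn b d) = l := by
  have hs := h.strand
  rw [hc] at hs
  refine ⟨?_, hs.step.thru, hs.step.code_eq⟩
  cases hs.1; assumption

theorem exists_turn (h : T.Thru p d) (hl : ¬ T.IsLeaf d.snd) :
    ∃ b, T.Thru p (T.turn b d) ∧ T.code p d = b :: T.code p (T.turn b d) := by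
  obtain ⟨b, l, hc, -⟩ := h.run.eq_cons hl
  obtain ⟨-, h1, h2⟩ := h.of_code hc
  exact ⟨b, h1, by rw [hc, h2]⟩

theorem code_nil (h : T.Thru p d) (hl : T.IsLeaf d.snd) : T.code p d = [] := h.run.eq_nil hl

theorem code_cons {b : Bool} (h : T.Thru p d) (hl : ¬ T.IsLeaf d.snd) (h' : T.Thru p (T.turn b d)) :
    T.code p d = b :: T.code p (T.turn b d) := by
  obtain ⟨c, h1, h2⟩ := h.exists_turn hl
  rcases h.strand.eq_symm_or_eq_turn h'.2 (turn_fst b d) with h3 | ⟨c', l, h3, h4⟩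
  · exact (turn_ne_symm hl h3).elim
  · have : b = c' := by
      by_contra hbc
      obtain rfl : b = !c' := by cases b <;> cases c' <;> simp_all
      exact turn_ne_turn hl h4
    rw [h2, List.cons.injEq] at h3
    rw [h2, h3.1, this]

theorem code_back {b : Bool} (h : T.Thru p d) (hl : ¬ T.IsLeaf d.snd) (h' : T.Thru p (T.turn b d)) :
    T.code p (T.turn b d).symm = (!b) :: T.code p d.symm := by
  have := h'.symm.code_cons (b := !b) (by simpa using hl) (by simpa using h.symm)
  simpa using this

theorem turn_unique {b c : Bool} (h : T.Thru p d) (hl : ¬ T.IsLeaf d.snd)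
    (h₁ : T.Thru p (T.turn b d)) (h₂ : T.Thru p (T.turn c d)) : b = c := by
  have := (h.code_cons hl h₁).symm.trans (h.code_cons hl h₂)
  simpa using (List.cons.inj this).1

theorem ext (h : T.Thru p d) (h' : T.Thru q d) (h₁ : T.code p d = T.code q d)
    (h₂ : T.code p d.symm = T.code q d.symm) : p = q := by
  rw [h.strand.2.2, h'.strand.2.2, h₁, h₂]

theorem cases (h : T.Thru p d) (h' : T.Thru p e) :
    T.Ahead d e ∨ T.Ahead d e.symm ∨ T.Ahead d.symm e ∨ T.Ahead d.symm e.symm :=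
  (h.strand.exists_strand h'.2).2

theorem ahead_cases (h : T.Thru p d) (h' : T.Thru p e) (ha : T.Ahead d e) :
    d = e ∨ (¬ T.IsLeaf d.snd ∧ ∃ b, T.Thru p (T.turn b d) ∧ T.Ahead (T.turn b d) e) := by
  rcases Relation.ReflTransGen.cases_head ha with rfl | ⟨x, ⟨hl, b, rfl⟩, hx⟩
  · exact .inl rfl
  · refine .inr ⟨hl, b, ?_, hx⟩
    obtain ⟨c, h1, h2⟩ := h.exists_turn hl
    have h3 := Ahead.snd_mem hx
    have h4 : e.snd ∈ T.trail (c :: T.code p (T.turn c d)) d := by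
      rw [← h2, ← h.strand.inter_beyond]
      exact ⟨h'.2.2, ha.snd_mem⟩
    rcases h4 with h4 | h4
    · rw [h4, ← turn_fst b d] at h3
      exact (fst_not_mem_beyond _ h3).elim
    · have := h1.run.trail_subset h4
      rw [eq_of_mem_beyond (by simp) h3 this]
      exact h1

end Thru

/-- Two arcs that share `d` and a later edge `e` share all turns between them, so a property of
common edges can be carried along turn by turn. -/
theorem ahead_induction {p q : Set V} {d e : T.graph.Dart} (hp : T.Thru p d) (hq : T.Thru q d)
    (ha : T.Ahead d e) (hp' : T.Thru p e) (hq' : T.Thru q e) {P : T.graph.Dart → Prop} (h0 : P d)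
    (hs : ∀ x b, T.Thru p x → T.Thru q x → ¬ T.IsLeaf x.snd → T.Thru p (T.turn b x) →
      T.Thru q (T.turn b x) → P x → P (T.turn b x)) : P e := by
  have ha' := ha
  unfold Ahead at ha'
  induction ha' using Relation.ReflTransGen.head_induction_on with
  | refl => exact h0
  | @head x y hxy hy ih =>
    obtain ⟨hl, b, rfl⟩ := hxy
    have key : ∀ {r}, T.Thru r x → T.Thru r e → T.Thru r (T.turn b x) := by
      intro r hr hr'
      rcases hr.ahead_cases hr' ha with rfl | ⟨_, c, h1, h2⟩
      · have := (Ahead.snd_mem hy)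
        exact ((beyond_turn_ssubset hl).not_subset (Ahead.beyond_subset hy)).elim
      · rwa [eq_of_mem_beyond (by simp) (Ahead.snd_mem hy) (Ahead.snd_mem h2)]
    exact ih (key hp hp') (key hq hq') hy (hs x b hp hq hl (key hp hp') (key hq hq') h0)

/-! ### Comparison of words along a common stretch -/

namespace Thru

variable {p q : Set V} {d e : T.graph.Dart}

theorem agree (hp : T.Thru p d) (hq : T.Thru q d) (h : T.code p d = T.code q d)
    (ha : T.Ahead d e) (hp' : T.Thru p e) : T.Thru q e ∧ T.code p e = T.code q e := by
  refine ahead_induction (P := fun x => T.Thru q x ∧ T.code p x = T.code q x) hp hp ha hp' hp'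
    ⟨hq, h⟩ ?_
  rintro x b hx - hl hb - ⟨h1, h2⟩
  rw [hx.code_cons hl hb] at h2
  obtain ⟨-, h3, h4⟩ := h1.of_code h2.symm
  exact ⟨h3, h4.symm⟩

/-- Moving on along a common stretch removes the same first letter from both forward words and puts
the same letter in front of both backward words. -/
theorem code_lt_iff (hp : T.Thru p d) (hq : T.Thru q d) (ha : T.Ahead d e) (hp' : T.Thru p e)
    (hq' : T.Thru q e) : (T.code p d < T.code q d ↔ T.code p e < T.code q e) ∧
      (T.code p d.symm < T.code q d.symm ↔ T.code p e.symm < T.code q e.symm) := by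
  refine ahead_induction (P := fun x => (T.code p d < T.code q d ↔ T.code p x < T.code q x) ∧
      (T.code p d.symm < T.code q d.symm ↔ T.code p x.symm < T.code q x.symm)) hp hq ha hp' hq'
    (by simp) ?_
  intro x b h1 h2 hl h3 h4 ih
  rw [ih.1, ih.2, h1.code_cons hl h3, h2.code_cons hl h4, h1.code_back hl h3, h2.code_back hl h4]
  simp

theorem code_eq_iff (hp : T.Thru p d) (hq : T.Thru q d) (ha : T.Ahead d e) (hp' : T.Thru p e)
    (hq' : T.Thru q e) : (T.code p d = T.code q d ↔ T.code p e = T.code q e) ∧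
      (T.code p d.symm = T.code q d.symm ↔ T.code p e.symm = T.code q e.symm) := by
  have h1 := hp.code_lt_iff hq ha hp' hq'
  have h2 := hq.code_lt_iff hp ha hq' hp'
  rw [eq_iff_le_not_lt, eq_iff_le_not_lt, ← not_lt, ← not_lt, h1.1, h2.1,
    eq_iff_le_not_lt, eq_iff_le_not_lt, ← not_lt, ← not_lt, h1.2, h2.2]
  exact ⟨Iff.rfl, Iff.rfl⟩

/-- Two arcs that part after `d` part at a vertex where one of them turns left and the other
turns right. -/
theorem exists_parting (hp : T.Thru p d) (hq : T.Thru q d) (h : T.code p d < T.code q d) :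
    ∃ e, T.Ahead d e ∧ T.Thru p e ∧ T.Thru q e ∧ ¬ T.IsLeaf e.snd ∧ T.Thru p (T.turn false e) ∧
      T.Thru q (T.turn true e) := by
  induction hc : T.code p d generalizing d with
  | nil =>
    rw [hc] at h
    obtain ⟨b, l, hl⟩ := List.exists_cons_of_ne_nil (l := T.code q d) (by rintro h'; simp [h'] at h)
    have := (hq.of_code hl).1
    obtain ⟨b, -, hb⟩ := hp.exists_turn this
    simp [hc] at hb
  | cons b l ih =>
    obtain ⟨h1, h2, h3⟩ := hp.of_code hc
    obtain ⟨c, h4, h5⟩ := hq.exists_turn h1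
    rw [hc, h5, List.cons_lt_cons_iff] at h
    rcases h with h | ⟨rfl, h⟩
    · obtain ⟨rfl, rfl⟩ : b = false ∧ c = true := by revert h; cases b <;> cases c <;> decide
      exact ⟨d, .refl d, hp, hq, h1, h2, h4⟩
    · obtain ⟨e, he, hr⟩ := ih h2 h4 (by rw [h3]; exact h) h3
      exact ⟨e, (ahead_turn h1).trans he, hr⟩

end Thru

/-! ### Extremal words -/

theorem cons_le_cons {b c : Bool} {l k : List Bool} :
    b :: l ≤ c :: k ↔ b < c ∨ b = c ∧ l ≤ k := by
  rw [← not_lt, List.cons_lt_cons_iff]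
  cases b <;> cases c <;> simp

theorem Run.false_le {d : T.graph.Dart} {l : List Bool} (h : T.Run d l) {n : ℕ}
    (hn : T.Run d (List.replicate n false)) : List.replicate n false ≤ l := by
  induction h generalizing n with
  | leaf hl => rw [hn.eq_nil hl]
  | @turn d b l hl _ ih =>
    obtain ⟨c, k, hk, hr⟩ := hn.eq_cons hl
    obtain _ | n := n
    · simp at hk
    rw [List.replicate_succ, List.cons.injEq] at hk
    obtain ⟨rfl, rfl⟩ := hk
    rw [List.replicate_succ, cons_le_cons]
    cases b
    · exact .inr ⟨rfl, ih hr⟩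
    · exact .inl (by decide)

theorem Run.le_true {d : T.graph.Dart} {l : List Bool} (h : T.Run d l) {n : ℕ}
    (hn : T.Run d (List.replicate n true)) : l ≤ List.replicate n true := by
  induction h generalizing n with
  | leaf hl => rw [hn.eq_nil hl]
  | @turn d b l hl _ ih =>
    obtain ⟨c, k, hk, hr⟩ := hn.eq_cons hl
    obtain _ | n := n
    · simp at hk
    rw [List.replicate_succ, List.cons.injEq] at hk
    obtain ⟨rfl, rfl⟩ := hk
    rw [List.replicate_succ, cons_le_cons]
    cases b
    · exact .inl (by decide)
    · exact .inr ⟨rfl, ih hr⟩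

/-! ### Comparison of arcs through a common edge -/

variable (T) in
/-- At `d`, the arc `p` is on the left of the arc `q`. -/
def Le (p q : Set V) (d : T.graph.Dart) : Prop :=
  T.code p d ≤ T.code q d ∧ T.code q d.symm ≤ T.code p d.symm

theorem Le.symm {p q : Set V} {d : T.graph.Dart} (h : T.Le p q d) : T.Le q p d.symm := ⟨h.2, h.1⟩

theorem le_symm {p q : Set V} {d : T.graph.Dart} : T.Le p q d.symm ↔ T.Le q p d :=
  ⟨fun h => ⟨h.2, h.1⟩, fun h => ⟨h.2, h.1⟩⟩

theorem Le.trans {p q r : Set V} {d : T.graph.Dart} (h : T.Le p q d) (h' : T.Le q r d) :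
    T.Le p r d := ⟨h.1.trans h'.1, h'.2.trans h.2⟩

theorem Le.rfl {p : Set V} {d : T.graph.Dart} : T.Le p p d := ⟨le_rfl, le_rfl⟩

theorem Le.antisymm {p q : Set V} {d : T.graph.Dart} (h : T.Le p q d) (h' : T.Le q p d)
    (hp : T.Thru p d) (hq : T.Thru q d) : p = q :=
  hp.ext hq (h.1.antisymm h'.1) (h'.2.antisymm h.2)

variable (T) in
/-- The arcs are comparable at each common edge. -/
def Compat (p q : Set V) : Prop :=
  ∀ d, T.Thru p d → T.Thru q d → T.Le p q d ∨ T.Le q p d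

theorem Compat.symm {p q : Set V} (h : T.Compat p q) : T.Compat q p :=
  fun d hq hp => (h d hp hq).symm

theorem Compat.refl (p : Set V) : T.Compat p p := fun _ _ _ => .inl .rfl

variable (T) in
/-- At `d`, the arc `p` turns left of the arc `q` in both directions. -/
def Under (p q : Set V) (d : T.graph.Dart) : Prop :=
  T.code p d < T.code q d ∧ T.code p d.symm < T.code q d.symm

theorem Under.symm {p q : Set V} {d : T.graph.Dart} (h : T.Under p q d) : T.Under p q d.symm :=
  ⟨h.2, h.1⟩

theorem Compat.not_under {p q : Set V} (h : T.Compat p q) {d : T.graph.Dart} (hp : T.Thru p d)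
    (hq : T.Thru q d) : ¬ T.Under p q d := by
  rintro ⟨h1, h2⟩
  rcases h d hp hq with h | h
  · exact h2.not_ge h.2
  · exact h1.not_ge h.1

theorem exists_under_of_not_compat {p q : Set V} (h : ¬ T.Compat p q) :
    ∃ d, T.Thru p d ∧ T.Thru q d ∧ (T.Under p q d ∨ T.Under q p d) := by
  simp only [Compat, Le, not_forall] at h
  obtain ⟨d, hp, hq, h⟩ := h
  refine ⟨d, hp, hq, ?_⟩
  unfold Under
  rcases lt_trichotomy (T.code p d) (T.code q d) with h1 | h1 | h1 <;>
  rcases lt_trichotomy (T.code p d.symm) (T.code q d.symm) with h2 | h2 | h2 <;>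
  simp_all [le_of_lt]

theorem le_iff_of_ahead {p q : Set V} {d e : T.graph.Dart} (hp : T.Thru p d) (hq : T.Thru q d)
    (ha : T.Ahead d e) (hp' : T.Thru p e) (hq' : T.Thru q e) : T.Le p q d ↔ T.Le p q e := by
  have h := hq.code_lt_iff hp ha hq' hp'
  have h' := hp.code_lt_iff hq ha hp' hq'
  rw [Le, Le, ← not_lt, ← not_lt, h.1, h'.2, not_lt, not_lt]

/-- The comparison does not change along the common stretch of two arcs, and reversing the direction
exchanges the two alternatives. So comparability has to be tested at one edge only. -/
theorem comparable_iff {p q : Set V} {d e : T.graph.Dart} (hp : T.Thru p d) (hq : T.Thru q d)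
    (hp' : T.Thru p e) (hq' : T.Thru q e) :
    (T.Le p q d ∨ T.Le q p d) ↔ (T.Le p q e ∨ T.Le q p e) := by
  have key : ∀ {d e : T.graph.Dart}, T.Thru p d → T.Thru q d → T.Thru p e → T.Thru q e →
      T.Ahead d e → ((T.Le p q d ∨ T.Le q p d) ↔ (T.Le p q e ∨ T.Le q p e)) := by
    intro d e hp hq hp' hq' h
    rw [le_iff_of_ahead hp hq h hp' hq', le_iff_of_ahead hq hp h hq' hp']
  rcases hp.cases hp' with h | h | h | h
  · exact key hp hq hp' hq' h
  · have := key hp hq hp'.symm hq'.symm h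
    rwa [le_symm, le_symm, or_comm (a := T.Le q p e)] at this
  · have := key hp.symm hq.symm hp' hq' h
    rwa [le_symm, le_symm, or_comm (a := T.Le q p d)] at this
  · have := key hp.symm hq.symm hp'.symm hq'.symm h
    rwa [le_symm, le_symm, le_symm, le_symm, or_comm (a := T.Le q p d),
      or_comm (a := T.Le q p e)] at this

theorem compat_of_comparable {p q : Set V} {d : T.graph.Dart} (hp : T.Thru p d) (hq : T.Thru q d)
    (h : T.Le p q d ∨ T.Le q p d) : T.Compat p q :=
  fun _ hp' hq' => (comparable_iff hp hq hp' hq').1 h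

/-- The arc that follows `p` before `d` and `q` after `d`. -/
theorem exists_splice {p q : Set V} {d : T.graph.Dart} (hp : T.Thru p d) (hq : T.Thru q d) :
    ∃ r, T.Thru r d ∧ T.code r d = T.code q d ∧ T.code r d.symm = T.code p d.symm :=
  exists_thru hq.run hp.symm.run

/-- Followed backwards from `e`, the arc `h` leaves the common stretch of `q` and `r` before it
reaches `d`. Its backward comparisons with `q` and with `r` are therefore decided at the same
vertex. -/
theorem splice_comparable_ahead {q r h : Set V} {d e : T.graph.Dart} (hq : T.Thru q d)
    (hr : T.Thru r d) (hc : T.code r d = T.code q d) (hhq : T.Compat h q) (hd : ¬ T.Thru h d)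
    (he : T.Thru h e) (hre : T.Thru r e) (ha : T.Ahead d e) : T.Le h r e ∨ T.Le r h e := by
  obtain ⟨hqe, hce⟩ := hr.agree hq hc ha hre
  have key : T.Thru h e → ((T.code h e.symm < T.code r e.symm ↔ T.code h e.symm < T.code q e.symm) ∧
      (T.code r e.symm < T.code h e.symm ↔ T.code q e.symm < T.code h e.symm)) := by
    refine ahead_induction (P := fun e => T.Thru h e →
      ((T.code h e.symm < T.code r e.symm ↔ T.code h e.symm < T.code q e.symm) ∧
      (T.code r e.symm < T.code h e.symm ↔ T.code q e.symm < T.code h e.symm))) hr hq ha hre hqe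
      (fun h => (hd h).elim) ?_
    intro x b h1 h2 hl h3 h4 ih h5
    rw [h1.code_back hl h3, h2.code_back hl h4]
    obtain ⟨c, h6, h7⟩ := h5.symm.exists_turn (by simpa using hl)
    rw [h7]
    by_cases hcb : c = !b
    · subst hcb
      rw [turn_symm_turn] at h6 ⊢
      simpa using ih h6.of_symm
    -- Here `h` has left the stretch, and the first letter decides both comparisons.
    · obtain rfl : c = b := by cases b <;> cases c <;> simp_all
      cases c <;> simp [List.cons_lt_cons_iff]
  rcases hhq e he hqe with h1 | h1
  · left
    refine ⟨hce ▸ h1.1, ?_⟩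
    rw [← not_lt, (key he).1, not_lt]
    exact h1.2
  · right
    refine ⟨hce ▸ h1.1, ?_⟩
    rw [← not_lt, (key he).2, not_lt]
    exact h1.2

/-- An arc compatible with `p` and `q` is compatible with their splice at `d`, provided that it is
comparable with the splice at `d` if it passes there. -/
theorem splice_compat {p q r h : Set V} {d : T.graph.Dart} (hp : T.Thru p d) (hq : T.Thru q d)
    (hr : T.Thru r d) (hcq : T.code r d = T.code q d) (hcp : T.code r d.symm = T.code p d.symm)
    (hhp : T.Compat h p) (hhq : T.Compat h q)
    (hd : T.Thru h d → T.Le h r d ∨ T.Le r h d) : T.Compat h r := by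
  by_cases hhd : T.Thru h d
  · exact compat_of_comparable hhd hr (hd hhd)
  intro e he hre
  have hhd' : ¬ T.Thru h d.symm := fun h => hhd h.of_symm
  rcases hr.cases hre with ha | ha | ha | ha
  · exact splice_comparable_ahead hq hr hcq hhq hhd he hre ha
  · have := splice_comparable_ahead hq hr hcq hhq hhd he.symm hre.symm ha
    rwa [le_symm, le_symm, or_comm] at this
  · exact splice_comparable_ahead hp.symm hr.symm hcp hhp hhd' he hre ha
  · have := splice_comparable_ahead hp.symm hr.symm hcp hhp hhd' he.symm hre.symm ha
    rwa [le_symm, le_symm, or_comm] at this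

/-! ### Regions -/

theorem reg_refl (p : Set V) (F : T.Face) : F ∈ T.Reg p F := Relation.ReflTransGen.refl

theorem reg_trans {p : Set V} {F G H : T.Face} (h : G ∈ T.Reg p F) (h' : H ∈ T.Reg p G) :
    H ∈ T.Reg p F := Relation.ReflTransGen.trans h h'

theorem reg_symm {p : Set V} {F G : T.Face} (h : G ∈ T.Reg p F) : F ∈ T.Reg p G := by
  induction h with
  | refl => exact reg_refl _ _
  | tail _ hs ih =>
    obtain ⟨d, hd, rfl, rfl⟩ := hs
    exact reg_trans (Relation.ReflTransGen.single
      ⟨d.symm, fun h => hd (edgeOf_symm.1 h), rfl, rfl⟩) ih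

theorem reg_eq {p : Set V} {F G : T.Face} (h : G ∈ T.Reg p F) : T.Reg p G = T.Reg p F :=
  Set.Subset.antisymm (fun _ h' => reg_trans h h') (fun _ h' => reg_trans (reg_symm h) h')

theorem rightFace_mem_reg {p : Set V} {d : T.graph.Dart} (h : ¬ T.EdgeOf d p) :
    T.rightFace d ∈ T.Reg p (T.leftFace d) :=
  Relation.ReflTransGen.single ⟨d, h, rfl, rfl⟩

/-- A connected set of vertices on both sides of an edge has to use that edge. -/
theorem IsArc.mem_beyond_iff {p : Set V} (hp : T.IsArc p) {x : T.graph.Dart} (hx : ¬ T.EdgeOf x p)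
    {u v : V} (hu : u ∈ p) (hv : v ∈ p) : u ∈ T.beyond x → v ∈ T.beyond x := by
  classical
  intro hux
  by_contra hvx
  obtain ⟨⟨a, b, -, -, -, w, -, rfl⟩, -⟩ := hp
  have hu' : u ∈ w.support := hu
  have hv' : v ∈ w.support := hv
  obtain ⟨d, hd, hd1, hd2⟩ := ((w.takeUntil u hu').reverse.append
    (w.takeUntil v hv')).exists_boundary_dart (T.beyond x) hux hvx
  have hdx : d.symm = x := eq_of_boundary hd1 hd2
  have hsub : ∀ z ∈ ((w.takeUntil u hu').reverse.append (w.takeUntil v hv')).support,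
      z ∈ w.support := by
    intro z hz
    rw [SimpleGraph.Walk.mem_support_append_iff, SimpleGraph.Walk.support_reverse,
      List.mem_reverse] at hz
    exact hz.elim (fun h => w.support_takeUntil_subset_support _ h)
      (fun h => w.support_takeUntil_subset_support _ h)
  refine hx ?_
  rw [← hdx]
  exact ⟨hsub _ (SimpleGraph.Walk.dart_snd_mem_support_of_mem_darts _ hd),
    hsub _ (SimpleGraph.Walk.dart_fst_mem_support_of_mem_darts _ hd)⟩

theorem Thru.exists_end {p : Set V} {d : T.graph.Dart} (h : T.Thru p d) :
    ∃ e, T.Ahead d e ∧ T.Thru p e ∧ T.IsLeaf e.snd := by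
  induction hc : T.code p d generalizing d with
  | nil =>
    refine ⟨d, .refl d, h, ?_⟩
    by_contra hl
    obtain ⟨b, -, hb⟩ := h.exists_turn hl
    simp [hc] at hb
  | cons b l ih =>
    obtain ⟨h1, h2, h3⟩ := h.of_code hc
    obtain ⟨e, he, hr⟩ := ih h2 h3
    exact ⟨e, (ahead_turn h1).trans he, hr⟩

section Finite

variable [Finite V]

instance finite_dart : Finite T.graph.Dart :=
  Finite.of_injective (fun d : T.graph.Dart => d.toProd) fun _ _ h => SimpleGraph.Dart.ext _ _ h

/-- At a left turn the face stays the same. At a right turn, rotate clockwise about the vertex until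
the next edge of the arc: all edges crossed in between are off the arc. -/
theorem leftFace_turn_mem_reg {p : Set V} {x : T.graph.Dart} {b : Bool} (hx : T.Thru p x)
    (hl : ¬ T.IsLeaf x.snd) (hb : T.Thru p (T.turn b x)) :
    T.leftFace (T.turn b x) ∈ T.Reg p (T.leftFace x) := by
  cases b with
  | false => rw [leftFace_turn hl]; exact reg_refl _ _
  | true =>
    have hfst : ∀ n : ℕ, ((T.cw ^ n) x.symm).fst = x.snd := by
      intro n
      induction n with
      | zero => rfl
      | succ n ih => rw [pow_succ', Equiv.Perm.mul_apply, T.cw_fst, ih]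
    -- The second alternative records that the rotation has already met the arc again.
    have key : ∀ n : ℕ, (T.leftFace ((T.cw ^ (n + 1)) x.symm) ∈ T.Reg p (T.leftFace x) ∧
        (T.cw ^ (n + 1)) x.symm ≠ x.symm) ∨
        T.leftFace (T.turn true x) ∈ T.Reg p (T.leftFace x) := by
      intro n
      induction n with
      | zero =>
        left
        rw [zero_add, pow_one]
        exact ⟨(leftFace_turn hl) ▸ reg_refl _ _, turn_ne_symm (b := false) hl⟩
      | succ n ih =>
        rcases ih with ⟨h1, h2⟩ | h
        · have h3 := hfst (n + 1)
          set y := (T.cw ^ (n + 1)) x.symm with hy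
          by_cases hyt : y = T.turn true x
          · exact .inr (hyt ▸ h1)
          · left
            rw [pow_succ', Equiv.Perm.mul_apply, ← hy]
            have hyp : ¬ T.EdgeOf y p := by
              intro he
              rcases hx.strand.eq_symm_or_eq_turn he h3 with h4 | ⟨b, l, h4, h5⟩
              · exact h2 h4
              · rw [hx.code_cons hl hb, List.cons.injEq] at h4
                rw [← h4.1] at h5
                exact hyt h5
            rw [← rightFace_eq_leftFace_cw (h3 ▸ hl)]
            refine ⟨reg_trans h1 (rightFace_mem_reg hyp), fun h => hyt ?_⟩
            rw [turn_true, ← h, Equiv.symm_apply_apply]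
        · exact .inr h
    obtain ⟨n, hn, -, hn'⟩ := (T.cw_sameCycle x.symm (T.turn true x) (by simp)).exists_pow_eq''
    obtain ⟨n, rfl⟩ := Nat.exists_eq_succ_of_ne_zero hn.ne'
    rcases key n with h | h
    · rw [← hn']; exact h.1
    · exact h

theorem reg_eq_of_ahead {p : Set V} {d e : T.graph.Dart} (hd : T.Thru p d) (he : T.Thru p e)
    (ha : T.Ahead d e) : T.Reg p (T.leftFace e) = T.Reg p (T.leftFace d) ∧
      T.Reg p (T.rightFace e) = T.Reg p (T.rightFace d) := by
  refine ahead_induction (P := fun e => T.Reg p (T.leftFace e) = T.Reg p (T.leftFace d) ∧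
      T.Reg p (T.rightFace e) = T.Reg p (T.rightFace d)) hd hd ha he he ⟨rfl, rfl⟩ ?_
  rintro x b hx - hl hb - ⟨h1, h2⟩
  refine ⟨(reg_eq (leftFace_turn_mem_reg hx hl hb)).trans h1, ?_⟩
  rw [← h2]
  have := leftFace_turn_mem_reg (b := !b) hb.symm (by simpa using hl) (by simpa using hx.symm)
  rw [turn_symm_turn] at this
  exact (reg_eq this).symm

theorem reg_cases {p : Set V} {d e : T.graph.Dart} (hd : T.Thru p d) (he : T.Thru p e) :
    (T.Reg p (T.leftFace e) = T.Reg p (T.leftFace d) ∧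
      T.Reg p (T.rightFace e) = T.Reg p (T.rightFace d)) ∨
    (T.Reg p (T.leftFace e) = T.Reg p (T.rightFace d) ∧
      T.Reg p (T.rightFace e) = T.Reg p (T.leftFace d)) := by
  rcases hd.cases he with h | h | h | h
  · exact .inl (reg_eq_of_ahead hd he h)
  · exact .inr (reg_eq_of_ahead hd he.symm h).symm
  · exact .inr (reg_eq_of_ahead hd.symm he h)
  · exact .inl (reg_eq_of_ahead hd.symm he.symm h).symm

/-- Every face is in one of the two regions of an arc. -/
theorem mem_reg_or {p : Set V} {d : T.graph.Dart} (hd : T.Thru p d) (F : T.Face) :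
    F ∈ T.Reg p (T.leftFace d) ∨ F ∈ T.Reg p (T.rightFace d) := by
  -- `A` is closed under reversal and rotation, hence contains every dart of the connected tree.
  set A : Set T.graph.Dart :=
    {x | T.leftFace x ∈ T.Reg p (T.leftFace d) ∨ T.leftFace x ∈ T.Reg p (T.rightFace d)} with hA
  have hsymm : ∀ x ∈ A, x.symm ∈ A := by
    intro x hx
    by_cases hxp : T.EdgeOf x p
    · rcases reg_cases hd ⟨hd.1, hxp⟩ with ⟨h1, h2⟩ | ⟨h1, h2⟩
      · exact .inr (h2 ▸ reg_refl _ _)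
      · exact .inl (h2 ▸ reg_refl _ _)
    · exact hx.imp (fun h => reg_trans h (rightFace_mem_reg hxp))
        (fun h => reg_trans h (rightFace_mem_reg hxp))
  have hcw : ∀ x ∈ A, T.cw x ∈ A := by
    intro x hx
    by_cases hl : T.IsLeaf x.fst
    · rwa [cw_of_leaf hl]
    · have := hsymm x hx
      simp only [hA, Set.mem_ofPred_eq] at this ⊢
      rwa [← rightFace_eq_leftFace_cw hl]
  have hpow : ∀ x ∈ A, ∀ n : ℕ, (T.cw ^ n) x ∈ A := by
    intro x hx n
    induction n with
    | zero => exact hx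
    | succ n ih => rw [pow_succ', Equiv.Perm.mul_apply]; exact hcw _ ih
  have hv : ∀ x ∈ A, ∀ y : T.graph.Dart, x.fst = y.fst → y ∈ A := by
    intro x hx y hxy
    obtain ⟨n, hn⟩ := (T.cw_sameCycle x y hxy).exists_nat_pow_eq
    exact hn ▸ hpow x hx n
  have hall : ∀ {u v : V} (_ : T.graph.Walk u v), (∀ y : T.graph.Dart, y.fst = u → y ∈ A) →
      ∀ y : T.graph.Dart, y.fst = v → y ∈ A := by
    intro u v w
    induction w with
    | nil => exact id
    | cons hadj w ih =>
      intro h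
      exact ih fun y hy => hv _ (hsymm _ (h ⟨(_, _), hadj⟩ rfl)) y hy.symm
  obtain ⟨x, rfl⟩ := Quot.exists_rep F
  obtain ⟨w⟩ := T.isTree.connected d.fst x.fst
  exact hall w (fun y hy => hv d (.inl (reg_refl _ _)) y hy.symm) x rfl

/-- The left-hand tour of the tree that starts with `x` traverses the branch beyond `x` before it
comes back along `x`. -/
theorem tour (x : T.graph.Dart) :
    Relation.ReflTransGen (fun y z => y.snd ∈ T.beyond x ∧ z = T.turn false y) x x.symm ∧
    ∀ y : T.graph.Dart, y.snd ∈ T.beyond x →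
      Relation.ReflTransGen (fun y z => y.snd ∈ T.beyond x ∧ z = T.turn false y) x y := by
  induction hn : (T.beyond x).ncard using Nat.strong_induction_on generalizing x with
  | _ n ih =>
    set R : T.graph.Dart → T.graph.Dart → Prop :=
      fun y z => y.snd ∈ T.beyond x ∧ z = T.turn false y with hR
    have hfirst : Relation.ReflTransGen R x (T.turn false x) := .single ⟨snd_mem_beyond x, rfl⟩
    have hat : ∀ y : T.graph.Dart, y.snd ∈ T.beyond x → y.snd ≠ x.snd →
        ∃ c : T.graph.Dart, c.fst = x.snd ∧ c ≠ x.symm ∧ y.snd ∈ T.beyond c := by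
      intro y hy hne
      obtain ⟨c, hc, hyc⟩ := exists_dart_mem_beyond hne
      refine ⟨c, hc, ?_, hyc⟩
      rintro rfl
      exact mem_beyond_symm.1 hyc hy
    by_cases hl : T.IsLeaf x.snd
    · have hx : T.turn false x = x.symm := cw_of_leaf (d := x.symm) hl
      refine ⟨hx ▸ hfirst, fun y hy => ?_⟩
      by_cases hyx : y.snd = x.snd
      · have := leaf_dart_unique (d := x.symm) (e := y.symm) hl hyx.symm
        have : x = y := by simpa using congrArg SimpleGraph.Dart.symm this
        exact this ▸ .refl
      · obtain ⟨c, hc, hne, -⟩ := hat y hy hyx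
        exact (hne (leaf_dart_unique (hc.symm ▸ hl) hc)).elim
    have hbranch : ∀ c : T.graph.Dart, c.fst = x.snd → c ≠ x.symm →
        Relation.ReflTransGen R c c.symm ∧
        ∀ y : T.graph.Dart, y.snd ∈ T.beyond c → Relation.ReflTransGen R c y := by
      intro c hc hne
      have hsub := beyond_subset hc hne
      have hlt : (T.beyond c).ncard < n := by
        refine hn ▸ Set.ncard_lt_ncard (hsub.ssubset_of_ne fun h => ?_)
        have := fst_not_mem_beyond c
        rw [h, hc] at this
        exact this (snd_mem_beyond x)
      obtain ⟨h1, h2⟩ := ih _ hlt c rfl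
      have hmono : ∀ {y z}, Relation.ReflTransGen
          (fun y z => y.snd ∈ T.beyond c ∧ z = T.turn false y) y z → Relation.ReflTransGen R y z :=
        fun {y z} h => Relation.ReflTransGen.mono (fun _ _ h => ⟨hsub h.1, h.2⟩) y z h
      exact ⟨hmono h1, fun y hy => hmono (h2 y hy)⟩
    have hfst : ∀ n : ℕ, ((T.cw ^ n) x.symm).fst = x.snd := by
      intro n
      induction n with
      | zero => rfl
      | succ n ih => rw [pow_succ', Equiv.Perm.mul_apply, T.cw_fst, ih]
    -- After one branch at `x.snd` has been toured, the way back along its first edge continues into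
    -- the next branch clockwise.
    have hpow : ∀ n : ℕ, Relation.ReflTransGen R x ((T.cw ^ (n + 1)) x.symm) := by
      intro n
      induction n with
      | zero => exact hfirst
      | succ n ihn =>
        have h3 := hfst (n + 1)
        set c := (T.cw ^ (n + 1)) x.symm with hc
        rw [pow_succ', Equiv.Perm.mul_apply, ← hc]
        by_cases hcx : c = x.symm
        · rw [hcx]; exact hfirst
        · refine (ihn.trans (hbranch c h3 hcx).1).tail ⟨?_, ?_⟩
          · rw [symm_snd, h3]; exact snd_mem_beyond x
          · rw [turn_false, SimpleGraph.Dart.symm_symm]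
    have hreach : ∀ c : T.graph.Dart, c.fst = x.snd → Relation.ReflTransGen R x c := by
      intro c hc
      obtain ⟨n, hn, -, hn'⟩ := (T.cw_sameCycle x.symm c hc.symm).exists_pow_eq''
      obtain ⟨n, rfl⟩ := Nat.exists_eq_succ_of_ne_zero hn.ne'
      exact hn' ▸ hpow n
    refine ⟨hreach _ rfl, fun y hy => ?_⟩
    by_cases hyx : y.snd = x.snd
    · by_cases h : y = x
      · rw [h]
      · have hne : y.symm ≠ x.symm := fun h' => h (by simpa using congrArg SimpleGraph.Dart.symm h')
        have := (hreach y.symm hyx).trans (hbranch y.symm hyx hne).1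
        rwa [SimpleGraph.Dart.symm_symm] at this
    · obtain ⟨c, hc, hne, hyc⟩ := hat y hy hyx
      exact (hreach c hc).trans ((hbranch c hc hne).2 y hyc)

/-- The two sides of an edge of an arc are in different regions. -/
theorem leftFace_not_mem_reg {p : Set V} {d : T.graph.Dart} (hd : T.Thru p d) :
    T.leftFace d ∉ T.Reg p (T.rightFace d) := by
  obtain ⟨β, hβ, hβp, hβl⟩ := hd.exists_end
  obtain ⟨α, hα, hαp, hαl⟩ := hd.symm.exists_end
  have hne : α.snd ≠ β.snd := by
    intro h
    exact mem_beyond_symm.1 hα.snd_mem (h ▸ hβ.snd_mem)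
  -- `f x` says that the left-hand tour from `x` meets the end `β` of the arc before the end `α`. It
  -- will be constant on regions and differ on the two sides of `α`.
  let f : T.graph.Dart → Prop := fun x =>
    Relation.ReflTransGen (fun y z => y ≠ α ∧ z = T.turn false y) x β
  have hstep : ∀ {x}, x ≠ α → x ≠ β → (f x ↔ f (T.turn false x)) := by
    intro x hxα hxβ
    refine ⟨fun h => ?_, fun h => .head ⟨hxα, rfl⟩ h⟩
    rcases Relation.ReflTransGen.cases_head h with h | ⟨z, ⟨-, rfl⟩, h⟩
    · exact (hxβ h).elim
    · exact h
  have hside : ∀ x y : T.graph.Dart, T.SideStep x y → f x = f y := by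
    rintro x y ⟨hl, rfl⟩
    exact propext (hstep (by rintro rfl; exact hl hαl) (by rintro rfl; exact hl hβl))
  let g : T.Face → Prop := Quot.lift f hside
  -- The branch beyond `x` contains neither end of the arc, so the tour passes through it and
  -- returns without a change of `f`.
  have hoff : ∀ {x : T.graph.Dart}, ¬ T.EdgeOf x p → α.snd ∉ T.beyond x → (f x ↔ f x.symm) := by
    intro x hx ha
    have hb : β.snd ∉ T.beyond x := fun hb => ha (hd.1.mem_beyond_iff hx hβp.2.2 hαp.2.2 hb)
    have key : ∀ {y}, Relation.ReflTransGen (fun y z => y.snd ∈ T.beyond x ∧ z = T.turn false y)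
        x y → (f x ↔ f y) := by
      intro y hy
      induction hy with
      | refl => exact Iff.rfl
      | tail _ hyz ih =>
        obtain ⟨h1, rfl⟩ := hyz
        exact ih.trans (hstep (by rintro rfl; exact ha h1) (by rintro rfl; exact hb h1))
    exact key (tour x).1
  have hreg : ∀ {F G : T.Face}, G ∈ T.Reg p F → (g F ↔ g G) := by
    intro F G h
    induction h with
    | refl => exact Iff.rfl
    | tail _ hs ih =>
      obtain ⟨x, hx, rfl, rfl⟩ := hs
      refine ih.trans ?_
      by_cases ha : α.snd ∈ T.beyond x
      · have := hoff (x := x.symm) (fun h => hx (edgeOf_symm.1 h))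
          (fun h => mem_beyond_symm.1 h ha)
        rw [SimpleGraph.Dart.symm_symm] at this
        exact this.symm
      · exact hoff hx ha
  have hα1 : ¬ f α := by
    intro h
    rcases Relation.ReflTransGen.cases_head h with h | ⟨z, ⟨h, -⟩, -⟩
    · exact hne (h ▸ rfl)
    · exact h rfl
  have hα2 : f α.symm := by
    have hmem : β.snd ∈ T.beyond α.symm := by
      by_contra hc
      obtain ⟨c, hc1, hc2⟩ := exists_dart_mem_beyond hne.symm
      have : α.symm = c := leaf_dart_unique hαl hc1.symm
      exact hc (this ▸ hc2)
    refine Relation.ReflTransGen.mono ?_ _ _ ((tour α.symm).2 β hmem)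
    rintro y z ⟨hy, rfl⟩
    refine ⟨?_, rfl⟩
    rintro rfl
    exact fst_not_mem_beyond y.symm hy
  have hα3 : ¬ (T.leftFace α ∈ T.Reg p (T.rightFace α)) := fun h => hα1 ((hreg h).1 hα2)
  intro h
  rcases reg_cases hαp hd with ⟨h1, h2⟩ | ⟨h1, h2⟩
  · rw [h2] at h
    have := reg_eq h
    rw [h1] at this
    exact hα3 (this ▸ reg_refl _ _)
  · rw [h2] at h
    have := reg_eq h
    rw [h1] at this
    exact hα3 (this.symm ▸ reg_refl _ _)

end Finite

/-! ### Regions and the comparison of arcs -/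

/-- A branch that leaves the arc does not meet it again, so its faces all lie on the side away from
which the arc turns. -/
theorem leftFace_mem_reg_of_ahead_turn {p : Set V} {d z : T.graph.Dart} {b : Bool}
    (hd : T.Thru p d) (hl : ¬ T.IsLeaf d.snd) (hb : T.Thru p (T.turn b d))
    (hz : T.Ahead (T.turn (!b) d) z) :
    T.leftFace z ∈ T.Reg p (bif b then T.leftFace d else T.rightFace d) := by
  have hnot : ¬ T.EdgeOf (T.turn (!b) d) p := by
    intro h
    have := hd.turn_unique hl ⟨hd.1, h⟩ hb
    cases b <;> simp at this
  have hdisj : ∀ x : T.graph.Dart, x.snd ∈ T.beyond (T.turn (!b) d) → ¬ T.EdgeOf x p := by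
    intro x hx he
    have := hd.1.mem_beyond_iff hnot he.2 hd.2.2 hx
    rw [← turn_fst (!b) d] at this
    exact fst_not_mem_beyond _ this
  unfold Ahead at hz
  induction hz with
  | refl =>
    cases b
    · have := reg_symm (rightFace_mem_reg hnot)
      simpa [rightFace_turn hl] using this
    · simpa [leftFace_turn hl] using reg_refl _ _
  | @tail x y hx hxy ih =>
    obtain ⟨hxl, c, rfl⟩ := hxy
    have hx' : T.Ahead (T.turn (!b) d) x := hx
    refine reg_trans ih ?_
    cases c
    · rw [leftFace_turn hxl]; exact reg_refl _ _
    · have h1 := rightFace_mem_reg (hdisj x hx'.snd_mem)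
      have h2 := rightFace_mem_reg (hdisj (T.turn true x) ((hx'.trans (ahead_turn hxl)).snd_mem))
      rw [rightFace_turn hxl] at h2
      exact reg_trans h1 (reg_symm h2)

section Finite

variable [Finite V]

theorem leftFace_mem_reg_of_ahead {p q : Set V} {d x : T.graph.Dart} (hp : T.Thru p d)
    (hq : T.Thru q d) (ha : T.Ahead d x) (hqx : T.Thru q x) (hpx : ¬ T.EdgeOf x p) :
    (T.code p d ≤ T.code q d → T.leftFace x ∈ T.Reg p (T.rightFace d)) ∧
    (T.code q d ≤ T.code p d → T.leftFace x ∈ T.Reg p (T.leftFace d)) := by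
  induction hc : T.code q d generalizing d with
  | nil =>
    rcases hq.ahead_cases hqx ha with rfl | ⟨hl, c, h1, h2⟩
    · exact (hpx hp.2).elim
    · rw [hq.code_cons hl h1] at hc
      simp at hc
  | cons c l ih =>
    rcases hq.ahead_cases hqx ha with rfl | ⟨hl, c', h1, h2⟩
    · exact (hpx hp.2).elim
    rw [hq.code_cons hl h1, List.cons.injEq] at hc
    obtain ⟨rfl, hc⟩ := hc
    obtain ⟨b, h3, h4⟩ := hp.exists_turn hl
    rw [h4]
    by_cases hbc : b = c'
    · subst hbc
      have := ih h3 h1 h2 hc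
      obtain ⟨hr1, hr2⟩ := reg_eq_of_ahead hp h3 (ahead_turn hl)
      rw [hr1, hr2] at this
      simpa [cons_le_cons] using this
    · obtain rfl : c' = !b := by revert hbc; cases b <;> cases c' <;> simp
      have := leftFace_mem_reg_of_ahead_turn hp hl h3 h2
      cases b <;> simpa [cons_le_cons] using this

/-- A sequence of faces that does not cross `p` could leave the region of `q` only through an edge
of `q` off `p`. Such an edge lies on the right of `p`, the side that the sequence never reaches. -/
theorem Le.reg_subset {p q : Set V} {d : T.graph.Dart} (h : T.Le p q d) (hp : T.Thru p d)
    (hq : T.Thru q d) : T.Reg p (T.leftFace d) ⊆ T.Reg q (T.leftFace d) := by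
  intro G hG
  have hG' : Relation.ReflTransGen (T.AdjacentOff p) (T.leftFace d) G := hG
  induction hG' with
  | refl => exact reg_refl _ _
  | tail hF hs ih =>
    obtain ⟨x, hx, rfl, rfl⟩ := hs
    have hF' := ih hF
    by_cases hxq : T.EdgeOf x q
    · exfalso
      have hxp : T.leftFace x ∈ T.Reg p (T.rightFace d) := by
        have hxs : ¬ T.EdgeOf x.symm p := fun h => hx (edgeOf_symm.1 h)
        have hqx : T.Thru q x := ⟨hq.1, hxq⟩
        have hback : T.leftFace x.symm ∈ T.Reg p (T.rightFace d) →
            T.leftFace x ∈ T.Reg p (T.rightFace d) :=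
          fun h => reg_trans h (reg_symm (rightFace_mem_reg hx))
        rcases hq.cases hqx with ha | ha | ha | ha
        · exact (leftFace_mem_reg_of_ahead hp hq ha hqx hx).1 h.1
        · exact hback ((leftFace_mem_reg_of_ahead hp hq ha hqx.symm hxs).1 h.1)
        · exact (leftFace_mem_reg_of_ahead hp.symm hq.symm ha hqx hx).2 h.2
        · exact hback ((leftFace_mem_reg_of_ahead hp.symm hq.symm ha hqx.symm hxs).2 h.2)
      exact leftFace_not_mem_reg hp (reg_trans hxp (reg_symm hF))
    · exact reg_trans hF' (rightFace_mem_reg hxq)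

/-- If `q` turned left where `p` turns right, the face left of the next edge of `p` would be on the
right of `q`. -/
theorem code_le_of_reg_subset {p q : Set V} {d : T.graph.Dart} (hp : T.Thru p d) (hq : T.Thru q d)
    (h : T.Reg p (T.leftFace d) ⊆ T.Reg q (T.leftFace d)) : T.code p d ≤ T.code q d := by
  by_contra hlt
  obtain ⟨e, he, hqe, hpe, hl, h1, h2⟩ := hq.exists_parting hp (not_le.1 hlt)
  have h3 : T.leftFace (T.turn true e) ∈ T.Reg p (T.leftFace d) := by
    rw [← (reg_eq_of_ahead hp h2 (he.trans (ahead_turn hl))).1]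
    exact reg_refl _ _
  have h4 := leftFace_mem_reg_of_ahead_turn hqe hl h1 (.refl _)
  rw [cond_false, (reg_eq_of_ahead hq hqe he).2] at h4
  exact leftFace_not_mem_reg hq (reg_trans h4 (reg_symm (h h3)))

theorem reg_subset_iff {p q : Set V} {d : T.graph.Dart} (hp : T.Thru p d) (hq : T.Thru q d) :
    T.Reg p (T.leftFace d) ⊆ T.Reg q (T.leftFace d) ↔ T.Le p q d := by
  refine ⟨fun h => ⟨code_le_of_reg_subset hp hq h, code_le_of_reg_subset hq.symm hp.symm ?_⟩,
    fun h => h.reg_subset hp hq⟩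
  intro G hG
  refine (mem_reg_or hp G).resolve_left fun hG' => ?_
  exact leftFace_not_mem_reg hq (reg_trans hG (reg_symm (h hG')))

/-- A single interior edge is already a segment, so a crossing can be detected there. At an edge
with a leaf both arcs have an empty word in one direction and comparability is automatic. -/
theorem noncrossing_iff {p q : Set V} (hp : T.IsArc p) (hq : T.IsArc q) :
    T.Noncrossing p q ↔ T.Compat p q := by
  constructor
  · intro h d hdp hdq
    by_cases h1 : T.IsLeaf d.fst
    · rw [Le, Le, hdp.symm.code_nil h1, hdq.symm.code_nil h1]
      simpa using le_total _ _
    by_cases h2 : T.IsLeaf d.snd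
    · rw [Le, Le, hdp.code_nil h2, hdq.code_nil h2]
      simpa using le_total _ _
    have hs : T.IsSegment {d.fst, d.snd} := by
      refine ⟨⟨d.fst, d.snd, d.adj.ne, h1, h2, .cons d.adj .nil, ?_, ?_⟩, ?_⟩
      · simp [d.adj.ne]
      · ext; simp
      · intro x y hxy hne hx hy
        refine (hne (dart_ext hxy ?_)).elim
        have := x.adj.ne
        have := y.adj.ne
        obtain ⟨hx1, hx2⟩ := hx
        obtain ⟨hy1, hy2⟩ := hy
        simp only [Set.mem_insert_iff, Set.mem_singleton_iff] at *
        grind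
    have hc := h {d.fst, d.snd}
    simp only [CrossAlong, not_and, not_forall, not_not] at hc
    obtain ⟨Rp, Rq, ⟨F, rfl⟩, ⟨G, rfl⟩, hc⟩ := hc hs
      (by simp [Set.insert_subset_iff, hdp.2.1, hdp.2.2])
      (by simp [Set.insert_subset_iff, hdq.2.1, hdq.2.2])
    have hc : T.Reg p F ⊆ T.Reg q G ∨ T.Reg q G ⊆ T.Reg p F := by
      by_contra hcon
      rw [not_or] at hcon
      exact hcon.2 (hc hcon.1)
    have hF := mem_reg_or hdp F
    have hG := mem_reg_or hdq G
    have hlp := leftFace_not_mem_reg hdp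
    have hlq := leftFace_not_mem_reg hdq
    have hrp : T.rightFace d ∉ T.Reg p (T.leftFace d) := fun h => hlp (reg_symm h)
    have hrq : T.rightFace d ∉ T.Reg q (T.leftFace d) := fun h => hlq (reg_symm h)
    have iff1 := reg_subset_iff hdp hdq
    have iff2 := reg_subset_iff hdq hdp
    have iff3 := reg_subset_iff hdp.symm hdq.symm
    have iff4 := reg_subset_iff hdq.symm hdp.symm
    rw [le_symm] at iff3 iff4
    change T.Reg p (T.rightFace d) ⊆ T.Reg q (T.rightFace d) ↔ _ at iff3
    change T.Reg q (T.rightFace d) ⊆ T.Reg p (T.rightFace d) ↔ _ at iff4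
    rcases hF with hF | hF <;> rcases hG with hG | hG <;> rw [reg_eq hF, reg_eq hG] at hc
    · exact hc.imp iff1.1 iff2.1
    · exact (hc.elim (fun h => hlq (h (reg_refl _ _))) (fun h => hrp (h (reg_refl _ _)))).elim
    · exact (hc.elim (fun h => hrq (h (reg_refl _ _))) (fun h => hlp (h (reg_refl _ _)))).elim
    · exact (hc.imp iff3.1 iff4.1).symm
  · rintro h s ⟨⟨⟨a, b, hab, -, -, w, -, rfl⟩, -⟩, hsp, hsq, hc⟩
    cases w with
    | nil => exact hab rfl
    | @cons _ v _ hadj w =>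
      have hv : v ∈ w.support := w.start_mem_support
      have hdp : T.Thru p ⟨(a, v), hadj⟩ := ⟨hp, hsp (by simp), hsp (by simp)⟩
      have hdq : T.Thru q ⟨(a, v), hadj⟩ := ⟨hq, hsq (by simp), hsq (by simp)⟩
      obtain ⟨h1, h2⟩ := hc _ _ ⟨T.leftFace ⟨(a, v), hadj⟩, rfl⟩ ⟨T.leftFace ⟨(a, v), hadj⟩, rfl⟩
      rcases h _ hdp hdq with h | h
      · exact h1 (h.reg_subset hdp hdq)
      · exact h2 (h.reg_subset hdq hdp)

end Finite

/-! ### Boundary arcs -/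

theorem Run.le_of_true_not_mem {d : T.graph.Dart} {l k : List Bool} (hl : T.Run d l)
    (hk : T.Run d k) (h : true ∉ l) : l ≤ k := by
  have : l = List.replicate l.length false :=
    List.eq_replicate_of_mem fun b hb => by cases b <;> simp_all
  rw [this] at hl ⊢
  exact hk.false_le hl

theorem Run.le_of_false_not_mem {d : T.graph.Dart} {l k : List Bool} (hl : T.Run d l)
    (hk : T.Run d k) (h : false ∉ l) : k ≤ l := by
  have : l = List.replicate l.length true :=
    List.eq_replicate_of_mem fun b hb => by cases b <;> simp_all
  rw [this] at hl ⊢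
  exact hk.le_true hl

theorem Run.onFace {d : T.graph.Dart} {l : List Bool} (h : T.Run d l) :
    (true ∉ l → ∀ v ∈ T.trail l d, T.OnFace v (T.leftFace d)) ∧
    (false ∉ l → ∀ v ∈ T.trail l d, T.OnFace v (T.rightFace d)) := by
  induction h with
  | @leaf d hl =>
    refine ⟨fun _ v hv => ⟨d.symm, hv.symm, .inr rfl⟩, fun _ v hv => ⟨d.symm, hv.symm, .inl rfl⟩⟩
  | @turn d b l hl _ ih =>
    constructor
    · intro hn v hv
      obtain rfl : b = false := by cases b <;> simp_all
      rcases hv with rfl | hv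
      · exact ⟨d.symm, rfl, .inr rfl⟩
      · rw [← leftFace_turn hl]
        exact ih.1 (fun h => hn (List.mem_cons_of_mem _ h)) v hv
    · intro hn v hv
      obtain rfl : b = true := by cases b <;> simp_all
      rcases hv with rfl | hv
      · exact ⟨d.symm, rfl, .inl rfl⟩
      · rw [← rightFace_turn hl]
        exact ih.2 (fun h => hn (List.mem_cons_of_mem _ h)) v hv

/-- Among the sides of `F` that start at the two ends of `d`, one is ahead of the other. It leads
towards an adjacent vertex, so it runs along `d`. -/
theorem borders_of_onFace {d : T.graph.Dart} {F : T.Face} (h₁ : T.OnFace d.fst F)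
    (h₂ : T.OnFace d.snd F) : T.Borders F d := by
  obtain ⟨x, hx, hxF⟩ := h₁
  obtain ⟨y, hy, hyF⟩ := h₂
  by_cases h1 : T.IsLeaf d.fst
  · exact leaf_dart_unique h1 hx.symm ▸ hxF
  by_cases h2 : T.IsLeaf d.snd
  · rw [← leaf_dart_unique (d := d.symm) h2 hy.symm] at hyF
    exact hyF.symm
  have key : ∀ {x : T.graph.Dart}, ¬ T.IsLeaf x.fst → T.Borders F x →
      ∃ x' : T.graph.Dart, x'.fst = x.fst ∧ F = T.leftFace x' := by
    rintro x hx (h | h)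
    · exact ⟨x, rfl, h⟩
    · exact ⟨T.cw x, T.cw_fst x, by rw [h, rightFace_eq_leftFace_cw hx]⟩
  obtain ⟨x', hx', hxF'⟩ := key (hx ▸ h1) hxF
  obtain ⟨y', hy', hyF'⟩ := key (hy ▸ h2) hyF
  rw [hx] at hx'
  rw [hy] at hy'
  rcases ahead_of_leftFace_eq (hxF'.symm.trans hyF') with h | h <;>
    rcases h.eq_or_fst_mem with h' | h'
  · exact (d.adj.ne (by rw [← hx', ← hy', h'])).elim
  · rw [hy'] at h'
    exact .inl ((eq_of_mem_beyond hx'.symm (snd_mem_beyond d) h') ▸ hxF')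
  · exact (d.adj.ne (by rw [← hx', ← hy', h'])).elim
  · rw [hx'] at h'
    have := eq_of_mem_beyond (d := d.symm) hy'.symm (snd_mem_beyond d.symm) h'
    exact .inr (by rw [hyF', ← this]; rfl)

theorem not_mem_code_of_borders {p : Set V} {F : T.Face}
    (hF : ∀ d, T.EdgeOf d p → T.Borders F d) {d : T.graph.Dart} (hd : T.Thru p d) :
    (F = T.leftFace d → true ∉ T.code p d) ∧ (F = T.rightFace d → false ∉ T.code p d) := by
  induction hc : T.code p d generalizing d with
  | nil => simp
  | cons b l ih =>
    obtain ⟨hl, h1, h2⟩ := hd.of_code hc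
    obtain ⟨ih1, ih2⟩ := ih h1 h2
    have hne := leftFace_ne_rightFace hl
    constructor
    · intro h
      cases b with
      | false => simpa using ih1 (h.trans (leftFace_turn hl).symm)
      | true =>
        exfalso
        rcases hF _ h1.2 with h' | h'
        · rw [h, ← leftFace_turn hl] at h'
          exact turn_ne_turn (b := false) hl (eq_of_leftFace_eq (by simp) h').symm
        · rw [rightFace_turn hl] at h'
          exact hne (h.symm.trans h')
    · intro h
      cases b with
      | true => simpa using ih2 (h.trans (rightFace_turn hl).symm)
      | false =>
        exfalso
        rcases hF _ h1.2 with h' | h'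
        · rw [leftFace_turn hl] at h'
          exact hne (h'.symm.trans h)
        · have hl' : ¬ T.IsLeaf (T.turn false d).symm.snd := by simpa using hl
          have h3 := leftFace_turn hl'
          have h4 : T.turn false (T.turn false d).symm = d.symm := by
            refine eq_of_leftFace_eq (by simp) ?_
            exact h3.trans (h'.symm.trans h)
          have h5 := turn_symm_turn false d
          exact turn_ne_turn hl' (h5.trans h4.symm)

/-- An arc keeps bordering a face exactly as long as it turns towards that face. -/
theorem Thru.isBoundaryArc_iff {p : Set V} {d : T.graph.Dart} (hd : T.Thru p d) :
    T.IsBoundaryArc p ↔ (true ∉ T.code p d ∧ false ∉ T.code p d.symm) ∨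
      (false ∉ T.code p d ∧ true ∉ T.code p d.symm) := by
  constructor
  · rintro ⟨hp, F, hF⟩
    have hF' : ∀ d, T.EdgeOf d p → T.Borders F d :=
      fun d hd => borders_of_onFace (hF _ hd.1) (hF _ hd.2)
    have h1 := not_mem_code_of_borders hF' hd
    have h2 := not_mem_code_of_borders hF' hd.symm
    rcases hF' d hd.2 with h | h
    · exact .inl ⟨h1.1 h, h2.2 h⟩
    · exact .inr ⟨h1.2 h, h2.1 h⟩
  · intro h
    have h1 := hd.run.onFace
    have h2 := hd.symm.run.onFace
    rw [IsBoundaryArc, hd.strand.2.2]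
    refine ⟨hd.strand.2.2 ▸ hd.1, ?_⟩
    rcases h with ⟨h3, h4⟩ | ⟨h3, h4⟩
    · exact ⟨T.leftFace d, fun v hv => hv.elim (h1.1 h3 v) (h2.2 h4 v)⟩
    · exact ⟨T.rightFace d, fun v hv => hv.elim (h1.2 h3 v) (h2.1 h4 v)⟩

theorem IsBoundaryArc.le_or {p q : Set V} (h : T.IsBoundaryArc p) {d : T.graph.Dart}
    (hp : T.Thru p d) (hq : T.Thru q d) : T.Le p q d ∨ T.Le q p d := by
  rcases hp.isBoundaryArc_iff.1 h with ⟨h1, h2⟩ | ⟨h1, h2⟩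
  · exact .inl ⟨hp.run.le_of_true_not_mem hq.run h1, hp.symm.run.le_of_false_not_mem hq.symm.run h2⟩
  · exact .inr ⟨hp.run.le_of_false_not_mem hq.run h1, hp.symm.run.le_of_true_not_mem hq.symm.run h2⟩

theorem IsBoundaryArc.compat {p q : Set V} (h : T.IsBoundaryArc p) : T.Compat p q :=
  fun _ hp hq => h.le_or hp hq

theorem exists_boundary_right [Finite V] (d : T.graph.Dart) :
    ∃ p, T.Thru p d ∧ T.IsBoundaryArc p ∧ false ∉ T.code p d ∧ true ∉ T.code p d.symm := by
  obtain ⟨n, hn⟩ := exists_run true d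
  obtain ⟨m, hm⟩ := exists_run false d.symm
  obtain ⟨p, hp, h1, h2⟩ := exists_thru hn hm
  have h3 : false ∉ T.code p d ∧ true ∉ T.code p d.symm := by
    rw [h1, h2]
    simp [List.mem_replicate]
  exact ⟨p, hp, hp.isBoundaryArc_iff.2 (.inr h3), h3⟩

/-! ### Marked corners -/

variable (T) in
/-- In `S`, the arc `p` is the rightmost of the arcs that turn left after `d`. -/
def MarkL (S : Set (Set V)) (p : Set V) (d : T.graph.Dart) : Prop :=
  (p ∈ S ∧ ¬ T.IsLeaf d.snd ∧ T.Thru p d ∧ T.Thru p (T.turn false d)) ∧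
    ∀ q ∈ S, T.Thru q d → T.Thru q (T.turn false d) → T.Le q p d

variable (T) in
/-- In `S`, the arc `p` is the leftmost of the arcs that turn right after `d`. -/
def MarkR (S : Set (Set V)) (p : Set V) (d : T.graph.Dart) : Prop :=
  (p ∈ S ∧ ¬ T.IsLeaf d.snd ∧ T.Thru p d ∧ T.Thru p (T.turn true d)) ∧
    ∀ q ∈ S, T.Thru q d → T.Thru q (T.turn true d) → T.Le p q d

/-- Both marks refer to the same corner, seen along the two directions of the arc. -/
theorem MarkL.markR {S : Set (Set V)} {p : Set V} {d : T.graph.Dart} (h : T.MarkL S p d) :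
    T.MarkR S p (T.turn false d).symm := by
  obtain ⟨⟨h1, h2, h3, h4⟩, h5⟩ := h
  have ht : T.turn true (T.turn false d).symm = d.symm := turn_symm_turn false d
  refine ⟨⟨h1, by simpa using h2, h4.symm, ht ▸ h3.symm⟩, fun q hq h6 h7 => ?_⟩
  rw [ht] at h7
  rw [le_symm, ← le_iff_of_ahead h7.of_symm h3 (ahead_turn h2) h6.of_symm h4]
  exact h5 q hq h7.of_symm h6.of_symm

theorem MarkR.markL {S : Set (Set V)} {p : Set V} {d : T.graph.Dart} (h : T.MarkR S p d) :
    T.MarkL S p (T.turn true d).symm := by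
  obtain ⟨⟨h1, h2, h3, h4⟩, h5⟩ := h
  have ht : T.turn false (T.turn true d).symm = d.symm := turn_symm_turn true d
  refine ⟨⟨h1, by simpa using h2, h4.symm, ht ▸ h3.symm⟩, fun q hq h6 h7 => ?_⟩
  rw [ht] at h7
  rw [le_symm, ← le_iff_of_ahead h3 h7.of_symm (ahead_turn h2) h4 h6.of_symm]
  exact h5 q hq h7.of_symm h6.of_symm

theorem containsCorner_iff {p : Set V} (hp : T.IsArc p) {v : V} {F : T.Face} :
    T.ContainsCorner p v F ↔ ∃ d : T.graph.Dart, d.snd = v ∧ F = T.leftFace d ∧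
      ¬ T.IsLeaf d.snd ∧ T.Thru p d ∧ T.Thru p (T.turn false d) := by
  constructor
  · rintro ⟨hl, x, y, rfl, hy, hne, hxp, hyp, hxF, hyF⟩
    rcases corner_of_borders hl hy.symm hne hxF hyF with ⟨rfl, h⟩ | ⟨rfl, h⟩
    · exact ⟨x.symm, rfl, h.trans (leftFace_turn (d := x.symm) hl), hl, ⟨hp, hxp.symm⟩, hp, hyp⟩
    · refine ⟨y.symm, hy, h.trans (leftFace_turn (d := y.symm) ?_), ?_, ⟨hp, hyp.symm⟩, hp, hxp⟩ <;>
      rwa [symm_snd, hy]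
  · rintro ⟨d, rfl, rfl, hl, h1, h2⟩
    refine ⟨hl, d.symm, T.turn false d, rfl, by simp, (turn_ne_symm hl).symm, h1.symm.2, h2.2,
      .inr rfl, .inl (leftFace_turn hl).symm⟩

theorem eq_of_leftFace_eq_of_snd {d e : T.graph.Dart} (hl : ¬ T.IsLeaf d.snd) (h : d.snd = e.snd)
    (hF : T.leftFace d = T.leftFace e) : d = e := by
  have hl' : ¬ T.IsLeaf e.snd := by rwa [← h]
  rw [← leftFace_turn hl, ← leftFace_turn hl'] at hF
  have := T.cw.injective (eq_of_leftFace_eq (by simp [h]) hF : T.turn false d = T.turn false e)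
  simpa using congrArg SimpleGraph.Dart.symm this

theorem marked_iff [Finite V] {S : Set (Set V)} (hS : ∀ p ∈ S, T.IsArc p) {p : Set V} {v : V}
    {F : T.Face} : T.Marked S p v F ↔
      ∃ d : T.graph.Dart, d.snd = v ∧ F = T.leftFace d ∧ T.MarkL S p d := by
  constructor
  · rintro ⟨hp, hc, hq⟩
    obtain ⟨d, rfl, rfl, hl, h1, h2⟩ := (containsCorner_iff (hS p hp)).1 hc
    refine ⟨d, rfl, rfl, ⟨hp, hl, h1, h2⟩, fun q hqS h3 h4 => ?_⟩
    exact (reg_subset_iff h3 h1).1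
      (hq q hqS ((containsCorner_iff (hS q hqS)).2 ⟨d, rfl, rfl, hl, h3, h4⟩))
  · rintro ⟨d, rfl, rfl, ⟨hp, hl, h1, h2⟩, h⟩
    refine ⟨hp, (containsCorner_iff (hS p hp)).2 ⟨d, rfl, rfl, hl, h1, h2⟩, fun q hqS hqc => ?_⟩
    obtain ⟨e, he, heF, -, h3, h4⟩ := (containsCorner_iff (hS q hqS)).1 hqc
    obtain rfl := eq_of_leftFace_eq_of_snd hl he.symm heF
    exact (reg_subset_iff h3 h1).2 (h q hqS h3 h4)

/-! ### Turns and order of edges along an arc -/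

theorem Thru.code_lt_of_turn {p q : Set V} {d : T.graph.Dart} (hp : T.Thru p d) (hq : T.Thru q d)
    (hl : ¬ T.IsLeaf d.snd) (hp' : T.Thru p (T.turn false d)) (hq' : T.Thru q (T.turn true d)) :
    T.code p d < T.code q d := by
  rw [hp.code_cons hl hp', hq.code_cons hl hq', List.cons_lt_cons_iff]
  exact .inl (by decide)

theorem Thru.ne_of_turn {p q : Set V} {d : T.graph.Dart} (hp : T.Thru p d)
    (hl : ¬ T.IsLeaf d.snd) (hp' : T.Thru p (T.turn false d)) (hq' : T.Thru q (T.turn true d)) :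
    q ≠ p := by
  rintro rfl
  have := hp.turn_unique hl hp' hq'
  simp at this

theorem Thru.ahead_turn_of_ne {p : Set V} {d e : T.graph.Dart} {b : Bool} (hd : T.Thru p d)
    (hl : ¬ T.IsLeaf d.snd) (hb : T.Thru p (T.turn b d)) (he : T.Thru p e) (ha : T.Ahead d e)
    (hne : d ≠ e) : T.Ahead (T.turn b d) e := by
  obtain ⟨-, c, hc, h⟩ := (hd.ahead_cases he ha).resolve_left hne
  rwa [hd.turn_unique hl hb hc]

theorem Thru.ahead_total {p : Set V} {d e f : T.graph.Dart} (hd : T.Thru p d) (he : T.Thru p e)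
    (hf : T.Thru p f) (hde : T.Ahead d e) (hdf : T.Ahead d f) : T.Ahead e f ∨ T.Ahead f e := by
  refine ahead_induction (P := fun x => T.Ahead x f ∨ T.Ahead f x) hd hd hde he he (.inl hdf) ?_
  rintro x b hx - hl hb - (h | h)
  · by_cases hxf : x = f
    · exact .inr (hxf ▸ ahead_turn hl)
    · exact .inl (hx.ahead_turn_of_ne hl hb hf h hxf)
  · exact .inr (h.trans (ahead_turn hl))

theorem Thru.mem_code_back {p : Set V} {d e : T.graph.Dart} {b : Bool} (hd : T.Thru p d)
    (he : T.Thru p e) (ha : T.Ahead d e) (hb : b ∈ T.code p d.symm) : b ∈ T.code p e.symm := by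
  refine ahead_induction (P := fun e => b ∈ T.code p e.symm) hd hd ha he he hb ?_
  intro x c hx _ hl hc _ h
  rw [hx.code_back hl hc]
  exact List.mem_cons_of_mem _ h

theorem Thru.exists_turn_of_mem {p : Set V} {d : T.graph.Dart} {b : Bool} (hd : T.Thru p d)
    (hb : b ∈ T.code p d) :
    ∃ e, T.Ahead d e ∧ T.Thru p e ∧ ¬ T.IsLeaf e.snd ∧ T.Thru p (T.turn b e) := by
  induction hc : T.code p d generalizing d with
  | nil => simp [hc] at hb
  | cons c l ih =>
    obtain ⟨hl, h1, h2⟩ := hd.of_code hc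
    rw [hc, List.mem_cons] at hb
    rcases hb with rfl | hb
    · exact ⟨d, .refl d, hd, hl, h1⟩
    · obtain ⟨e, he, hr⟩ := ih h1 (by rwa [h2]) h2
      exact ⟨e, (ahead_turn hl).trans he, hr⟩

/-! ### The arcs compatible with a facet -/

/-- The arcs compatible with all arcs of the facet `S`: its elements and the boundary arcs. -/
def Facet.hat (S : T.Facet) : Set (Set V) := {p | T.IsArc p ∧ ∀ q ∈ S.1, T.Compat p q}

theorem Facet.isArc (S : T.Facet) {p : Set V} (hp : p ∈ S.1) : T.IsArc p := S.2.prop.1.1 p hp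

theorem Facet.boundary_mem_hat (S : T.Facet) {p : Set V} (hp : T.IsBoundaryArc p) : p ∈ S.hat :=
  ⟨hp.1, fun _ _ => hp.compat⟩

theorem Facet.not_boundary (S : T.Facet) {p : Set V} (hp : p ∈ S.1) : ¬ T.IsBoundaryArc p :=
  S.2.prop.2 p hp

section Finite

variable [Finite V]

theorem Facet.compat (S : T.Facet) {p q : Set V} (hp : p ∈ S.1) (hq : q ∈ S.1) : T.Compat p q :=
  (noncrossing_iff (S.isArc hp) (S.isArc hq)).1 (S.2.prop.1.2 p hp q hq)

theorem Facet.subset_hat (S : T.Facet) : S.1 ⊆ S.hat := fun _ hp => ⟨S.isArc hp, fun _ => S.compat hp⟩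

theorem isReducedNoncrossingSet_iff {S : Set (Set V)} :
    T.IsReducedNoncrossingSet S ↔ (∀ p ∈ S, T.IsArc p ∧ ¬ T.IsBoundaryArc p) ∧
      ∀ p ∈ S, ∀ q ∈ S, T.Compat p q := by
  constructor
  · rintro ⟨⟨h1, h2⟩, h3⟩
    exact ⟨fun p hp => ⟨h1 p hp, h3 p hp⟩,
      fun p hp q hq => (noncrossing_iff (h1 p hp) (h1 q hq)).1 (h2 p hp q hq)⟩
  · rintro ⟨h1, h2⟩
    exact ⟨⟨fun p hp => (h1 p hp).1, fun p hp q hq =>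
      (noncrossing_iff (h1 p hp).1 (h1 q hq).1).2 (h2 p hp q hq)⟩, fun p hp => (h1 p hp).2⟩

theorem Facet.mem_of_mem_hat (S : T.Facet) {p : Set V} (hp : p ∈ S.hat)
    (hb : ¬ T.IsBoundaryArc p) : p ∈ S.1 := by
  obtain ⟨h1, h2⟩ := isReducedNoncrossingSet_iff.1 S.2.prop
  refine S.2.le_of_ge (y := insert p S.1) (isReducedNoncrossingSet_iff.2 ⟨?_, ?_⟩)
    (Set.subset_insert _ _) (Set.mem_insert _ _)
  · rintro q (rfl | hq)
    · exact ⟨hp.1, hb⟩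
    · exact h1 q hq
  · rintro q (rfl | hq) r (rfl | hr)
    · exact .refl _
    · exact hp.2 r hr
    · exact (hp.2 q hq).symm
    · exact h2 q hq r hr

theorem Facet.hat_compat (S : T.Facet) {p q : Set V} (hp : p ∈ S.hat) (hq : q ∈ S.hat) :
    T.Compat p q := by
  by_cases hb : T.IsBoundaryArc q
  · exact hb.compat.symm
  · exact hp.2 q (S.mem_of_mem_hat hq hb)

theorem exists_rightmost {A : Set (Set V)} {d : T.graph.Dart} (hne : A.Nonempty)
    (hA : ∀ p ∈ A, T.Thru p d) (hc : ∀ p ∈ A, ∀ q ∈ A, T.Compat p q) :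
    ∃ p ∈ A, ∀ q ∈ A, T.Le q p d := by
  obtain ⟨p, hp, hmax⟩ := Set.Finite.exists_maximalFor
    -- `Le` compares the backward words in the opposite order, hence the order dual.
    (fun p => (T.code p d, OrderDual.toDual (T.code p d.symm))) A A.toFinite hne
  refine ⟨p, hp, fun q hq => ?_⟩
  rcases hc p hp q hq d (hA p hp) (hA q hq) with h | h
  · have := hmax hq ⟨h.1, h.2⟩
    exact ⟨this.1, this.2⟩
  · exact h

theorem exists_leftmost {A : Set (Set V)} {d : T.graph.Dart} (hne : A.Nonempty)
    (hA : ∀ p ∈ A, T.Thru p d) (hc : ∀ p ∈ A, ∀ q ∈ A, T.Compat p q) :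
    ∃ p ∈ A, ∀ q ∈ A, T.Le p q d := by
  obtain ⟨p, hp, h⟩ := exists_rightmost (d := d.symm) hne (fun p hp => (hA p hp).symm) hc
  exact ⟨p, hp, fun q hq => le_symm.1 (h q hq)⟩

variable {S : T.Facet}

/-- Consecutive arcs through `d` agree before `d` or agree after `d`. -/
theorem Facet.agree_of_adjacent {p q : Set V} {d : T.graph.Dart} (hp : p ∈ S.hat) (hq : q ∈ S.hat)
    (hpd : T.Thru p d) (hqd : T.Thru q d) (hle : T.Le p q d)
    (hadj : ∀ h ∈ S.hat, T.Thru h d → T.Le p h d → T.Le h q d → h = p ∨ h = q) :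
    T.code p d = T.code q d ∨ T.code p d.symm = T.code q d.symm := by
  obtain ⟨r, hr, h1, h2⟩ := exists_splice hpd hqd
  have hpr : T.Le p r d := ⟨h1 ▸ hle.1, h2.le⟩
  have hrq : T.Le r q d := ⟨h1.le, h2 ▸ hle.2⟩
  -- An arc of `S` through `d` is left of `p`, right of `q`, or one of the two by `hadj`; in each
  -- case it is comparable with the splice.
  have hrS : r ∈ S.hat := by
    refine ⟨hr.1, fun h hh => (splice_compat hpd hqd hr h1 h2 (hp.2 h hh).symm (hq.2 h hh).symm
      fun hhd => ?_).symm⟩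
    rcases hp.2 h hh d hpd hhd with h3 | h3
    · rcases hq.2 h hh d hqd hhd with h4 | h4
      · exact .inr (hrq.trans h4)
      · rcases hadj h (S.subset_hat hh) hhd h3 h4 with rfl | rfl
        · exact .inl hpr
        · exact .inr hrq
    · exact .inl (h3.trans hpr)
  rcases hadj r hrS hr hpr hrq with rfl | rfl
  · exact .inl h1
  · exact .inr h2.symm

/-- Every arc through `d` turns left or right after it, so the rightmost left-turning and the
leftmost right-turning arc are consecutive. They part right after `d`, hence agree before it. -/
theorem Facet.agree_of_marks {p m : Set V} {d : T.graph.Dart} (hp : T.MarkL S.hat p d)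
    (hm : T.MarkR S.hat m d) : T.code m d.symm = T.code p d.symm := by
  obtain ⟨⟨p1, hl, p2, p3⟩, p4⟩ := hp
  obtain ⟨⟨m1, -, m2, m3⟩, m4⟩ := hm
  have hlt := p2.code_lt_of_turn m2 hl p3 m3
  have hle : T.Le p m d := (S.hat_compat p1 m1 d p2 m2).resolve_right fun h => hlt.not_ge h.1
  refine ((agree_of_adjacent p1 m1 p2 m2 hle ?_).resolve_left hlt.ne).symm
  intro h hh hhd h1 h2
  obtain ⟨b, hb, -⟩ := hhd.exists_turn hl
  cases b
  · exact .inl ((p4 h hh hhd hb).antisymm h1 hhd p2)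
  · exact .inr (h2.antisymm (m4 h hh hhd hb) hhd m2)

/-- A boundary arc supplies a candidate; this is why marks are taken in `S.hat`. -/
theorem Facet.exists_markL (S : T.Facet) {d : T.graph.Dart} (hl : ¬ T.IsLeaf d.snd) :
    ∃ p, T.MarkL S.hat p d := by
  have hne : {p | p ∈ S.hat ∧ T.Thru p d ∧ T.Thru p (T.turn false d)}.Nonempty := by
    obtain ⟨p, h1, h2, -, h3⟩ := exists_boundary_right d.symm
    obtain ⟨b, hb, hb'⟩ := h1.of_symm.exists_turn hl
    refine ⟨p, S.boundary_mem_hat h2, h1.of_symm, ?_⟩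
    cases b
    · exact hb
    · rw [SimpleGraph.Dart.symm_symm, hb'] at h3
      simp at h3
  obtain ⟨p, ⟨h1, h2, h3⟩, h4⟩ := exists_rightmost (d := d) hne (fun p hp => hp.2.1)
    (fun p hp q hq => S.hat_compat hp.1 hq.1)
  exact ⟨p, ⟨h1, hl, h2, h3⟩, fun q hq h5 h6 => h4 q ⟨hq, h5, h6⟩⟩

theorem Facet.exists_markR (S : T.Facet) {d : T.graph.Dart} (hl : ¬ T.IsLeaf d.snd) :
    ∃ p, T.MarkR S.hat p d := by
  have hne : {p | p ∈ S.hat ∧ T.Thru p d ∧ T.Thru p (T.turn true d)}.Nonempty := by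
    obtain ⟨p, h1, h2, h3, -⟩ := exists_boundary_right d
    obtain ⟨b, hb, hb'⟩ := h1.exists_turn hl
    refine ⟨p, S.boundary_mem_hat h2, h1, ?_⟩
    cases b
    · rw [hb'] at h3
      simp at h3
    · exact hb
  obtain ⟨p, ⟨h1, h2, h3⟩, h4⟩ := exists_leftmost (d := d) hne (fun p hp => hp.2.1)
    (fun p hp q hq => S.hat_compat hp.1 hq.1)
  exact ⟨p, ⟨h1, hl, h2, h3⟩, fun q hq h5 h6 => h4 q ⟨hq, h5, h6⟩⟩

/-- Every arc of a facet is marked on its left. -/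
theorem Facet.exists_mark {p : Set V} (hp : p ∈ S.1) {d : T.graph.Dart} (hd : T.Thru p d) :
    ∃ δ, (T.Ahead d δ ∨ T.Ahead δ d) ∧ T.MarkL S.hat p δ := by
  have hpS := S.subset_hat hp
  have hne : {q | q ∈ S.hat ∧ T.Thru q d ∧ T.Le p q d ∧ q ≠ p}.Nonempty := by
    obtain ⟨e, e1, e2, e3, e4⟩ := exists_boundary_right d
    refine ⟨e, S.boundary_mem_hat e2, e1, ⟨?_, ?_⟩, ?_⟩
    · exact e1.run.le_of_false_not_mem hd.run e3
    · exact e1.symm.run.le_of_true_not_mem hd.symm.run e4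
    · rintro rfl
      exact S.not_boundary hp e2
  obtain ⟨p', ⟨h1, h2, h3, h4⟩, h5⟩ := exists_leftmost (d := d) hne (fun p hp => hp.2.1)
    (fun p hp q hq => S.hat_compat hp.1 hq.1)
  have hadj : ∀ h ∈ S.hat, T.Thru h d → T.Le p h d → T.Le h p' d → h = p ∨ h = p' := by
    intro h hh hhd h6 h7
    by_cases hhp : h = p
    · exact .inl hhp
    · exact .inr (h7.antisymm (h5 h ⟨hh, hhd, h6, hhp⟩) hhd h2)
  -- `p'` is the next arc on the right of `p` at `d`. They agree on one side of `d`, and `p` is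
  -- marked where they part on the other: a competitor there would share the stretch back to `d` and
  -- lie between them.
  rcases Facet.agree_of_adjacent hpS h1 hd h2 h3 hadj with hag | hag
  · have hlt : T.code p' d.symm < T.code p d.symm :=
      lt_of_le_of_ne h3.2 fun h => h4 (h2.ext hd hag.symm h)
    obtain ⟨δ, ha, q1, q2, hl, q3, q4⟩ := h2.symm.exists_parting hd.symm hlt
    have ha' : T.Ahead δ.symm d := by simpa using ha.symm
    have heq : T.code p' δ.symm = T.code p δ.symm := by
      refine (h2.symm.code_eq_iff hd.symm ha q1 q2).2.1 ?_
      simpa using hag.symm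
    have hR : T.MarkR S.hat p δ := by
      refine ⟨⟨hpS, hl, q2, q4⟩, fun h hh r1 r2 => ?_⟩
      rcases S.hat_compat hpS hh δ q2 r1 with h6 | h6
      · exact h6
      have h7 : T.Le p' h δ := (S.hat_compat h1 hh δ q1 r1).resolve_right
        fun h => (q1.code_lt_of_turn r1 hl q3 r2).not_ge h.1
      have h8 : T.code p δ.symm = T.code h δ.symm := le_antisymm h6.2 (heq ▸ h7.2)
      have h9 := (q2.symm.agree r1.symm h8 ha' hd).1
      have l1 := (le_iff_of_ahead h9.symm hd.symm ha r1 q2).2 h6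
      have l2 := (le_iff_of_ahead h2.symm h9.symm ha q1 r1).2 h7
      rcases hadj h hh h9 (le_symm.1 l1) (le_symm.1 l2) with rfl | rfl
      · exact .rfl
      · exact (q1.ne_of_turn hl q3 r2 rfl).elim
    refine ⟨_, .inr ?_, hR.markL⟩
    simpa using (ha.trans (ahead_turn (b := true) hl)).symm
  · have hlt : T.code p d < T.code p' d :=
      lt_of_le_of_ne h3.1 fun h => h4 (h2.ext hd h.symm hag.symm)
    obtain ⟨δ, ha, q1, q2, hl, q3, q4⟩ := hd.exists_parting h2 hlt
    have heq : T.code p δ.symm = T.code p' δ.symm := (hd.code_eq_iff h2 ha q1 q2).2.1 hag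
    refine ⟨δ, .inl ha, ⟨hpS, hl, q1, q3⟩, fun h hh r1 r2 => ?_⟩
    rcases S.hat_compat hpS hh δ q1 r1 with h6 | h6
    swap
    · exact h6
    have h7 : T.Le h p' δ := (S.hat_compat h1 hh δ q2 r1).resolve_left
      fun h => (r1.code_lt_of_turn q2 hl r2 q4).not_ge h.1
    have h8 : T.code p δ.symm = T.code h δ.symm := le_antisymm (heq ▸ h7.2) h6.2
    have h9 := (q1.symm.agree r1.symm h8 ha.symm hd.symm).1.of_symm
    have l1 := (le_iff_of_ahead hd h9 ha q1 r1).2 h6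
    have l2 := (le_iff_of_ahead h9 h2 ha r1 q2).2 h7
    rcases hadj h hh h9 l1 l2 with rfl | rfl
    · exact .rfl
    · exact (r1.ne_of_turn hl r2 q4 rfl).elim

/-- The arc `n`, marked at the corner next to the mark at `δ`, agrees with `p` from there on and
lies on its right. It also turns left after a later `ε`, so `p` cannot be rightmost there. -/
theorem Facet.mark_unique {p : Set V} {δ ε : T.graph.Dart} (hδ : T.MarkL S.hat p δ)
    (hε : T.MarkL S.hat p ε) (ha : T.Ahead δ ε) : δ = ε := by
  by_contra hne
  have hR := hδ.markR
  obtain ⟨⟨d1, d2, d3, d4⟩, -⟩ := hδ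
  obtain ⟨⟨-, e2, e3, e4⟩, e5⟩ := hε
  obtain ⟨⟨-, r2, r3, r4⟩, -⟩ := id hR
  obtain ⟨n, hn⟩ := S.exists_markL (d := (T.turn false δ).symm) r2
  have hag := Facet.agree_of_marks hn hR
  obtain ⟨⟨n1, -, n3, n4⟩, -⟩ := hn
  rw [SimpleGraph.Dart.symm_symm] at hag
  have ha' := d3.ahead_turn_of_ne d2 d4 e3 ha hne
  obtain ⟨f1, -⟩ := d4.agree n3.of_symm hag ha' e3
  obtain ⟨f2, -⟩ := d4.agree n3.of_symm hag (ha'.trans (ahead_turn e2)) e4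
  have hlt := (n3.of_symm.code_lt_iff d4 ha' f1 e3).2.1 (n3.code_lt_of_turn r3 r2 n4 r4)
  exact hlt.not_ge (e5 n n1 f1 f2).2

theorem Facet.markL_hat {p : Set V} {δ : T.graph.Dart} (h : T.MarkL S.1 p δ) :
    T.MarkL S.hat p δ := by
  obtain ⟨⟨h1, hl, h2, h3⟩, h4⟩ := h
  refine ⟨⟨S.subset_hat h1, hl, h2, h3⟩, fun q hq h5 h6 => ?_⟩
  by_cases hb : T.IsBoundaryArc q
  · rcases h5.isBoundaryArc_iff.1 hb with ⟨h7, h8⟩ | ⟨h7, h8⟩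
    · exact ⟨h5.run.le_of_true_not_mem h2.run h7, h5.symm.run.le_of_false_not_mem h2.symm.run h8⟩
    · rw [h5.code_cons hl h6] at h7
      simp at h7
  · exact h4 q (S.mem_of_mem_hat hq hb) h5 h6

end Finite

/-! ### The facet of the arcs that first turn left and then right -/

variable (T) in
/-- The non-boundary arcs that never turn right before turning left. -/
def bottomSet : Set (Set V) :=
  {p | T.IsArc p ∧ ¬ T.IsBoundaryArc p ∧
    ∀ d, T.Thru p d → false ∉ T.code p d ∨ false ∉ T.code p d.symm}

theorem Thru.not_mem_of_ahead {p : Set V} {d e : T.graph.Dart} {b : Bool} (hd : T.Thru p d)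
    (he : T.Thru p e) (ha : T.Ahead d e) (h : b ∉ T.code p d) : b ∉ T.code p e := by
  intro hb
  have := he.symm.mem_code_back hd.symm ha.symm (b := b) (by simpa using hb)
  exact h (by simpa using this)

theorem mem_bottomSet {p : Set V} {d : T.graph.Dart} (hd : T.Thru p d) (h₁ : ¬ T.IsLeaf d.fst)
    (h₂ : ¬ T.IsLeaf d.snd) (h₃ : false ∉ T.code p d) (h₄ : false ∉ T.code p d.symm) :
    p ∈ T.bottomSet := by
  refine ⟨hd.1, ?_, ?_⟩
  · rw [hd.isBoundaryArc_iff]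
    obtain ⟨b, -, hb⟩ := hd.exists_turn h₂
    obtain ⟨c, -, hc⟩ := hd.symm.exists_turn h₁
    rw [hb] at h₃ ⊢
    rw [hc] at h₄ ⊢
    cases b <;> cases c <;> simp_all
  · intro e he
    rcases hd.cases he with ha | ha | ha | ha
    · exact .inl (hd.not_mem_of_ahead he ha h₃)
    · exact .inr (hd.not_mem_of_ahead he.symm ha h₃)
    · exact .inl (hd.symm.not_mem_of_ahead he ha h₄)
    · exact .inr (hd.symm.not_mem_of_ahead he.symm ha h₄)

/-- A word without left turns is the greatest one, and each of these arcs has such a word in at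
least one direction. -/
theorem bottomSet_compat {p q : Set V} (hp : p ∈ T.bottomSet) (hq : q ∈ T.bottomSet) :
    T.Compat p q := by
  intro d hpd hqd
  have key : ∀ {p q}, T.Thru p d → T.Thru q d → false ∉ T.code p d → T.code q d ≤ T.code p d :=
    fun hp hq h => hp.run.le_of_false_not_mem hq.run h
  have key' : ∀ {p q}, T.Thru p d → T.Thru q d → false ∉ T.code p d.symm →
    T.code q d.symm ≤ T.code p d.symm :=
    fun hp hq h => hp.symm.run.le_of_false_not_mem hq.symm.run h
  rcases hp.2.2 d hpd with h1 | h1 <;> rcases hq.2.2 d hqd with h2 | h2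
  · have := (key hqd hpd h2).antisymm (key hpd hqd h1)
    rw [Le, Le, this]
    simpa using le_total _ _
  · exact .inr ⟨key hpd hqd h1, key' hqd hpd h2⟩
  · exact .inl ⟨key hqd hpd h2, key' hpd hqd h1⟩
  · have := (key' hqd hpd h2).antisymm (key' hpd hqd h1)
    rw [Le, Le, this]
    simpa using le_total _ _

section Finite

variable [Finite V]

theorem exists_mem_bottomSet {d : T.graph.Dart} (h₁ : ¬ T.IsLeaf d.fst) (h₂ : ¬ T.IsLeaf d.snd) :
    ∃ p ∈ T.bottomSet, T.Thru p d ∧ false ∉ T.code p d ∧ false ∉ T.code p d.symm := by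
  obtain ⟨n, hn⟩ := exists_run true d
  obtain ⟨m, hm⟩ := exists_run true d.symm
  obtain ⟨p, hp, h3, h4⟩ := exists_thru hn hm
  have h5 : false ∉ T.code p d := by simp [h3, List.mem_replicate]
  have h6 : false ∉ T.code p d.symm := by simp [h4, List.mem_replicate]
  exact ⟨p, mem_bottomSet hp h₁ h₂ h5 h6, hp, h5, h6⟩

theorem bottomSet_maximal : Maximal T.IsReducedNoncrossingSet T.bottomSet := by
  constructor
  · exact isReducedNoncrossingSet_iff.2 ⟨fun p hp => ⟨hp.1, hp.2.1⟩,
      fun p hp q hq => bottomSet_compat hp hq⟩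
  · intro S hS hle p hp
    obtain ⟨h1, h2⟩ := isReducedNoncrossingSet_iff.1 hS
    by_contra hpn
    have : ¬ ∀ d, T.Thru p d → false ∉ T.code p d ∨ false ∉ T.code p d.symm :=
      fun h => hpn ⟨(h1 p hp).1, (h1 p hp).2, h⟩
    push Not at this
    obtain ⟨d, hd, h3, h4⟩ := this
    have hl : ∀ {e : T.graph.Dart}, T.Thru p e → false ∈ T.code p e → ¬ T.IsLeaf e.snd := by
      intro e he h hl
      simp [he.code_nil hl] at h
    -- An arc outside the set has left turns in both directions from some `d`; the arc that turns
    -- only right from `d` in both directions crosses it.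
    obtain ⟨q, hq, hqd, h5, h6⟩ := exists_mem_bottomSet (hl hd.symm h4) (hl hd h3)
    refine (h2 p hp q (hle hq)).not_under hd hqd ⟨?_, ?_⟩
    · exact lt_of_le_of_ne (hqd.run.le_of_false_not_mem hd.run h5) fun h => h5 (h ▸ h3)
    · exact lt_of_le_of_ne (hqd.symm.run.le_of_false_not_mem hd.symm.run h6) fun h => h6 (h ▸ h4)

variable (T) in
/-- The facet of the arcs that first turn left and then right. -/
def bottom : T.Facet := ⟨T.bottomSet, bottomSet_maximal⟩

variable {S : T.Facet}

/-- If all arcs of a facet turn right at the ends of the segment between their marks, then no arc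
turns right before it turns left. -/
theorem Facet.eq_bottom (hS : ∀ p ∈ S.1, ∀ δ τ, T.MarkL S.hat p δ → T.MarkL S.hat p τ →
    ¬ T.Ahead τ.symm δ) : S = T.bottom := by
  have key : ∀ y : T.graph.Dart, ∀ p ∈ S.hat, ¬ T.IsLeaf y.snd → T.Thru p y →
      T.Thru p (T.turn false y) → false ∉ T.code p y.symm := by
    intro y
    induction hn : (T.beyond y).ncard using Nat.strong_induction_on generalizing y with
    | _ n ih =>
    intro p hp hl h1 h2 hf
    obtain ⟨m, hm⟩ := S.exists_markL hl
    obtain ⟨⟨m1, -, m3, m4⟩, m5⟩ := id hm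
    have hpm := m5 p hp h1 h2
    -- Passing to the rightmost arc keeps a left turn behind `y`, because a word without left turns
    -- is the greatest.
    have hmf : false ∈ T.code m y.symm := by
      by_contra hmf
      exact hmf ((hpm.2.antisymm (m3.symm.run.le_of_false_not_mem h1.symm.run hmf)).symm ▸ hf)
    have hmb : ¬ T.IsBoundaryArc m := by
      rw [m3.isBoundaryArc_iff]
      rintro (⟨-, h⟩ | ⟨h, -⟩)
      · exact h hmf
      · rw [m3.code_cons hl m4] at h
        simp at h
    have hmS := S.mem_of_mem_hat m1 hmb
    obtain ⟨δ, ha | ha, hδ⟩ := Facet.exists_mark hmS m3.symm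
    · exact hS m hmS δ y hδ hm ha
    have hne : δ ≠ y.symm := by
      rintro rfl
      exact hS m hmS _ y hδ hm (.refl _)
    obtain ⟨⟨-, d2, d3, d4⟩, -⟩ := id hδ
    have hR := hδ.markR
    have ha' : T.Ahead y (T.turn false δ).symm := by
      simpa using (d3.ahead_turn_of_ne d2 d4 m3.symm ha hne).symm
    set ρ := (T.turn false δ).symm with hρ
    obtain ⟨⟨-, r2, r3, r4⟩, -⟩ := id hR
    have hyρ : y ≠ ρ := by
      intro h
      have := m3.turn_unique hl m4 (h ▸ r4)
      simp at this
    have ha2 := m3.ahead_turn_of_ne hl m4 r3 ha' hyρ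
    -- The other mark of `m` is farther out than `y`. The arc marked beside it inherits the past of
    -- `m`, including the left turn, so the induction applies to the smaller branch beyond `ρ`.
    obtain ⟨m', hm'⟩ := S.exists_markL r2
    have hag := Facet.agree_of_marks hm' hR
    refine ih _ ?_ ρ rfl m' hm'.1.1 r2 hm'.1.2.2.1 hm'.1.2.2.2 ?_
    · rw [← hn]
      exact Set.ncard_lt_ncard (ha2.beyond_subset.trans_ssubset (beyond_turn_ssubset hl))
    · rw [← hag]
      exact m3.mem_code_back r3 ha' hmf
  have hsub : S.1 ⊆ T.bottomSet := by
    intro p hp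
    refine ⟨S.isArc hp, S.not_boundary hp, fun d hd => ?_⟩
    by_contra hcon
    rw [not_or, not_not, not_not] at hcon
    obtain ⟨y, ha, h1, h2, h3⟩ := hd.exists_turn_of_mem hcon.1
    exact key y p (S.subset_hat hp) h2 h1 h3 (hd.mem_code_back h1 ha hcon.2)
  exact Subtype.ext (hsub.antisymm (S.2.le_of_ge bottomSet_maximal.prop hsub))

end Finite

/-! ### Flips -/

/-- The arc `p` of the facet `S` is marked at its two left turns `δ` and `τ`, away from the segment
between them; the arc `q` turns right there instead and then follows the arcs `m` and `n` marked at
the adjacent corners. -/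
structure Facet.FlipData (S : T.Facet) (p q m n : Set V) (δ τ : T.graph.Dart) : Prop where
  ahead : T.Ahead τ.symm δ
  markδ : T.MarkL S.hat p δ
  markτ : T.MarkL S.hat p τ
  markm : T.MarkR S.hat m δ
  markn : T.MarkR S.hat n τ
  backm : T.code m δ.symm = T.code p δ.symm
  backn : T.code n τ.symm = T.code p τ.symm
  thrum : T.Thru m τ
  thrun : T.Thru n δ
  thruδ : T.Thru q δ
  thruτ : T.Thru q τ
  codeδ : T.code q δ = T.code m δ
  codeτ : T.code q τ = T.code n τ
  backδ : T.code q δ.symm = T.code n δ.symm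
  backτ : T.code q τ.symm = T.code m τ.symm

namespace Facet.FlipData

variable {S : T.Facet} {p q m n : Set V} {δ τ : T.graph.Dart}

theorem symm (h : S.FlipData p q m n δ τ) : S.FlipData p q n m τ δ where
  ahead := by simpa using h.ahead.symm
  markδ := h.markτ
  markτ := h.markδ
  markm := h.markn
  markn := h.markm
  backm := h.backn
  backn := h.backm
  thrum := h.thrun
  thrun := h.thrum
  thruδ := h.thruτ
  thruτ := h.thruδ
  codeδ := h.codeτ
  codeτ := h.codeδ
  backδ := h.backτ
  backτ := h.backδ

theorem leaf (h : S.FlipData p q m n δ τ) : ¬ T.IsLeaf δ.snd := h.markδ.1.2.1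

theorem thrup (h : S.FlipData p q m n δ τ) : T.Thru p δ := h.markδ.1.2.2.1

theorem turnp (h : S.FlipData p q m n δ τ) : T.Thru p (T.turn false δ) := h.markδ.1.2.2.2

theorem thrum' (h : S.FlipData p q m n δ τ) : T.Thru m δ := h.markm.1.2.2.1

theorem turnm (h : S.FlipData p q m n δ τ) : T.Thru m (T.turn true δ) := h.markm.1.2.2.2

theorem turnq (h : S.FlipData p q m n δ τ) : T.Thru q (T.turn true δ) := by
  have := h.codeδ
  rw [h.thrum'.code_cons h.leaf h.turnm] at this
  exact (h.thruδ.of_code this).2.1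

theorem p_lt_m (h : S.FlipData p q m n δ τ) : T.code p δ < T.code m δ :=
  h.thrup.code_lt_of_turn h.thrum' h.leaf h.turnp h.turnm

theorem m_ne (h : S.FlipData p q m n δ τ) : m ≠ p := h.thrup.ne_of_turn h.leaf h.turnp h.turnm

theorem back_lt (h : S.FlipData p q m n δ τ) {x y : Set V} (hx : T.Thru x δ) (hy : T.Thru y δ)
    (hx' : T.Thru x τ) (hy' : T.Thru y τ) (hlt : T.code x τ < T.code y τ) :
    T.code x δ.symm < T.code y δ.symm :=
  (hx.symm.code_lt_iff hy.symm h.symm.ahead hx' hy').1.2 hlt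

theorem under (h : S.FlipData p q m n δ τ) : T.Under p q δ := by
  refine ⟨h.codeδ ▸ h.p_lt_m, h.back_lt h.thrup h.thruδ h.symm.thrup h.thruτ ?_⟩
  exact h.codeτ ▸ h.symm.p_lt_m

theorem ne (h : S.FlipData p q m n δ τ) : p ≠ q := by
  rintro rfl
  exact h.under.1.ne rfl

theorem not_compat (h : S.FlipData p q m n δ τ) : ¬ T.Compat p q := fun hc =>
  hc.not_under h.thrup h.thruδ h.under

/-- Ahead of `δ` the two arcs coincide. Backwards, `m` follows `p` and turns left after `τ`, where
`q` turns right. -/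
theorem q_le_m (h : S.FlipData p q m n δ τ) : T.Le q m δ := by
  refine ⟨h.codeδ.le, (h.back_lt h.thrum' h.thruδ h.thrum h.thruτ ?_).le⟩
  have := (h.thrup.symm.agree h.thrum'.symm h.backm.symm h.symm.ahead h.symm.thrup).2
  rw [h.codeτ, ← this]
  exact h.symm.p_lt_m

theorem not_boundary (hf : S.FlipData p q m n δ τ) : ¬ T.IsBoundaryArc q := fun hb =>
  hf.not_compat hb.compat.symm

/-! ### Maximality of the flipped set -/

variable {h : Set V} {x : T.graph.Dart}

theorem not_under_left (hf : S.FlipData p q m n δ τ)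
    (hc : ∀ g ∈ S.hat, g ≠ p → T.Compat h g) (hh : T.Thru h x) (hp : T.Thru p x)
    (hx : T.Ahead x δ) : ¬ T.Under h p x := by
  rintro ⟨h1, h2⟩
  obtain ⟨h3, h4⟩ := hf.thrup.symm.agree hf.thrum'.symm hf.backm.symm hx.symm hp.symm
  have h5 := (hp.code_lt_iff h3.of_symm hx hf.thrup hf.thrum').1.2 hf.p_lt_m
  exact (hc m hf.markm.1.1 hf.m_ne).not_under hh h3.of_symm ⟨h1.trans h5, h4 ▸ h2⟩

theorem le_m (hf : S.FlipData p q m n δ τ)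
    (hc : ∀ g ∈ S.hat, g ≠ p → T.Compat h g) (hh : T.Thru h x) (hp : T.Thru p x)
    (hx : T.Ahead x δ) (hu : T.Under p h x) : T.Thru m x ∧ T.code h x ≤ T.code m x := by
  obtain ⟨h3, h4⟩ := hf.thrup.symm.agree hf.thrum'.symm hf.backm.symm hx.symm hp.symm
  refine ⟨h3.of_symm, ?_⟩
  rcases hc m hf.markm.1.1 hf.m_ne x hh h3.of_symm with h5 | h5
  · exact h5.1
  · exact (hu.2.not_ge (h4 ▸ h5.2)).elim

section Finite

variable [Finite V]

/-- `q` is a splice of `m` and `n` at `δ` and at `τ`, which settles the arcs missing one of these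
edges. For the others the turns at both ends decide: two left turns force `h = p`, one of each gives
comparability, and two right turns would put `m` left of `n` at `δ`, where `n` follows `p`. -/
theorem compat (hf : S.FlipData p q m n δ τ) {h : Set V} (hh : h ∈ S.hat) (hne : h ≠ p) :
    T.Compat h q := by
  have hm := S.hat_compat hh hf.markm.1.1
  have hn := S.hat_compat hh hf.markn.1.1
  by_cases hδ : T.Thru h δ
  swap
  · exact splice_compat hf.thrun hf.thrum' hf.thruδ hf.codeδ hf.backδ hn hm fun h => (hδ h).elim
  by_cases hτ : T.Thru h τ
  swap
  · exact splice_compat hf.thrum hf.symm.thrum' hf.thruτ hf.codeτ hf.backτ hm hn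
      fun h => (hτ h).elim
  refine compat_of_comparable hδ hf.thruδ ?_
  have hle : ∀ {x y}, T.Thru x δ → T.Thru y δ → T.Thru x τ → T.Thru y τ → T.Le x y τ →
      T.Le y x δ := fun h1 h2 h3 h4 h5 =>
    (le_iff_of_ahead h4.symm h3.symm hf.ahead h2 h1).1 h5.symm
  obtain ⟨b, hb, -⟩ := hδ.exists_turn hf.leaf
  obtain ⟨c, hc, -⟩ := hτ.exists_turn hf.symm.leaf
  cases b <;> cases c
  · have h1 := hf.markδ.2 h hh hδ hb
    have h2 := hle hδ hf.thrup hτ hf.symm.thrup (hf.markτ.2 h hh hτ hc)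
    exact (hne (h1.antisymm h2 hδ hf.thrup)).elim
  · have h1 := hle hf.thrun hδ hf.symm.thrum' hτ (hf.markn.2 h hh hτ hc)
    refine .inl ⟨(hδ.code_lt_of_turn hf.thruδ hf.leaf hb hf.turnq).le, ?_⟩
    rw [hf.backδ]
    exact h1.2
  · have h1 := hf.markm.2 h hh hδ hb
    refine .inr ⟨hf.codeδ ▸ h1.1, ?_⟩
    exact (hf.back_lt hδ hf.thruδ hτ hf.thruτ
      (hτ.code_lt_of_turn hf.thruτ hf.symm.leaf hc hf.symm.turnq)).le
  · have h1 := hle hf.thrun hδ hf.symm.thrum' hτ (hf.markn.2 h hh hτ hc)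
    have h2 := hf.markm.2 h hh hδ hb
    have h3 := (hf.symm.thrup.symm.agree hf.symm.thrum'.symm hf.backn.symm hf.ahead hf.thrup).2
    exact (hf.p_lt_m.not_ge (h3 ▸ h2.1.trans h1.1)).elim

/-- Beyond its mark, `p` has a neighbour `k` with the same future and a smaller backward word. If
`p` were under `h`, so would be `k`. -/
theorem not_under_right (hf : S.FlipData p q m n δ τ)
    (hc : ∀ g ∈ S.hat, g ≠ p → T.Compat h g) (hh : T.Thru h x) (hp : T.Thru p x)
    (hx : T.Ahead (T.turn false δ) x) : ¬ T.Under p h x := by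
  rintro ⟨h1, h2⟩
  have hR := hf.markδ.markR
  obtain ⟨⟨-, r2, r3, r4⟩, -⟩ := id hR
  obtain ⟨k, hk⟩ := S.exists_markL r2
  have hag := Facet.agree_of_marks hk hR
  obtain ⟨⟨k1, -, k3, k4⟩, -⟩ := id hk
  rw [SimpleGraph.Dart.symm_symm] at hag
  obtain ⟨h3, h4⟩ := hf.turnp.agree k3.of_symm hag hx hp
  have h5 := (k3.of_symm.code_lt_iff hf.turnp hx h3 hp).2.1 (k3.code_lt_of_turn r3 r2 k4 r4)
  exact (hc k k1 (k3.ne_of_turn r2 k4 r4).symm).symm.not_under h3 hh ⟨h4 ▸ h1, h5.trans h2⟩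

/-- The word of `h` is squeezed between those of `p` and `m`, which agree up to `δ`. A left turn
after `δ` is excluded by `not_under_right`. -/
theorem under_thru (hf : S.FlipData p q m n δ τ)
    (hc : ∀ g ∈ S.hat, g ≠ p → T.Compat h g) (hh : T.Thru h x) (hp : T.Thru p x)
    (hx : T.Ahead x δ) (hu : T.Under p h x) :
    T.Thru h δ ∧ T.Thru h (T.turn true δ) ∧ T.Under p h δ := by
  obtain ⟨hm, hle⟩ := hf.le_m hc hh hp hx hu
  have h1 : T.Thru h δ ∧ T.code p δ ≤ T.code h δ ∧ T.code h δ ≤ T.code m δ := by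
    refine ahead_induction (P := fun y => T.Thru h y ∧ T.code p y ≤ T.code h y ∧
      T.code h y ≤ T.code m y) hp hm hx hf.thrup hf.thrum' ⟨hh, hu.1.le, hle⟩ ?_
    rintro y b y1 y2 hl y3 y4 ⟨y5, y6, y7⟩
    rw [y1.code_cons hl y3] at y6
    rw [y2.code_cons hl y4] at y7
    obtain ⟨c, y8, y9⟩ := y5.exists_turn hl
    rw [y9, cons_le_cons] at y6 y7
    have : b = c := by
      rcases y6 with y6 | ⟨rfl, -⟩
      · rcases y7 with y7 | ⟨rfl, -⟩
        · exact (lt_asymm y6 y7).elim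
        · rfl
      · rfl
    subst this
    exact ⟨y8, by simpa using y6, by simpa using y7⟩
  obtain ⟨h1, -, -⟩ := h1
  have hiff := hp.code_lt_iff hh hx hf.thrup h1
  have h2 : T.Under p h δ := ⟨hiff.1.1 hu.1, hiff.2.1 hu.2⟩
  obtain ⟨b, hb, -⟩ := h1.exists_turn hf.leaf
  cases b
  · have hiff := hf.thrup.code_lt_iff h1 (ahead_turn hf.leaf) hf.turnp hb
    exact (hf.not_under_right hc hb hf.turnp (.refl _) ⟨hiff.1.1 h2.1, hiff.2.1 h2.2⟩).elim
  · exact ⟨h1, hb, h2⟩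

theorem code_eq (hf : S.FlipData p q m n δ τ) (hpS : p ∈ S.1)
    (hc : ∀ g ∈ S.hat, g ≠ p → T.Compat h g) (hh : T.Thru h δ) (hht : T.Thru h (T.turn true δ))
    (hu : T.Under p h δ) : T.code h δ = T.code m δ := by
  refine (hf.le_m hc hh hf.thrup (.refl _) hu).2.antisymm ?_
  obtain ⟨r, hr, r1, r2⟩ := exists_splice hf.thrup hh
  have hrS : r ∈ S.hat := by
    refine ⟨hr.1, fun g hg => Compat.symm ?_⟩
    by_cases hgp : g = p
    · subst hgp
      refine compat_of_comparable hf.thrup hr (.inl ⟨r1 ▸ hu.1.le, r2.le⟩)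
    · have hgh := (hc g (S.subset_hat hg) hgp).symm
      have hgp' := S.compat hg hpS
      refine splice_compat hf.thrup hh hr r1 r2 hgp' hgh fun hgd => ?_
      rcases hgp' δ hgd hf.thrup with h1 | h1
      · exact .inl ⟨r1 ▸ h1.1.trans hu.1.le, r2 ▸ h1.2⟩
      · rcases hgh δ hgd hh with h2 | h2
        · exact (hu.2.not_ge (h2.2.trans h1.2)).elim
        · exact .inr ⟨r1 ▸ h2.1, r2 ▸ h1.2⟩
  have hrt : T.Thru r (T.turn true δ) := by
    rw [hh.code_cons hf.leaf hht] at r1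
    exact (hr.of_code r1).2.1
  exact r1 ▸ (hf.markm.2 r hrS hr hrt).1

theorem eq_of_under (hf : S.FlipData p q m n δ τ) (hpS : p ∈ S.1)
    (hc : ∀ g ∈ S.hat, g ≠ p → T.Compat h g) (hh : T.Thru h x) (hp : T.Thru p x)
    (hx : T.Ahead x δ ∨ T.Ahead δ x) (hu : T.Under p h x) : h = q := by
  have hxδ : T.Ahead x δ := by
    rcases hx with hx | hx
    · exact hx
    · by_cases hne : δ = x
      · exact hne ▸ .refl _
      · exact (hf.not_under_right hc hh hp (hf.thrup.ahead_turn_of_ne hf.leaf hf.turnp hp hx hne)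
          hu).elim
  have hxτ : T.Ahead x.symm τ := by
    rcases hf.thrup.symm.ahead_total hp.symm hf.symm.thrup hxδ.symm hf.symm.ahead with hx | hx
    · exact hx
    · by_cases hne : τ = x.symm
      · exact hne ▸ .refl _
      · exact (hf.symm.not_under_right hc hh.symm hp.symm
          (hf.symm.thrup.ahead_turn_of_ne hf.symm.leaf hf.symm.turnp hp.symm hx hne)
          hu.symm).elim
  obtain ⟨h1, h2, h3⟩ := hf.under_thru hc hh hp hxδ hu
  obtain ⟨h4, h5, h6⟩ := hf.symm.under_thru hc hh.symm hp.symm hxτ hu.symm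
  refine h1.ext hf.thruδ (hf.codeδ ▸ hf.code_eq hpS hc h1 h2 h3) ?_
  refine (h1.symm.code_eq_iff hf.thruδ.symm hf.symm.ahead h4 hf.thruτ).1.2 ?_
  exact hf.codeτ ▸ hf.symm.code_eq hpS hc h4 h5 h6

theorem not_mem (hf : S.FlipData p q m n δ τ) (hpS : p ∈ S.1) : q ∉ S.1 := fun hq =>
  hf.not_compat (S.compat hpS hq)

theorem maximal (hf : S.FlipData p q m n δ τ) (hpS : p ∈ S.1) :
    Maximal T.IsReducedNoncrossingSet (S.1 \ {p} ∪ {q}) := by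
  constructor
  · refine isReducedNoncrossingSet_iff.2 ⟨?_, ?_⟩
    · rintro g (⟨hg, -⟩ | rfl)
      · exact ⟨S.isArc hg, S.not_boundary hg⟩
      · exact ⟨hf.thruδ.1, hf.not_boundary⟩
    · rintro g (⟨hg, hgp⟩ | rfl) k (⟨hk, hkp⟩ | rfl)
      · exact S.compat hg hk
      · exact hf.compat (S.subset_hat hg) hgp
      · exact (hf.compat (S.subset_hat hk) hkp).symm
      · exact .refl _
  · intro R hR hle h hh
    obtain ⟨h1, h2⟩ := isReducedNoncrossingSet_iff.1 hR
    have hc : ∀ g ∈ S.hat, g ≠ p → T.Compat h g := by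
      intro g hg hgp
      by_cases hb : T.IsBoundaryArc g
      · exact hb.compat.symm
      · exact h2 h hh g (hle (.inl ⟨S.mem_of_mem_hat hg hb, hgp⟩))
    have hhq : T.Compat h q := h2 h hh q (hle (.inr rfl))
    -- If `h` is compatible with `p`, it belongs to `S` already; if it crosses `p`, it must be `q`.
    by_cases hhp : T.Compat h p
    · refine .inl ⟨S.mem_of_mem_hat ⟨(h1 h hh).1, fun g hg => ?_⟩ (h1 h hh).2, ?_⟩
      · by_cases hgp : g = p
        · exact hgp ▸ hhp
        · exact hc g (S.subset_hat hg) hgp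
      · rintro rfl
        exact hf.not_compat hhq
    · right
      obtain ⟨x, hx, hpx, hu⟩ := exists_under_of_not_compat hhp
      obtain ⟨x, hx, hpx, hu, ha⟩ : ∃ x, T.Thru h x ∧ T.Thru p x ∧
          (T.Under h p x ∨ T.Under p h x) ∧ (T.Ahead x δ ∨ T.Ahead δ x) := by
        have hu' : T.Under h p x.symm ∨ T.Under p h x.symm := hu.imp (·.symm) (·.symm)
        rcases hpx.cases hf.thrup with ha | ha | ha | ha
        · exact ⟨x, hx, hpx, hu, .inl ha⟩
        · exact ⟨x.symm, hx.symm, hpx.symm, hu', .inr (by simpa using ha.symm)⟩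
        · exact ⟨x.symm, hx.symm, hpx.symm, hu', .inl ha⟩
        · exact ⟨x, hx, hpx, hu, .inr (by simpa using ha.symm)⟩
      rcases hu with hu | hu
      · exfalso
        rcases ha with ha | ha
        · exact hf.not_under_left hc hx hpx ha hu
        · exact hf.symm.not_under_left hc hx.symm hpx.symm (by simpa using (hf.ahead.trans ha).symm)
            hu.symm
      · exact hf.eq_of_under hpS hc hx hpx ha hu

theorem markR_flip (hf : S.FlipData p q m n δ τ) :
    T.MarkR (S.1 \ {p} ∪ {q}) q δ := by
  refine ⟨⟨.inr rfl, hf.leaf, hf.thruδ, hf.turnq⟩, ?_⟩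
  rintro g (⟨hg, -⟩ | rfl) h1 h2
  · exact hf.q_le_m.trans (hf.markm.2 g (S.subset_hat hg) h1 h2)
  · exact .rfl

end Finite

end Facet.FlipData

section Finite

variable [Finite V] {S : T.Facet}

theorem Facet.exists_flipData {p : Set V} {δ τ : T.graph.Dart} (hδ : T.MarkL S.hat p δ)
    (hτ : T.MarkL S.hat p τ) (ha : T.Ahead τ.symm δ) :
    ∃ q m n, S.FlipData p q m n δ τ := by
  obtain ⟨m, hm⟩ := S.exists_markR hδ.1.2.1
  obtain ⟨n, hn⟩ := S.exists_markR hτ.1.2.1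
  have hpm := Facet.agree_of_marks hδ hm
  have hpn := Facet.agree_of_marks hτ hn
  have hpδ := hδ.1.2.2.1
  have hpτ := hτ.1.2.2.1
  have hmδ := hm.1.2.2.1
  have hnτ := hn.1.2.2.1
  have ha' : T.Ahead δ.symm τ := by simpa using ha.symm
  have hmτ := (hpδ.symm.agree hmδ.symm hpm.symm ha' hpτ).1
  have hnδ := (hpτ.symm.agree hnτ.symm hpn.symm ha hpδ).1
  -- As `m` and `n` both follow `p` between the marks, the splice at `δ` is also the splice at `τ`
  -- in the other direction.
  obtain ⟨q, hq, q1, q2⟩ := exists_splice hnδ hmδ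
  obtain ⟨q3, q4⟩ := hnδ.symm.agree hq.symm q2.symm ha' hnτ
  exact ⟨q, m, n, ha, hδ, hτ, hm, hn, hpm, hpn, hmτ, hnδ, hq, q3, q1, q4.symm, q2,
    (q3.symm.code_eq_iff hmτ.symm ha hq hmδ).1.2 q1⟩

/-- A facet that contains an arc turning left at the ends of the segment between its marks is
obtained from another facet by a flip. -/
theorem Facet.exists_flipEdge {p : Set V} (hp : p ∈ S.1) {δ τ : T.graph.Dart}
    (hδ : T.MarkL S.hat p δ) (hτ : T.MarkL S.hat p τ) (ha : T.Ahead τ.symm δ) :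
    ∃ S' : T.Facet, T.FlipEdge S' S := by
  obtain ⟨q, m, n, hf⟩ := Facet.exists_flipData hδ hτ ha
  have hsymm : T.MarkR (S.1 \ {p} ∪ {q}) q τ := hf.symm.markR_flip
  have hq := hf.not_mem hp
  have harc : ∀ g ∈ S.1 \ {p} ∪ {q}, T.IsArc g := by
    rintro g (⟨hg, -⟩ | rfl)
    · exact S.isArc hg
    · exact hf.thruδ.1
  have hleft : ∀ {ε : T.graph.Dart}, ¬ T.IsLeaf ε.snd →
      T.leftFace (T.turn true ε).symm = T.leftFace ε.symm := fun h => rightFace_turn h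
  -- The corners on the right and on the left of `ε` at its final vertex are separated by the edge
  -- of `ε` only.
  have hcw : ∀ {ε : T.graph.Dart}, ¬ T.IsLeaf ε.snd →
      T.ImmediatelyClockwise ε.snd (T.leftFace (T.turn true ε).symm) (T.leftFace ε) :=
    fun h => ⟨h, _, rfl, hleft h, (leftFace_turn h).symm⟩
  refine ⟨⟨_, hf.maximal hp⟩, q, p, .inr rfl, ?_, ?_, δ.snd, τ.snd,
    T.leftFace (T.turn true δ).symm, T.leftFace (T.turn true τ).symm, T.leftFace δ, T.leftFace τ,
    ?_, ?_, ?_, ?_, ?_, hcw hf.leaf, hcw hf.symm.leaf⟩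
  · rintro (⟨-, h⟩ | h)
    · exact h rfl
    · exact hf.ne h
  · ext g
    simp only [Set.mem_union, Set.mem_sdiff, Set.mem_singleton_iff]
    constructor
    · intro hg
      by_cases hgp : g = p
      · exact .inr hgp
      · exact .inl ⟨.inl ⟨hg, hgp⟩, by rintro rfl; exact hq hg⟩
    · rintro (⟨⟨h, -⟩ | h, h'⟩ | rfl)
      · exact h
      · exact (h' h).elim
      · exact hp
  · intro h
    have := ha.snd_mem
    rw [h] at this
    exact fst_not_mem_beyond τ.symm this
  · exact (marked_iff harc).2 ⟨_, by simp, rfl, hf.markR_flip.markL⟩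
  · exact (marked_iff harc).2 ⟨_, by simp, rfl, hsymm.markL⟩
  · exact (marked_iff fun g hg => S.isArc hg).2 ⟨δ, rfl, rfl, ⟨hp, hδ.1.2⟩,
      fun g hg => hδ.2 g (S.subset_hat hg)⟩
  · exact (marked_iff fun g hg => S.isArc hg).2 ⟨τ, rfl, rfl, ⟨hp, hτ.1.2⟩,
      fun g hg => hτ.2 g (S.subset_hat hg)⟩

theorem Facet.exists_flipEdge_of_ne_bottom (h : S ≠ T.bottom) : ∃ S' : T.Facet, T.FlipEdge S' S := by
  by_contra hcon
  refine h (Facet.eq_bottom fun p hp δ τ hδ hτ ha => hcon ?_)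
  exact Facet.exists_flipEdge hp hδ hτ ha

/-! ### Flips go in one direction -/

/-- The two marks of a flipped arc, and the turns of the new arc there. -/
theorem FlipEdge.exists_marks {S₁ S₂ : T.Facet} (h : T.FlipEdge S₁ S₂) :
    ∃ p q μ ν, p ∈ S₁.1 ∧ q ∉ S₁.1 ∧ S₂.1 = S₁.1 \ {p} ∪ {q} ∧ T.MarkR S₁.hat p μ ∧
      T.MarkR S₁.hat p ν ∧ T.Ahead μ.symm ν ∧ T.Thru q μ ∧ T.Thru q (T.turn false μ) ∧
      T.Thru q ν ∧ T.Thru q (T.turn false ν) := by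
  obtain ⟨p, q, hp, hq, hS, u, v, F, G, F', G', huv, m1, m2, m3, m4, c1, c2⟩ := h
  have hmark : ∀ {u F F'}, T.Marked S₁.1 p u F → T.Marked S₂.1 q u F' →
      T.ImmediatelyClockwise u F F' → ∃ δ : T.graph.Dart, δ.snd = u ∧ T.MarkL S₁.hat p δ ∧
        T.Thru q (T.turn false δ).symm ∧ T.Thru q (T.turn false (T.turn false δ).symm) := by
    rintro u F F' m m' ⟨hl, d, rfl, hF, hF'⟩
    obtain ⟨δ, hδ, rfl, hm⟩ := (marked_iff fun g hg => S₁.isArc hg).1 m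
    obtain ⟨ε, hε, rfl, ⟨-, hl', hm1, hm2⟩, -⟩ := (marked_iff fun g hg => S₂.isArc hg).1 m'
    have h1 : T.turn false δ = d := by
      refine eq_of_leftFace_eq (by simpa using hδ) ?_
      rw [leftFace_turn (hm.1.2.1), hF]
    have h2 : T.turn false ε = T.cw d := by
      refine eq_of_leftFace_eq (by rw [turn_fst, T.cw_fst, hε]) ?_
      rw [leftFace_turn hl', hF']
    have h3 : ε = d.symm := by
      have := T.cw.injective h2
      simpa using congrArg SimpleGraph.Dart.symm this
    refine ⟨δ, hδ, Facet.markL_hat hm, ?_, ?_⟩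
    · rw [h1, ← h3]; exact hm1
    · rw [h1, ← h3]; exact hm2
  obtain ⟨δ, rfl, hδ, qδ, qδ'⟩ := hmark m1 m3 c1
  obtain ⟨ε, rfl, hε, qε, qε'⟩ := hmark m2 m4 c2
  have hne : δ ≠ ε := fun h => huv (h ▸ rfl)
  obtain ⟨⟨-, hl, pδ, pδ'⟩, -⟩ := id hδ
  obtain ⟨⟨-, hl', pε, pε'⟩, -⟩ := id hε
  -- `q` visits both marked vertices without using the edge of `δ`, so these lie on the same side of
  -- it.
  have hnot : ¬ T.Ahead δ.symm ε := by
    intro ha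
    have hq : ¬ T.EdgeOf δ.symm q := by
      intro he
      have ht : T.turn true (T.turn false δ).symm = δ.symm := turn_symm_turn false δ
      have hq2 : T.Thru q (T.turn true (T.turn false δ).symm) := by rw [ht]; exact ⟨qδ.1, he⟩
      have := qδ.turn_unique (by simpa using hl) qδ' hq2
      simp at this
    have hmem : ∀ {x : T.graph.Dart}, T.Thru q (T.turn false x).symm → x.snd ∈ q := by
      intro x h
      simpa using h.2.2
    have := qδ.1.mem_beyond_iff hq (hmem qε) (hmem qδ) ha.snd_mem
    exact fst_not_mem_beyond δ.symm this
  refine ⟨p, q, _, _, hp, hq, hS, hδ.markR, hε.markR, ?_, qδ, qδ', qε, qε'⟩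
  have ha : T.Ahead δ ε.symm := by
    rcases pδ.cases pε with ha | ha | ha | ha
    · exact (hne (Facet.mark_unique hδ hε ha)).elim
    · exact ha
    · exact (hnot ha).elim
    · exact (hne (Facet.mark_unique hε hδ (by simpa using ha.symm)).symm).elim
  have h1 : δ ≠ ε.symm := by
    rintro rfl
    exact hnot (by simpa using Ahead.refl ε)
  have h2 := (pδ.ahead_turn_of_ne hl pδ' pε.symm ha h1).symm
  rw [SimpleGraph.Dart.symm_symm] at h2
  have h3 : ε ≠ (T.turn false δ).symm := by
    intro h
    have := pε.turn_unique hl' pε' (h ▸ hδ.markR.1.2.2.2)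
    simp at this
  have h4 := (pε.ahead_turn_of_ne hl' pε' pδ'.symm h2 h3).symm
  exact h4

variable (T) in
/-- No arc of `S` turns left of an arc of `R` in both directions. -/
def NeverUnder (S R : Set (Set V)) : Prop :=
  ∀ p ∈ S, ∀ q ∈ R, ∀ d, T.Thru p d → T.Thru q d → ¬ T.Under p q d

/-- Only the removed arc `p` matters. If it were under an arc of `R`, then so would be the arc
marked beside one of its marks, which has the same past, lies left of `p` ahead, and survives the
flip or is a boundary arc. -/
theorem FlipEdge.neverUnder {S₁ S₂ : T.Facet} (h : T.FlipEdge S₁ S₂) {R : T.Facet}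
    (hR : T.NeverUnder S₂.1 R.1) : T.NeverUnder S₁.1 R.1 := by
  obtain ⟨p, q, μ, ν, hp, -, hS, hμ, hν, ha, -⟩ := h.exists_marks
  have hhat : ∀ k ∈ S₁.hat, k ≠ p → ∀ g ∈ R.1, ∀ d, T.Thru k d → T.Thru g d → ¬ T.Under k g d := by
    intro k hk hkp g hg d h1 h2
    by_cases hb : T.IsBoundaryArc k
    · exact hb.compat.not_under h1 h2
    · exact hR k (hS ▸ .inl ⟨S₁.mem_of_mem_hat hk hb, hkp⟩) g hg d h1 h2
  have key : ∀ {ν}, T.MarkR S₁.hat p ν → ∀ g ∈ R.1, ∀ d, T.Thru p d → T.Thru g d → T.Ahead d ν →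
      ¬ T.Under p g d := by
    intro ν hν g hg d h1 h2 hd hu
    obtain ⟨m, hm⟩ := S₁.exists_markL hν.1.2.1
    have hag := Facet.agree_of_marks hm hν
    obtain ⟨⟨-, hl, n1, n2⟩, -⟩ := hν
    obtain ⟨⟨m1, -, m2, m3⟩, -⟩ := hm
    obtain ⟨h3, h4⟩ := n1.symm.agree m2.symm hag hd.symm h1.symm
    have h5 := (h3.of_symm.code_lt_iff h1 hd m2 n1).1.2 (m2.code_lt_of_turn n1 hl m3 n2)
    exact hhat m m1 (m2.ne_of_turn hl m3 n2).symm g hg d h3.of_symm h2 ⟨h5.trans hu.1, h4 ▸ hu.2⟩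
  intro k hk g hg d h1 h2
  by_cases hkp : k = p
  · subst hkp
    intro hu
    have hν1 := hν.1.2.2.1
    rcases h1.cases hν1 with hd | hd | hd | hd
    · exact key hν g hg d h1 h2 hd hu
    · exact key hμ g hg d h1 h2 (hd.trans (by simpa using ha.symm)) hu
    · exact key hν g hg d.symm h1.symm h2.symm hd hu.symm
    · exact key hμ g hg d.symm h1.symm h2.symm (hd.trans (by simpa using ha.symm)) hu.symm
  · exact hhat k (S₁.subset_hat hk) hkp g hg d h1 h2

theorem Facet.le_antisymm {S₁ S₂ : T.Facet} (h₁ : S₁ ≤ S₂) (h₂ : S₂ ≤ S₁) : S₁ = S₂ := by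
  rcases Relation.ReflTransGen.cases_head h₁ with h | ⟨S', hf, h'⟩
  · exact h
  exfalso
  have hle : Relation.ReflTransGen T.FlipEdge S' S₁ := Relation.ReflTransGen.trans h' h₂
  have hN : T.NeverUnder S'.1 S₁.1 := by
    clear hf h' h₁
    induction hle using Relation.ReflTransGen.head_induction_on with
    | refl => exact fun p hp q hq d h1 h2 => (S₁.compat hp hq).not_under h1 h2
    | head h _ ih => exact h.neverUnder ih
  obtain ⟨p, q, μ, ν, hp, -, hS, hμ, hν, ha, q1, q2, q3, q4⟩ := hf.exists_marks
  obtain ⟨⟨-, l1, p1, p2⟩, -⟩ := hμ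
  obtain ⟨⟨-, l2, p3, p4⟩, -⟩ := hν
  refine hN q (hS ▸ .inr rfl) p hp μ q1 p1 ⟨q1.code_lt_of_turn p1 l1 q2 p2, ?_⟩
  exact (q1.symm.code_lt_iff p1.symm ha q3 p3).1.2 (q3.code_lt_of_turn p3 l2 q4 p4)

theorem bottom_le (S : T.Facet) : T.bottom ≤ S := by
  have : Finite T.Facet := Subtype.finite
  obtain ⟨M, hM, hmin⟩ := Set.Finite.exists_minimalFor id {R : T.Facet | R ≤ S} (Set.toFinite _)
    ⟨S, (le_refl S : S ≤ S)⟩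
  by_cases h : M = T.bottom
  · exact h ▸ hM
  · obtain ⟨R, hR⟩ := Facet.exists_flipEdge_of_ne_bottom h
    have hRM : R ≤ M := Relation.ReflTransGen.single hR
    have := Facet.le_antisymm hRM (hmin (j := R) (le_trans hRM hM) hRM)
    obtain ⟨p, q, -, hq, hS, -⟩ := hR
    rw [this] at hq hS
    exact (hq (hS ▸ .inr rfl)).elim

end Finite

/-! ### Diagonals of arcs -/

theorem Run.leaf_unique {d : T.graph.Dart} {l : List Bool} (h : T.Run d l) {u v : V}
    (hu : T.IsLeaf u) (hv : T.IsLeaf v) (hul : u ∈ T.trail l d) (hvl : v ∈ T.trail l d) :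
    u = v := by
  induction h with
  | leaf h =>
    simp only [trail, Set.mem_singleton_iff] at hul hvl
    rw [hul, hvl]
  | turn h _ ih =>
    simp only [trail, Set.mem_insert_iff] at hul hvl
    exact ih (hul.resolve_left fun h' => h (h' ▸ hu)) (hvl.resolve_left fun h' => h (h' ▸ hv))

theorem Thru.leaf_unique {p : Set V} {d : T.graph.Dart} (h : T.Thru p d) {u v : V}
    (hu : T.IsLeaf u) (hv : T.IsLeaf v) (hup : u ∈ p) (hvp : v ∈ p) (hud : u ∈ T.beyond d)
    (hvd : v ∈ T.beyond d) : u = v :=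
  h.run.leaf_unique hu hv (h.strand.inter_beyond ▸ ⟨hup, hud⟩) (h.strand.inter_beyond ▸ ⟨hvp, hvd⟩)

theorem IsArc.leaf_cases {p : Set V} (hp : T.IsArc p) {a b u : V} (hab : a ≠ b) (ha : T.IsLeaf a)
    (hb : T.IsLeaf b) (hu : T.IsLeaf u) (hap : a ∈ p) (hbp : b ∈ p) (hup : u ∈ p) :
    u = a ∨ u = b := by
  obtain ⟨d, hd⟩ := hp.exists_edge
  have h : T.Thru p d := ⟨hp, hd⟩
  by_cases h1 : a ∈ T.beyond d <;> by_cases h2 : b ∈ T.beyond d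
  · exact (hab (h.leaf_unique ha hb hap hbp h1 h2)).elim
  · by_cases h3 : u ∈ T.beyond d
    · exact .inl (h.leaf_unique hu ha hup hap h3 h1)
    · exact .inr (h.symm.leaf_unique hu hb hup hbp (mem_beyond_symm.2 h3) (mem_beyond_symm.2 h2))
  · by_cases h3 : u ∈ T.beyond d
    · exact .inr (h.leaf_unique hu hb hup hbp h3 h2)
    · exact .inl (h.symm.leaf_unique hu ha hup hap (mem_beyond_symm.2 h3) (mem_beyond_symm.2 h1))
  · exact (hab (h.symm.leaf_unique ha hb hap hbp (mem_beyond_symm.2 h1)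
      (mem_beyond_symm.2 h2))).elim

theorem IsAcyclicPath.symm {p : Set V} {a b : V} (h : T.IsAcyclicPath p a b) :
    T.IsAcyclicPath p b a := by
  obtain ⟨w, hw, rfl⟩ := h
  exact ⟨w.reverse, hw.reverse, by simp⟩

theorem IsAcyclicPath.unique {p q : Set V} {a b : V} (hp : T.IsAcyclicPath p a b)
    (hq : T.IsAcyclicPath q a b) : p = q := by
  obtain ⟨w, hw, rfl⟩ := hp
  obtain ⟨w', hw', rfl⟩ := hq
  rw [(T.isTree.existsUnique_path a b).unique hw hw']

theorem IsAcyclicPath.mem {p : Set V} {a b : V} (h : T.IsAcyclicPath p a b) : a ∈ p ∧ b ∈ p := by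
  obtain ⟨w, -, rfl⟩ := h
  exact ⟨w.start_mem_support, w.end_mem_support⟩

theorem IsArc.isAcyclicPath {p : Set V} (hp : T.IsArc p) {a b : V} (hab : a ≠ b) (ha : T.IsLeaf a)
    (hb : T.IsLeaf b) (hap : a ∈ p) (hbp : b ∈ p) : T.IsAcyclicPath p a b := by
  obtain ⟨x, y, hxy, hx, hy, h⟩ := hp.1
  rcases hp.leaf_cases hxy hx hy ha h.mem.1 h.mem.2 hap with rfl | rfl <;>
  rcases hp.leaf_cases hxy hx hy hb h.mem.1 h.mem.2 hbp with rfl | rfl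
  · exact (hab rfl).elim
  · exact h
  · exact h.symm
  · exact (hab rfl).elim

theorem IsLeaf.exists_dart {a : V} (h : T.IsLeaf a) : ∃ d : T.graph.Dart, d.fst = a := by
  obtain ⟨b, hb⟩ := Set.ncard_eq_one.1 h
  have : T.graph.Adj a b := by
    have : b ∈ T.graph.neighborSet a := hb ▸ rfl
    exact this
  exact ⟨⟨(a, b), this⟩, rfl⟩

theorem IsCcwMostLeaf.leaf_unique {a b : V} {F : T.Face} (ha : T.IsCcwMostLeaf a F)
    (hb : T.IsCcwMostLeaf b F) : a = b := by
  obtain ⟨ha, d, rfl, rfl⟩ := ha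
  obtain ⟨hb, e, rfl, h⟩ := hb
  rw [eq_of_leftFace_eq_of_leaf ha hb h]

theorem IsCcwMostLeaf.face_unique {a : V} {F G : T.Face} (hF : T.IsCcwMostLeaf a F)
    (hG : T.IsCcwMostLeaf a G) : F = G := by
  obtain ⟨ha, d, rfl, rfl⟩ := hF
  obtain ⟨-, e, h, rfl⟩ := hG
  rw [leaf_dart_unique ha h.symm]

/-- A face determines its counterclockwise most leaf, and two leaves determine the path between
them. -/
theorem IsDiagonalOf.arc_unique {p q : Set V} {D : Sym2 T.Face} (hp : T.IsArc p) (hq : T.IsArc q)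
    (hpD : T.IsDiagonalOf p D) (hqD : T.IsDiagonalOf q D) : p = q := by
  obtain ⟨a, b, F, G, hab, ha, hb, hF, hG, rfl⟩ := hpD
  obtain ⟨c, d, F', G', hcd, hc, hd, hF', hG', h⟩ := hqD
  have h1 := hp.isAcyclicPath hab hF.1 hG.1 ha hb
  have h2 := hq.isAcyclicPath hcd hF'.1 hG'.1 hc hd
  rcases Sym2.eq_iff.1 h with ⟨rfl, rfl⟩ | ⟨rfl, rfl⟩
  · obtain rfl := hF.leaf_unique hF'
    obtain rfl := hG.leaf_unique hG'
    exact h1.unique h2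
  · obtain rfl := hF.leaf_unique hG'
    obtain rfl := hG.leaf_unique hF'
    exact h1.unique h2.symm

theorem IsDiagonalOf.unique {p : Set V} {D E : Sym2 T.Face} (hp : T.IsArc p)
    (hD : T.IsDiagonalOf p D) (hE : T.IsDiagonalOf p E) : D = E := by
  obtain ⟨a, b, F, G, hab, ha, hb, hF, hG, rfl⟩ := hD
  obtain ⟨c, d, F', G', hcd, hc, hd, hF', hG', rfl⟩ := hE
  rcases hp.leaf_cases hab hF.1 hG.1 hF'.1 ha hb hc with rfl | rfl <;>
  rcases hp.leaf_cases hab hF.1 hG.1 hG'.1 ha hb hd with rfl | rfl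
  · exact (hcd rfl).elim
  · rw [hF.face_unique hF', hG.face_unique hG']
  · rw [hF.face_unique hG', hG.face_unique hF', Sym2.eq_swap]
  · exact (hcd rfl).elim

theorem IsArc.exists_isDiagonalOf {p : Set V} (hp : T.IsArc p) : ∃ D, T.IsDiagonalOf p D := by
  obtain ⟨a, b, hab, ha, hb, h⟩ := hp.1
  obtain ⟨d, hd⟩ := ha.exists_dart
  obtain ⟨e, he⟩ := hb.exists_dart
  exact ⟨_, a, b, _, _, hab, h.mem.1, h.mem.2, ⟨ha, d, hd, rfl⟩, ⟨hb, e, he, rfl⟩, rfl⟩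

theorem subdivision_injective : Function.Injective T.subdivision := by
  have key : ∀ {S R : T.Facet}, T.subdivision S = T.subdivision R → S.1 ⊆ R.1 := by
    intro S R h p hp
    obtain ⟨D, hD⟩ := (S.isArc hp).exists_isDiagonalOf
    obtain ⟨q, hq, hqD⟩ : D ∈ T.subdivision R := h ▸ ⟨p, hp, hD⟩
    rw [hD.arc_unique (S.isArc hp) (R.isArc hq) hqD]
    exact hq
  exact fun S R h => Subtype.ext ((key h).antisymm (key h.symm))

/-! ### The subdivision of the bottom facet -/

/-- Right turns keep the same face on the right; seen back from the final leaf, it is on the left.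
-/
theorem Thru.exists_ccwMostLeaf {p : Set V} {d : T.graph.Dart} (h : T.Thru p d)
    (hf : false ∉ T.code p d) : ∃ a ∈ p, a ∈ T.beyond d ∧ T.IsCcwMostLeaf a (T.rightFace d) := by
  induction hc : T.code p d generalizing d with
  | nil =>
    refine ⟨d.snd, h.2.2, snd_mem_beyond d, ?_, d.symm, rfl, rfl⟩
    by_contra hl
    obtain ⟨b, -, hb⟩ := h.exists_turn hl
    simp [hc] at hb
  | cons b l ih =>
    obtain ⟨hl, h1, h2⟩ := h.of_code hc
    rw [hc, List.mem_cons, not_or] at hf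
    obtain rfl : b = true := by simpa using Ne.symm hf.1
    obtain ⟨a, ha, hab, hF⟩ := ih h1 (h2 ▸ hf.2) h2
    exact ⟨a, ha, beyond_turn_subset hl hab, rightFace_turn hl ▸ hF⟩

theorem Thru.isDiagonalOf {p : Set V} {d : T.graph.Dart} (h : T.Thru p d)
    (h₁ : false ∉ T.code p d) (h₂ : false ∉ T.code p d.symm) :
    T.IsDiagonalOf p s(T.leftFace d, T.rightFace d) := by
  obtain ⟨a, ha, had, hF⟩ := h.exists_ccwMostLeaf h₁
  obtain ⟨b, hb, hbd, hG⟩ := h.symm.exists_ccwMostLeaf h₂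
  refine ⟨b, a, _, _, ?_, hb, ha, ?_, hF, rfl⟩
  · rintro rfl
    exact mem_beyond_symm.1 hbd had
  · simpa [rightFace] using hG

theorem exists_peak {p : Set V} (hp : p ∈ T.bottomSet) :
    ∃ d, T.Thru p d ∧ false ∉ T.code p d ∧ false ∉ T.code p d.symm := by
  -- Starting at an end leaf, advance as long as the arc turns left; the edge before the first right
  -- turn, or the last edge, is the one sought.
  have key : ∀ l d, T.code p d = l → T.Thru p d → false ∉ T.code p d.symm →
      ∃ e, T.Thru p e ∧ false ∉ T.code p e ∧ false ∉ T.code p e.symm := by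
    intro l
    induction l with
    | nil => exact fun d hc h h' => ⟨d, h, by simp [hc], h'⟩
    | cons b l ih =>
      intro d hc h h'
      obtain ⟨hl, h1, h2⟩ := h.of_code hc
      have h3 := h.code_back hl h1
      cases b
      · exact ih _ h2 h1 (by simpa [h3] using h')
      · refine ⟨d, h, ?_, h'⟩
        rcases hp.2.2 _ h1 with h4 | h4
        · simpa [hc, h2] using h4
        · simp [h3] at h4
  obtain ⟨d, hd⟩ := hp.1.exists_edge
  obtain ⟨e, -, he, hl⟩ := Thru.exists_end ⟨hp.1, hd⟩
  exact key _ e.symm rfl he.symm (by simp [he.code_nil hl])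

theorem leaf_cases_of_bottomSet {p : Set V} (hp : p ∈ T.bottomSet) {d : T.graph.Dart}
    (hd : T.Thru p d) (h : false ∉ T.code p d.symm) : ¬ T.IsLeaf d.snd := fun hl =>
  hp.2.1 (hd.isBoundaryArc_iff.2 (.inl ⟨by simp [hd.code_nil hl], h⟩))

theorem subdivision_bottom [Finite V] : T.subdivision T.bottom = T.dualSubdivision := by
  ext D
  constructor
  · rintro ⟨p, hp, hD⟩
    obtain ⟨d, hd, h1, h2⟩ := exists_peak hp
    refine ⟨d, leaf_cases_of_bottomSet hp hd.symm h1, leaf_cases_of_bottomSet hp hd h2, ?_⟩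
    exact hD.unique hp.1 (hd.isDiagonalOf h1 h2)
  · rintro ⟨d, h1, h2, rfl⟩
    obtain ⟨p, hp, hd, h3, h4⟩ := exists_mem_bottomSet h1 h2
    exact ⟨p, hp, hd.isDiagonalOf h3 h4⟩

/-! ### Reflection -/

variable (T) in
/-- The mirror image of a plane tree. -/
abbrev mirror : PlaneTree V where
  graph := T.graph
  isTree := T.isTree
  cw := T.cw.symm
  cw_fst := cw_symm_fst
  cw_sameCycle d d' h := (T.cw_sameCycle d d' h).inv
  degree_cond := T.degree_cond

variable (T) in
/-- The faces of a plane tree are those of its mirror image. -/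
def reflect : T.Face ≃ T.mirror.Face where
  -- Reflection exchanges the sides of an edge, so the dart is reversed, and so is `SideStep`.
  toFun := Quot.lift (fun d => T.mirror.leftFace d.symm) (by
    rintro d e ⟨hl, rfl⟩
    refine (Quot.sound ⟨?_, ?_⟩).symm
    · change ¬ T.IsLeaf (T.cw d.symm).fst
      rwa [T.cw_fst]
    · simp)
  invFun := Quot.lift (fun d : T.graph.Dart => T.leftFace d.symm) (by
    rintro d e ⟨hl, rfl⟩
    refine (Quot.sound ⟨?_, ?_⟩).symm
    · change ¬ T.IsLeaf (T.cw.symm d.symm).fst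
      rwa [cw_symm_fst]
    · simp)
  left_inv := by
    rintro ⟨d⟩
    change T.leftFace d.symm.symm = T.leftFace d
    rw [SimpleGraph.Dart.symm_symm]
  right_inv := by
    rintro ⟨d⟩
    change T.mirror.leftFace (SimpleGraph.Dart.symm (SimpleGraph.Dart.symm d)) = T.mirror.leftFace d
    rw [SimpleGraph.Dart.symm_symm]

theorem reflect_leftFace (d : T.graph.Dart) :
    T.reflect (T.leftFace d) = T.mirror.rightFace d := rfl

theorem reflect_rightFace (d : T.graph.Dart) :
    T.reflect (T.rightFace d) = T.mirror.leftFace d := by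
  change T.mirror.leftFace d.symm.symm = _
  rw [SimpleGraph.Dart.symm_symm]

theorem mirror_borders {F : T.Face} {d : T.graph.Dart} :
    T.mirror.Borders (T.reflect F) d ↔ T.Borders F d := by
  rw [Borders, Borders, ← reflect_leftFace, ← reflect_rightFace, T.reflect.apply_eq_iff_eq,
    T.reflect.apply_eq_iff_eq, or_comm]

theorem mirror_onFace {F : T.Face} {v : V} : T.mirror.OnFace v (T.reflect F) ↔ T.OnFace v F :=
  exists_congr fun _ => and_congr_right fun _ => mirror_borders

theorem mirror_turnsAtCorners {p : Set V} : T.mirror.TurnsAtCorners p ↔ T.TurnsAtCorners p := by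
  unfold TurnsAtCorners
  simp only [T.reflect.surjective.exists, mirror_borders]
  rfl

theorem mirror_isArc {p : Set V} : T.mirror.IsArc p ↔ T.IsArc p :=
  and_congr Iff.rfl mirror_turnsAtCorners

theorem mirror_isSegment {p : Set V} : T.mirror.IsSegment p ↔ T.IsSegment p :=
  and_congr Iff.rfl mirror_turnsAtCorners

theorem mirror_containsCorner {p : Set V} {v : V} {F : T.Face} :
    T.mirror.ContainsCorner p v (T.reflect F) ↔ T.ContainsCorner p v F := by
  unfold ContainsCorner
  simp only [mirror_borders]
  rfl

theorem mirror_adjacentOff {p : Set V} {F G : T.Face} :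
    T.mirror.AdjacentOff p (T.reflect F) (T.reflect G) ↔ T.AdjacentOff p F G := by
  constructor
  · rintro ⟨d, hd, hF, hG⟩
    rw [← reflect_rightFace, T.reflect.apply_eq_iff_eq] at hF
    rw [← reflect_leftFace, T.reflect.apply_eq_iff_eq] at hG
    exact ⟨d.symm, fun h => hd (edgeOf_symm.1 h), hF, by simpa [rightFace] using hG⟩
  · rintro ⟨d, hd, rfl, rfl⟩
    refine ⟨d.symm, fun h => hd (edgeOf_symm.1 h), rfl, ?_⟩
    rw [reflect_rightFace, rightFace, SimpleGraph.Dart.symm_symm]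

theorem mirror_reg {p : Set V} {F : T.Face} :
    T.mirror.Reg p (T.reflect F) = T.reflect '' T.Reg p F := by
  ext G
  constructor
  · intro h
    have h' : Relation.ReflTransGen (T.mirror.AdjacentOff p) (T.reflect F) G := h
    induction h' with
    | refl => exact ⟨F, reg_refl _ _, rfl⟩
    | @tail A B hA hAB ih =>
      obtain ⟨C, hC, rfl⟩ := ih hA
      obtain ⟨D, rfl⟩ := T.reflect.surjective B
      exact ⟨D, Relation.ReflTransGen.tail hC (mirror_adjacentOff.1 hAB), rfl⟩
  · rintro ⟨G, h, rfl⟩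
    have h' : Relation.ReflTransGen (T.AdjacentOff p) F G := h
    exact h'.lift T.reflect fun _ _ => mirror_adjacentOff.2

theorem mirror_reg_subset {p q : Set V} {F G : T.Face} :
    T.mirror.Reg p (T.reflect F) ⊆ T.mirror.Reg q (T.reflect G) ↔ T.Reg p F ⊆ T.Reg q G := by
  rw [mirror_reg, mirror_reg, Set.image_subset_image_iff T.reflect.injective]

theorem mirror_noncrossing {p q : Set V} : T.mirror.Noncrossing p q ↔ T.Noncrossing p q := by
  have key : ∀ (T : PlaneTree V) (p q : Set V), T.Noncrossing p q ↔
      ∀ s, T.IsSegment s → s ⊆ p → s ⊆ q →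
        ∃ F G, T.Reg p F ⊆ T.Reg q G ∨ T.Reg q G ⊆ T.Reg p F := by
    intro T p q
    refine forall_congr' fun s => ?_
    unfold CrossAlong IsRegion
    constructor
    · intro h h1 h2 h3
      by_contra! h4
      refine h ⟨h1, h2, h3, ?_⟩
      rintro _ _ ⟨F, rfl⟩ ⟨G, rfl⟩
      exact h4 F G
    · rintro h ⟨h1, h2, h3, h4⟩
      obtain ⟨F, G, h5⟩ := h h1 h2 h3
      have := h4 _ _ ⟨F, rfl⟩ ⟨G, rfl⟩
      tauto
  rw [key, key]
  simp only [T.reflect.surjective.exists, mirror_reg_subset, mirror_isSegment]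

theorem mirror_isBoundaryArc {p : Set V} : T.mirror.IsBoundaryArc p ↔ T.IsBoundaryArc p := by
  unfold IsBoundaryArc
  simp only [T.reflect.surjective.exists, mirror_onFace, mirror_isArc]

theorem mirror_isReducedNoncrossingSet :
    T.mirror.IsReducedNoncrossingSet = T.IsReducedNoncrossingSet := by
  ext S
  unfold IsReducedNoncrossingSet IsNoncrossingSet
  simp only [mirror_isArc, mirror_noncrossing, mirror_isBoundaryArc]

theorem mirror_marked {S : Set (Set V)} {p : Set V} {v : V} {F : T.Face} :
    T.mirror.Marked S p v (T.reflect F) ↔ T.Marked S p v F := by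
  unfold Marked
  simp only [mirror_containsCorner, mirror_reg_subset]

theorem mirror_immediatelyClockwise {v : V} {F G : T.Face}
    (h : T.mirror.ImmediatelyClockwise v (T.reflect F) (T.reflect G)) :
    T.ImmediatelyClockwise v G F := by
  obtain ⟨hl, d, rfl, hF, hG⟩ := h
  rw [← reflect_rightFace, T.reflect.apply_eq_iff_eq] at hF hG
  have hl' : ¬ T.IsLeaf (T.cw.symm d).fst := by rwa [cw_symm_fst]
  refine ⟨hl, d, rfl, ?_, hF.trans (rightFace_eq_leftFace_cw hl)⟩
  rw [hG]
  exact (rightFace_eq_leftFace_cw hl').trans (by rw [Equiv.apply_symm_apply])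

/-- The facet of a plane tree that corresponds to a facet of its mirror image. -/
def Facet.ofMirror (S : T.mirror.Facet) : T.Facet :=
  ⟨S.1, mirror_isReducedNoncrossingSet (T := T) ▸ S.2⟩

theorem FlipEdge.ofMirror {S R : T.mirror.Facet} (h : T.mirror.FlipEdge S R) :
    T.FlipEdge R.ofMirror S.ofMirror := by
  obtain ⟨p, q, hp, hq, hS, u, v, F, G, F', G', huv, h1, h2, h3, h4, h5, h6⟩ := h
  obtain ⟨F, rfl⟩ := T.reflect.surjective F
  obtain ⟨G, rfl⟩ := T.reflect.surjective G
  obtain ⟨F', rfl⟩ := T.reflect.surjective F'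
  obtain ⟨G', rfl⟩ := T.reflect.surjective G'
  rw [mirror_marked] at h1 h2 h3 h4
  have hpq : p ≠ q := fun h => hq (h ▸ hp)
  refine ⟨q, p, h3.1, ?_, ?_, u, v, F', G', F, G, huv, h3, h4, h1, h2,
    mirror_immediatelyClockwise h5, mirror_immediatelyClockwise h6⟩
  · change p ∉ R.1
    simp [hS, hpq]
  · change S.1 = (R.1 \ {q}) ∪ {p}
    rw [hS]
    ext x
    by_cases hxp : x = p <;> by_cases hxq : x = q <;> simp_all

theorem mirror_isCcwMostLeaf {a : V} {F : T.Face} :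
    T.mirror.IsCcwMostLeaf a (T.reflect F) ↔ T.IsCwMostLeaf a F := by
  refine and_congr Iff.rfl (exists_congr fun d => and_congr_right fun _ => ?_)
  rw [← T.reflect.apply_eq_iff_eq, reflect_rightFace]

theorem mirror_mem_dualSubdivision {F G : T.Face} :
    s(T.reflect F, T.reflect G) ∈ T.mirror.dualSubdivision ↔ s(F, G) ∈ T.dualSubdivision := by
  refine exists_congr fun d => and_congr_right fun _ => and_congr_right fun _ => ?_
  rw [← reflect_leftFace, ← reflect_rightFace, Sym2.eq_swap (a := T.leftFace d)]
  simp only [Sym2.eq_iff, T.reflect.apply_eq_iff_eq]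

/-! ### The largest facet -/

section Finite

variable [Finite V]

variable (T) in
/-- The facet of the arcs that first turn right and then left. -/
def top : T.Facet := T.mirror.bottom.ofMirror

theorem le_top (S : T.Facet) : S ≤ T.top := by
  have h : Relation.ReflTransGen T.mirror.FlipEdge T.mirror.bottom
    ⟨S.1, by rw [mirror_isReducedNoncrossingSet]; exact S.2⟩ := bottom_le _
  exact Relation.reflTransGen_swap.1
    (h.lift (p := Function.swap T.FlipEdge) Facet.ofMirror fun _ _ => FlipEdge.ofMirror)

/-- In the mirror image, an end leaf `a` stands for the face whose clockwise most leaf it is. The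
face whose counterclockwise most leaf is `a` comes next clockwise. -/
theorem subdivision_top : T.subdivision T.top = T.rotation T.dualSubdivision := by
  have hbot : ∀ D, D ∈ T.mirror.dualSubdivision ↔
      ∃ p ∈ T.top.1, T.mirror.IsDiagonalOf p D := by
    intro D
    rw [← subdivision_bottom]
    rfl
  have hcw : ∀ {a}, T.IsLeaf a → ∃ F, T.IsCwMostLeaf a F := by
    intro a ha
    obtain ⟨d, hd⟩ := ha.exists_dart
    exact ⟨_, ha, d, hd, rfl⟩
  ext D
  constructor
  · rintro ⟨p, hp, a, b, F', G', hab, ha, hb, hF', hG', rfl⟩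
    obtain ⟨F, hF⟩ := hcw hF'.1
    obtain ⟨G, hG⟩ := hcw hG'.1
    refine ⟨F, G, F', G', ?_, ⟨a, hF, hF'⟩, ⟨b, hG, hG'⟩, rfl⟩
    rw [← mirror_mem_dualSubdivision, hbot]
    exact ⟨p, hp, a, b, _, _, hab, ha, hb, mirror_isCcwMostLeaf.2 hF, mirror_isCcwMostLeaf.2 hG,
      rfl⟩
  · rintro ⟨F, G, F', G', h, ⟨a, ha, hF'⟩, ⟨b, hb, hG'⟩, rfl⟩
    rw [← mirror_mem_dualSubdivision, hbot] at h
    obtain ⟨p, hp, c, d, A, B, hcd, hc, hd, hA, hB, h⟩ := h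
    rw [← mirror_isCcwMostLeaf] at ha hb
    rcases Sym2.eq_iff.1 h with ⟨rfl, rfl⟩ | ⟨rfl, rfl⟩
    · obtain rfl := ha.leaf_unique hA
      obtain rfl := hb.leaf_unique hB
      exact ⟨p, hp, a, b, _, _, hcd, hc, hd, hF', hG', rfl⟩
    · obtain rfl := ha.leaf_unique hB
      obtain rfl := hb.leaf_unique hA
      exact ⟨p, hp, a, b, _, _, hcd.symm, hd, hc, hF', hG', rfl⟩

end Finite

end PlaneTree

theorem theorem7p4 {V : Type*} [Finite V] (T : PlaneTree V) :
    -- reachability in the oriented flip graph is a partial order on the facets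
    (∀ S₁ S₂ : T.Facet, S₁ ≤ S₂ → S₂ ≤ S₁ → S₁ = S₂) ∧
    -- a facet is determined by its polygonal subdivision
    Function.Injective T.subdivision ∧
    -- the bottom element corresponds to the subdivision dual to the tree
    (∃ B : T.Facet, IsBot B ∧ T.subdivision B = T.dualSubdivision) ∧
    -- the top element corresponds to the rotation of that subdivision
    (∃ M : T.Facet, IsTop M ∧ T.subdivision M = T.rotation T.dualSubdivision) := by
  exact ⟨fun _ _ => PlaneTree.Facet.le_antisymm, PlaneTree.subdivision_injective,
    ⟨T.bottom, PlaneTree.bottom_le, PlaneTree.subdivision_bottom⟩,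
    ⟨T.top, PlaneTree.le_top, PlaneTree.subdivision_top⟩⟩
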